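/- **Setting.** Let $q>0$, $c_o>0$, $h,g\in C([0,1];\mathbb C)$, $S_r\in\mathbb C^{n_r\times n_r}$, $S_d\in\mathbb C^{n_d\times n_d}$, $q_r\in\mathbb C^{n_r}$, $q_{d_1},q_{d_2}\in\mathbb C^{n_d}$. Consider the plant $$z_t=-iz_{xx}+h(x)z+g(x)d_1(t)\ (0<x<1),\quad z_x(0,t)=-iqz(0,t)+d_2(t),\quad z_x(1,t)=u(t),\quad y_m(t)=z(1,t)$$ in $L^2[0,1]$, with control $u$, and the exosystem $\dot w_r=S_rw_r$, $\dot w_d=S_dw_d$, $r=q_r^\top w_r$, $d_1=q_{d_1}^\top w_d$, $d_2=q_{d_2}^\top w_d$. For gains $l_r\in\mathbb C^{n_r}$, $l_d\in\mathbb C^{n_d}$, $l:[0,1]\to\mathbb C$, $l_0\in\mathbb C$ consider the reference observer $\dot{\widehat w}_r=S_r\widehat w_r+l_r(q_r^\top\widehat w_r-r)$ and the disturbance/state observer $$\dot{\widehat w}_d=S_d\widehat w_d+l_d(\widehat z(1,t)-y_m),\qquad \widehat z_t=-i\widehat z_{xx}+h\widehat z+g\,q_{d_1}^\top\widehat w_d+l(x)(\widehat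 z(1,t)-y_m),$$ $$\widehat z_x(0,t)=-iq\widehat z(0,t)+q_{d_2}^\top\widehat w_d,\qquad \widehat z_x(1,t)=u+l_0(\widehat z(1,t)-y_m).$$ A classical solution on $[0,\infty)$ of the plant with exosystem (respectively of the observer) has $z$ (respectively $\widehat z$) in $C^1([0,\infty);L^2[0,1])$ with values in $H^2(0,1)$ and satisfies the equations for all $t\ge0$, with $u,y_m$ continuous. A generalized solution is a limit of classical ones, where the states converge uniformly on every $[0,\tau]$ and $u,y_m$ converge in $L^2[0,\tau]$ for every $\tau$. **Design of the gains.** Let $p$, of class $C^1$ on the closed triangle $0\le x\le\xi\le1$, solve $$p_{\xi\xi}-p_{xx}=i(h(x)+c_o)p,\qquad p_x(0,\xi)+iq\,p(0,\xi)=0,\qquad p(x,x)=-\tfrac i2\int_0^x(h(s)+c_o)\,ds-iq ,$$ where, $h$ being only continuous, the left side of the first equation is read as $(\partial_x+\partial_\xi)(p_\xi-p_x)$, with $\partial_x+\partial_\xi$ the derivative in the direction $(1,1)$. Put $\mathcal F_o[f](x)=f(x)-\int_x^1p(x,\xi)f(\xi)\,d\xi$. Let $n\in C^2([0,1];\mathbb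 C^{n_d})$ solve $$i\,n''(x)^\top+n(x)^\top S_d+c_o\,n(x)^\top=\mathcal F_o^{-1}[g](x)\,q_{d_1}^\top,\qquad n'(0)=q_{d_2},\quad n'(1)=0 .$$ The gains are $l(x)=\mathcal F_o[n^\top l_d](x)-ip_\xi(x,1)$ and $l_0=p(1,1)$. **Theorem.** Let $\sigma_o=\{ij^2\pi^2-c_o: j=0,1,2,\dots\}$ (the eigenvalues of $\phi\mapsto-i\phi''-c_o\phi$ with $\phi'(0)=\phi'(1)=0$) and assume $\sigma_o\cap\sigma(S_d)=\emptyset$. Then $p$ and $n$ exist and are unique. Let $l_r,l_d$ be such that $S_r+l_rq_r^\top$ and $S_d+l_dn(1)^\top$ are Hurwitz, each with algebraically simple eigenvalues, and have no common eigenvalue, and let $l,l_0$ be the gains above. Then the two observers together are an observer for the plant with exosystem, with exponentially stable error dynamics. More precisely, there are a strongly continuous semigroup $T$ on $X=\mathbb C^{n_r}\times\mathbb C^{n_d}\times L^2[0,1]$ and constants $M\ge1$, $\mu>0$ such that the following hold. 1. The generator of $T$ is exactly the operator of the error system $$\dot{\widetilde w}_r=(S_r+l_rq_r^\top)\widetilde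 w_r,\quad \dot{\widetilde w}_d=S_d\widetilde w_d+l_d\widetilde z(1,t),\quad \widetilde z_t=-i\widetilde z_{xx}+h\widetilde z+g\,q_{d_1}^\top\widetilde w_d+l\,\widetilde z(1,t),$$ $$\widetilde z_x(0,t)=-iq\widetilde z(0,t)+q_{d_2}^\top\widetilde w_d,\qquad \widetilde z_x(1,t)=l_0\widetilde z(1,t),$$ whose domain consists of all states with $\widetilde z\in H^2(0,1)$ that satisfy the two boundary conditions. Moreover $\|T(t)X_0\|\le Me^{-\mu t}\|X_0\|$ for all $t\ge0$, $X_0\in X$. 2. Along every generalized (in particular, every classical) solution of the exosystem, plant and observers, the error $E(t)=(\widehat w_r-w_r,\widehat w_d-w_d,\widehat z-z)(t)$ satisfies $E(t)=T(t)E(0)$ and $\|E(t)\|\le Me^{-\mu t}\|E(0)\|$ for all $t\ge0$. 3. For every generalized solution of the plant with exosystem and every initial observer state in $X$, there is exactly one evolution on $[0,\infty)$ of the observer state that starts there and forms with it a generalized solution of the coupled system. For every classical solution of the plant with exosystem and every initial observer state whose $\widehat z$-component lies in $H^2(0,1)$ and satisfies the observer's boundary conditions at $t=0$, there is exactly one classical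 solution of the observer on $[0,\infty)$ that starts there. -/

import Mathlib

open MeasureTheory Filter Topology Set
open scoped Matrix

noncomputable section

namespace SchObs

/-! ### Function spaces -/

/-- Lebesgue measure on the interval `[0,1]`. -/
abbrev mu01 : Measure ℝ := volume.restrict (Icc (0 : ℝ) 1)

/-- The energy space `L²[0,1]` of complex-valued functions. -/
abbrev L2I : Type := Lp ℂ 2 mu01

/-- `F ∈ H²(0,1)`: the class `F` is represented on `[0,1]` by the `C¹` function `f`, whose derivative
`f1` is absolutely continuous with derivative `f2 ∈ L²`.  Then `F' = f1`, `F'' = f2`, and the boundary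
values `F(0), F'(0), F(1), F'(1)` are `f 0, f1 0, f 1, f1 1`. -/
structure IsH2Jet (F : L2I) (f f1 f2 : ℝ → ℂ) : Prop where
  rep : (F : ℝ → ℂ) =ᵐ[mu01] f
  memLp : MemLp f2 2 mu01
  deriv_one : ∀ x ∈ Icc (0 : ℝ) 1, f x = f 0 + ∫ t in (0 : ℝ)..x, f1 t
  deriv_two : ∀ x ∈ Icc (0 : ℝ) 1, f1 x = f1 0 + ∫ t in (0 : ℝ)..x, f2 t

/-! ### Data of the plant and of the exosystem -/

/-- The parameters of the plant
`z_t = -i z_xx + h z + g d₁`, `z_x(0) = -i q z(0) + d₂`, `z_x(1) = u`, `y_m = z(1)`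
and of the exosystem `w_r' = S_r w_r`, `w_d' = S_d w_d`, `r = q_rᵀ w_r`, `d₁ = q_{d1}ᵀ w_d`,
`d₂ = q_{d2}ᵀ w_d`. -/
structure PlantData (nr nd : ℕ) where
  q : ℝ
  h : ℝ → ℂ
  g : ℝ → ℂ
  Sr : Matrix (Fin nr) (Fin nr) ℂ
  Sd : Matrix (Fin nd) (Fin nd) ℂ
  qr : Fin nr → ℂ
  qd1 : Fin nd → ℂ
  qd2 : Fin nd → ℂ

/-- The observer gains `l_r`, `l_d`, `l(·)`, `l₀`. -/
structure Gains (nr nd : ℕ) where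
  lr : Fin nr → ℂ
  ld : Fin nd → ℂ
  l : ℝ → ℂ
  l0 : ℂ

variable {nr nd : ℕ}

/-- Action of a square matrix on a Euclidean vector. -/
def act {n : ℕ} (A : Matrix (Fin n) (Fin n) ℂ) (v : EuclideanSpace ℂ (Fin n)) :
    EuclideanSpace ℂ (Fin n) := WithLp.toLp 2 (A *ᵥ v.ofLp)

/-! ### Design of the gains -/

/-- The closed triangle `0 ≤ x ≤ ξ ≤ 1`. -/
def triangle : Set (ℝ × ℝ) := {z | 0 ≤ z.1 ∧ z.1 ≤ z.2 ∧ z.2 ≤ 1}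

/-- `p` is a solution, of class `C¹` up to the boundary of the triangle `0 ≤ x ≤ ξ ≤ 1` and with
partial derivatives `px`, `pξ`, of the kernel equations
* `p_ξξ - p_xx = i (h(x) + c) p`,
* `p_x(0,ξ) + i q p(0,ξ) = 0`,
* `p(x,x) = -(i/2) ∫₀ˣ (h + c) - i q`.

Since `h` is only continuous, `p` need not have separate second derivatives.  The wave operator is
therefore read in the factored form `p_ξξ - p_xx = (∂_x + ∂_ξ) (p_ξ - p_x)`, where `∂_x + ∂_ξ` is the
derivative along the characteristic direction `(1,1)`; for `p` of class `C²` this is the same. -/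
structure IsKernel (P : PlantData nr nd) (c : ℝ) (p px pξ : ℝ × ℝ → ℂ) : Prop where
  cont : ContinuousOn p triangle
  cont_x : ContinuousOn px triangle
  cont_ξ : ContinuousOn pξ triangle
  partial_x : ∀ x ξ : ℝ, 0 < x → x < ξ → ξ < 1 →
    HasDerivAt (fun s : ℝ => p (s, ξ)) (px (x, ξ)) x
  partial_ξ : ∀ x ξ : ℝ, 0 < x → x < ξ → ξ < 1 →
    HasDerivAt (fun s : ℝ => p (x, s)) (pξ (x, ξ)) ξ
  wave : ∀ x ξ : ℝ, 0 < x → x < ξ → ξ < 1 →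
    HasDerivAt (fun s : ℝ => pξ (x + s, ξ + s) - px (x + s, ξ + s))
      (Complex.I * (P.h x + (c : ℂ)) * p (x, ξ)) 0
  left : ∀ ξ ∈ Icc (0 : ℝ) 1, px (0, ξ) + Complex.I * (P.q : ℂ) * p (0, ξ) = 0
  diag : ∀ x ∈ Icc (0 : ℝ) 1,
    p (x, x) = -(Complex.I / 2) * (∫ s in (0 : ℝ)..x, (P.h s + (c : ℂ))) - Complex.I * (P.q : ℂ)

/-- The backstepping transformation `F_o[f](x) = f(x) - ∫ₓ¹ p(x,ξ) f(ξ) dξ`. -/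
def backstep (p : ℝ × ℝ → ℂ) (f : ℝ → ℂ) (x : ℝ) : ℂ :=
  f x - ∫ ξ in x..(1 : ℝ), p (x, ξ) * f ξ

/-- `n : [0,1] → ℂ^{n_d}` is a `C²` solution of
`i n''ᵀ + nᵀ S_d + c nᵀ = F_o⁻¹[g] q_{d1}ᵀ`, `n'(0) = q_{d2}`, `n'(1) = 0`.
Here `γ = F_o⁻¹[g]`. -/
def IsProfile (P : PlantData nr nd) (c : ℝ) (p : ℝ × ℝ → ℂ) (n : ℝ → Fin nd → ℂ) : Prop :=
  ∃ (γ : ℝ → ℂ) (n1 n2 : ℝ → Fin nd → ℂ),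
    ContinuousOn γ (Icc 0 1) ∧
    (∀ x ∈ Icc (0 : ℝ) 1, backstep p γ x = P.g x) ∧
    ContinuousOn n2 (Icc 0 1) ∧
    (∀ x ∈ Icc (0 : ℝ) 1, HasDerivWithinAt n (n1 x) (Icc 0 1) x) ∧
    (∀ x ∈ Icc (0 : ℝ) 1, HasDerivWithinAt n1 (n2 x) (Icc 0 1) x) ∧
    (∀ x ∈ Icc (0 : ℝ) 1,
      Complex.I • n2 x + n x ᵥ* P.Sd + (c : ℂ) • n x = γ x • P.qd1) ∧
    n1 0 = P.qd2 ∧ n1 1 = 0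

/-- The designed gains `l(x) = F_o[nᵀ l_d](x) - i p_ξ(x,1)`, `l₀ = p(1,1)`. -/
def designedGains (p pξ : ℝ × ℝ → ℂ) (n : ℝ → Fin nd → ℂ) (lr : Fin nr → ℂ) (ld : Fin nd → ℂ) :
    Gains nr nd where
  lr := lr
  ld := ld
  l := fun x => backstep p (fun ξ => n ξ ⬝ᵥ ld) x - Complex.I * pξ (x, 1)
  l0 := p (1, 1)

/-- All eigenvalues have negative real part. -/
def IsHurwitz {n : ℕ} (A : Matrix (Fin n) (Fin n) ℂ) : Prop :=
  ∀ lam ∈ spectrum ℂ A, lam.re < 0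

/-- All eigenvalues are (algebraically) simple. -/
def HasSimpleEigenvalues {n : ℕ} (A : Matrix (Fin n) (Fin n) ℂ) : Prop :=
  A.charpoly.roots.Nodup

/-! ### The error dynamics -/

/-- The Hilbert space `ℂ^{n_r} × ℂ^{n_d} × L²[0,1]`. -/
abbrev StateSpace (nr nd : ℕ) : Type :=
  WithLp 2 (EuclideanSpace ℂ (Fin nr) × WithLp 2 (EuclideanSpace ℂ (Fin nd) × L2I))

/-- The element `(a, b, F)` of the state space. -/
def mkState (a : EuclideanSpace ℂ (Fin nr)) (b : EuclideanSpace ℂ (Fin nd)) (F : L2I) :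
    StateSpace nr nd := WithLp.toLp 2 (a, WithLp.toLp 2 (b, F))

/-- Graph of the operator of the error dynamics
`w_r' = (S_r + l_r q_rᵀ) w_r`, `w_d' = S_d w_d + l_d z(1)`,
`z_t = -i z_xx + h z + g q_{d1}ᵀ w_d + l z(1)`,
`z_x(0) = -i q z(0) + q_{d2}ᵀ w_d`, `z_x(1) = l₀ z(1)`:
`ErrorOp P K X Y` says that `X` lies in the domain and is mapped to `Y`. -/
def ErrorOp (P : PlantData nr nd) (K : Gains nr nd) (X Y : StateSpace nr nd) : Prop :=
  ∃ f f1 f2 : ℝ → ℂ,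
    IsH2Jet X.snd.snd f f1 f2 ∧
    f1 0 = -Complex.I * (P.q : ℂ) * f 0 + P.qd2 ⬝ᵥ X.snd.fst.ofLp ∧
    f1 1 = K.l0 * f 1 ∧
    Y.fst = act (P.Sr + Matrix.vecMulVec K.lr P.qr) X.fst ∧
    Y.snd.fst = act P.Sd X.snd.fst + f 1 • WithLp.toLp 2 K.ld ∧
    (Y.snd.snd : ℝ → ℂ) =ᵐ[mu01] fun x =>
      -Complex.I * f2 x + P.h x * f x + P.g x * (P.qd1 ⬝ᵥ X.snd.fst.ofLp) + K.l x * f 1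

/-- `(T t)_{t ≥ 0}` is a strongly continuous semigroup (values at negative times are irrelevant). -/
structure IsC0Semigroup {E : Type*} [NormedAddCommGroup E] [NormedSpace ℂ E] (T : ℝ → E →L[ℂ] E) :
    Prop where
  zero : T 0 = ContinuousLinearMap.id ℂ E
  add : ∀ s t : ℝ, 0 ≤ s → 0 ≤ t → T (s + t) = (T s).comp (T t)
  cont : ∀ x : E, ContinuousOn (fun t => T t x) (Ici 0)

/-- The relation `G` is the graph of the infinitesimal generator of `T`. -/
def IsGeneratorOf {E : Type*} [NormedAddCommGroup E] [NormedSpace ℂ E] (G : E → E → Prop)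
    (T : ℝ → E →L[ℂ] E) : Prop :=
  ∀ x y : E, G x y ↔ Tendsto (fun t : ℝ => (t : ℂ)⁻¹ • (T t x - x)) (𝓝[>] 0) (𝓝 y)

/-! ### Solutions of the plant with exosystem, and of the observer -/

/-- Classical solutions, on `[0,∞)`, of the exosystem and the plant, with control `u` and
measurement `y`. -/
structure IsPlantSolution (P : PlantData nr nd) (wr : ℝ → EuclideanSpace ℂ (Fin nr))
    (wd : ℝ → EuclideanSpace ℂ (Fin nd)) (z : ℝ → L2I) (u y : ℝ → ℂ) : Prop where
  cont_u : ContinuousOn u (Ici 0)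
  cont_y : ContinuousOn y (Ici 0)
  ode_r : ∀ t : ℝ, 0 ≤ t → HasDerivWithinAt wr (act P.Sr (wr t)) (Ici 0) t
  ode_d : ∀ t : ℝ, 0 ≤ t → HasDerivWithinAt wd (act P.Sd (wd t)) (Ici 0) t
  pde : ∃ z' : ℝ → L2I, ContinuousOn z' (Ici 0) ∧ ∀ t : ℝ, 0 ≤ t →
    HasDerivWithinAt z (z' t) (Ici 0) t ∧
    ∃ f f1 f2 : ℝ → ℂ, IsH2Jet (z t) f f1 f2 ∧
      ((z' t : ℝ → ℂ) =ᵐ[mu01] fun x =>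
        -Complex.I * f2 x + P.h x * f x + P.g x * (P.qd1 ⬝ᵥ (wd t).ofLp)) ∧
      f1 0 = -Complex.I * (P.q : ℂ) * f 0 + P.qd2 ⬝ᵥ (wd t).ofLp ∧
      f1 1 = u t ∧
      y t = f 1

/-- Compatibility of an initial state `(b, F)` of the observer with the values `u0`, `y0` of its
inputs at time `0`: `F ∈ H²(0,1)` satisfies the boundary conditions of the observer. -/
def ObserverCompatible (P : PlantData nr nd) (K : Gains nr nd) (u0 y0 : ℂ)
    (b : EuclideanSpace ℂ (Fin nd)) (F : L2I) : Prop :=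
  ∃ f f1 f2 : ℝ → ℂ, IsH2Jet F f f1 f2 ∧
    f1 0 = -Complex.I * (P.q : ℂ) * f 0 + P.qd2 ⬝ᵥ b.ofLp ∧
    f1 1 = u0 + K.l0 * (f 1 - y0)

/-- Classical solutions, on `[0,∞)`, of the reference observer
`w_r' = S_r w_r + l_r (q_rᵀ w_r - r)` and of the disturbance/state observer
`w_d' = S_d w_d + l_d (z(1) - y)`, `z_t = -i z_xx + h z + g q_{d1}ᵀ w_d + l (z(1) - y)`,
`z_x(0) = -i q z(0) + q_{d2}ᵀ w_d`, `z_x(1) = u + l₀ (z(1) - y)`, with the inputs `r`, `u`, `y`. -/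
structure IsObserverSolution (P : PlantData nr nd) (K : Gains nr nd) (r u y : ℝ → ℂ)
    (wr : ℝ → EuclideanSpace ℂ (Fin nr)) (wd : ℝ → EuclideanSpace ℂ (Fin nd)) (z : ℝ → L2I) :
    Prop where
  ode_r : ∀ t : ℝ, 0 ≤ t → HasDerivWithinAt wr
    (act P.Sr (wr t) + (P.qr ⬝ᵥ (wr t).ofLp - r t) • WithLp.toLp 2 K.lr) (Ici 0) t
  pde : ∃ z' : ℝ → L2I, ContinuousOn z' (Ici 0) ∧ ∀ t : ℝ, 0 ≤ t →
    HasDerivWithinAt z (z' t) (Ici 0) t ∧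
    ∃ f f1 f2 : ℝ → ℂ, IsH2Jet (z t) f f1 f2 ∧
      HasDerivWithinAt wd (act P.Sd (wd t) + (f 1 - y t) • WithLp.toLp 2 K.ld) (Ici 0) t ∧
      ((z' t : ℝ → ℂ) =ᵐ[mu01] fun x =>
        -Complex.I * f2 x + P.h x * f x + P.g x * (P.qd1 ⬝ᵥ (wd t).ofLp)
          + K.l x * (f 1 - y t)) ∧
      f1 0 = -Complex.I * (P.q : ℂ) * f 0 + P.qd2 ⬝ᵥ (wd t).ofLp ∧
      f1 1 = u t + K.l0 * (f 1 - y t)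

/-- Uniform convergence on every `[0,τ]`. -/
def ConvUniform {E : Type*} [NormedAddCommGroup E] (a : ℕ → ℝ → E) (b : ℝ → E) : Prop :=
  ∀ τ : ℝ, TendstoUniformlyOn a b atTop (Icc 0 τ)

/-- Convergence in `L²[0,τ]` for every `τ`, to a limit in `L²_loc[0,∞)`. -/
def ConvL2loc (a : ℕ → ℝ → ℂ) (b : ℝ → ℂ) : Prop :=
  ∀ τ : ℝ, MemLp b 2 (volume.restrict (Icc 0 τ)) ∧
    Tendsto (fun k => eLpNorm (a k - b) 2 (volume.restrict (Icc 0 τ))) atTop (𝓝 0)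

/-- Generalized solutions of the exosystem and the plant: limits of classical ones. -/
def IsGenPlantSolution (P : PlantData nr nd) (wr : ℝ → EuclideanSpace ℂ (Fin nr))
    (wd : ℝ → EuclideanSpace ℂ (Fin nd)) (z : ℝ → L2I) (u y : ℝ → ℂ) : Prop :=
  ∃ (wrk : ℕ → ℝ → EuclideanSpace ℂ (Fin nr)) (wdk : ℕ → ℝ → EuclideanSpace ℂ (Fin nd))
    (zk : ℕ → ℝ → L2I) (uk yk : ℕ → ℝ → ℂ),
    (∀ k, IsPlantSolution P (wrk k) (wdk k) (zk k) (uk k) (yk k)) ∧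
    ConvUniform wrk wr ∧ ConvUniform wdk wd ∧ ConvUniform zk z ∧
    ConvL2loc uk u ∧ ConvL2loc yk y

/-- Generalized solutions of the exosystem, the plant and the observer (whose state is written
with the suffix `h`) interconnected through `r`, `u`, `y`: limits of classical ones. -/
def IsGenCoupledSolution (P : PlantData nr nd) (K : Gains nr nd)
    (wr : ℝ → EuclideanSpace ℂ (Fin nr)) (wd : ℝ → EuclideanSpace ℂ (Fin nd)) (z : ℝ → L2I)
    (u y : ℝ → ℂ)
    (wrh : ℝ → EuclideanSpace ℂ (Fin nr)) (wdh : ℝ → EuclideanSpace ℂ (Fin nd)) (zh : ℝ → L2I) :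
    Prop :=
  ∃ (wrk : ℕ → ℝ → EuclideanSpace ℂ (Fin nr)) (wdk : ℕ → ℝ → EuclideanSpace ℂ (Fin nd))
    (zk : ℕ → ℝ → L2I) (uk yk : ℕ → ℝ → ℂ)
    (wrhk : ℕ → ℝ → EuclideanSpace ℂ (Fin nr)) (wdhk : ℕ → ℝ → EuclideanSpace ℂ (Fin nd))
    (zhk : ℕ → ℝ → L2I),
    (∀ k, IsPlantSolution P (wrk k) (wdk k) (zk k) (uk k) (yk k) ∧
      IsObserverSolution P K (fun t => P.qr ⬝ᵥ (wrk k t).ofLp) (uk k) (yk k)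
        (wrhk k) (wdhk k) (zhk k)) ∧
    ConvUniform wrk wr ∧ ConvUniform wdk wd ∧ ConvUniform zk z ∧
    ConvL2loc uk u ∧ ConvL2loc yk y ∧
    ConvUniform wrhk wrh ∧ ConvUniform wdhk wdh ∧ ConvUniform zhk zh

/-- The observer errors `(ŵ_r - w_r, ŵ_d - w_d, ẑ - z)` at time `t`. -/
def obsError (wr : ℝ → EuclideanSpace ℂ (Fin nr)) (wd : ℝ → EuclideanSpace ℂ (Fin nd)) (z : ℝ → L2I)
    (wrh : ℝ → EuclideanSpace ℂ (Fin nr)) (wdh : ℝ → EuclideanSpace ℂ (Fin nd)) (zh : ℝ → L2I)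
    (t : ℝ) : StateSpace nr nd :=
  mkState (wrh t - wr t) (wdh t - wd t) (zh t - z t)

end SchObs

end

open SchObs

/-! Subtracting the plant from the observers, the input `u` and the measurement `y` cancel, and the
errors obey an autonomous linear system. Its reference part is decoupled and governed by a Hurwitz
matrix. For the rest, write z̃ = F_o[v] and v = e + nᵀw̃_d. The kernel equations make F_o intertwine
-i∂ₓₓ - c_o with -i∂ₓₓ + h up to edge terms, which the gains l and l₀ compensate; the profile n then
absorbs the disturbance, both in the equation and at x = 0. What remains is e_t = -i e_xx - c_o e
with homogeneous Neumann conditions, which feeds w̃_d' = (S_d + l_d n(1)ᵀ) w̃_d + l_d e(1).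

The trace e(1) is unbounded on L². By Green's formula the bounded functional m(e) = (i/2)∫x²e
satisfies m(e)' = ∫e - e(1) - c_o m(e) along the flow (`momentMap_neumann`), so w̃_d + l_d m(e)
obeys an equation driven by e through a bounded operator only. The cascade is then solved by
Duhamel's formula (`exists_triangular_semigroup`). The cosines diagonalize the Neumann part with its
exact domain (`neumannOp_iff`), all eigenvalues having real part -c_o (`exists_diagonal_semigroup`);
matrices with simple spectrum are diagonalizable and decay like their eigenvalues. The change of
variables is an isomorphism of the state space that carries the target operator exactly to the error
operator (`errorOp_iff_targetOp`), so semigroup, generator and decay are all transported.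

In the characteristic coordinates a = (x+ξ)/2, s = (ξ-x)/2 the kernel problem is equivalent to a
Volterra-type integral equation, solved by contraction in a weighted norm
(`exists_goursat_solution`, `IsKernel.goursat`). Since h is only continuous, p has no separate
second derivatives. That F_o nevertheless preserves H² rests on reflecting ξ in [x,1], after which
only the derivative of p_ξ - p_x in the direction (1,1) is needed
(`IsKernel.hasDerivWithinAt_volt_sub`). The profile n comes from shooting: σ_o ∩ σ(S_d) = ∅ makes
the homogeneous Neumann problem uniquely solvable, and in finite dimension injectivity gives
surjectivity.

Finally, every classical error is a classical solution of the Cauchy problem, hence an orbit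
(`IsGeneratorOf.eq_orbit`); conversely plant plus orbit is an observer solution. Generalized
solutions follow by limits, with density of the generator's domain. -/

noncomputable section

namespace SchObs

variable {nr nd : ℕ}

/-! ### Strongly continuous semigroups -/

section Semigroup

variable {E F W : Type*} [NormedAddCommGroup E] [NormedSpace ℂ E]
  [NormedAddCommGroup F] [NormedSpace ℂ F] [NormedAddCommGroup W] [NormedSpace ℂ W]

/-- Exponential stability of a family of operators. -/
def IsExpStable (T : ℝ → E →L[ℂ] E) : Prop :=
  ∃ M μ : ℝ, 1 ≤ M ∧ 0 < μ ∧
    ∀ t : ℝ, 0 ≤ t → ∀ x : E, ‖T t x‖ ≤ M * Real.exp (-μ * t) * ‖x‖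

theorem smul_inv_ofReal (t : ℝ) (x : E) : ((t : ℂ)⁻¹) • x = t⁻¹ • x := by
  rw [← Complex.ofReal_inv, Complex.coe_smul]

/-- Transport of a family of operators along an isomorphism. -/
def conjFamily (Φ : E ≃L[ℂ] F) (T : ℝ → E →L[ℂ] E) (t : ℝ) : F →L[ℂ] F :=
  (Φ : E →L[ℂ] F).comp ((T t).comp (Φ.symm : F →L[ℂ] E))

theorem conjFamily_apply (Φ : E ≃L[ℂ] F) (T : ℝ → E →L[ℂ] E) (t : ℝ) (x : F) :
    conjFamily Φ T t x = Φ (T t (Φ.symm x)) := rfl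

theorem IsC0Semigroup.conj {T : ℝ → E →L[ℂ] E} (hT : IsC0Semigroup T) (Φ : E ≃L[ℂ] F) :
    IsC0Semigroup (conjFamily Φ T) where
  zero := by ext x; simp [conjFamily_apply, hT.zero]
  add s t hs ht := by ext x; simp [conjFamily_apply, hT.add s t hs ht]
  cont x := Φ.continuous.comp_continuousOn (hT.cont (Φ.symm x))

theorem IsGeneratorOf.conj {G : E → E → Prop} {T : ℝ → E →L[ℂ] E} (hG : IsGeneratorOf G T)
    (Φ : E ≃L[ℂ] F) :
    IsGeneratorOf (fun x y => G (Φ.symm x) (Φ.symm y)) (conjFamily Φ T) := by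
  intro x y
  refine (hG _ _).trans ?_
  rw [Φ.symm.toHomeomorph.isInducing.tendsto_nhds_iff]
  simp [Function.comp_def, conjFamily_apply]

theorem IsExpStable.conj {T : ℝ → E →L[ℂ] E} (hT : IsExpStable T) (Φ : E ≃L[ℂ] F) :
    IsExpStable (conjFamily Φ T) := by
  obtain ⟨M, μ, hM, hμ, h⟩ := hT
  refine ⟨max 1 (‖(Φ : E →L[ℂ] F)‖ * M * ‖(Φ.symm : F →L[ℂ] E)‖), μ, le_max_left _ _, hμ,
    fun t ht x => ?_⟩
  calc ‖Φ (T t (Φ.symm x))‖ ≤ ‖(Φ : E →L[ℂ] F)‖ * ‖T t (Φ.symm x)‖ :=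
        (Φ : E →L[ℂ] F).le_opNorm _
    _ ≤ ‖(Φ : E →L[ℂ] F)‖ * (M * Real.exp (-μ * t) * (‖(Φ.symm : F →L[ℂ] E)‖ * ‖x‖)) := by
        gcongr
        exact (h t ht _).trans (by gcongr; exact (Φ.symm : F →L[ℂ] E).le_opNorm x)
    _ = (‖(Φ : E →L[ℂ] F)‖ * M * ‖(Φ.symm : F →L[ℂ] E)‖) * Real.exp (-μ * t) * ‖x‖ := by ring
    _ ≤ _ := by gcongr; exact le_max_right _ _

theorem IsGeneratorOf.tendsto_slope {G : E → E → Prop} {T : ℝ → E →L[ℂ] E}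
    (hG : IsGeneratorOf G T) {x y : E} (h : G x y) :
    Tendsto (fun t : ℝ => t⁻¹ • (T t x - x)) (𝓝[>] 0) (𝓝 y) := by
  simpa only [smul_inv_ofReal] using (hG x y).1 h

theorem IsGeneratorOf.of_tendsto_slope {G : E → E → Prop} {T : ℝ → E →L[ℂ] E}
    (hG : IsGeneratorOf G T) {x y : E}
    (h : Tendsto (fun t : ℝ => t⁻¹ • (T t x - x)) (𝓝[>] 0) (𝓝 y)) : G x y :=
  (hG x y).2 (by simpa only [smul_inv_ofReal] using h)

/-- The orbit of an element of the domain stays in the domain. -/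
theorem IsGeneratorOf.orbit_mem {G : E → E → Prop} {T : ℝ → E →L[ℂ] E} (hT : IsC0Semigroup T)
    (hG : IsGeneratorOf G T) {x y : E} (h : G x y) {t : ℝ} (ht : 0 ≤ t) : G (T t x) (T t y) := by
  apply hG.of_tendsto_slope
  have := ((T t).continuous.tendsto y).comp (hG.tendsto_slope h)
  refine this.congr' ?_
  filter_upwards [self_mem_nhdsWithin] with s hs
  have hs : (0 : ℝ) ≤ s := le_of_lt hs
  have h1 : T s (T t x) = T t (T s x) := by
    have := hT.add s t hs ht
    rw [add_comm, hT.add t s ht hs] at this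
    exact (DFunLike.congr_fun this x).symm
  simp only [Function.comp_apply]
  rw [h1, ← map_sub, ← Complex.coe_smul, ← Complex.coe_smul, map_smul]

theorem IsC0Semigroup.apply_add {T : ℝ → E →L[ℂ] E} (hT : IsC0Semigroup T) {s t : ℝ}
    (hs : 0 ≤ s) (ht : 0 ≤ t) (x : E) : T (s + t) x = T s (T t x) := by
  rw [hT.add s t hs ht]; rfl

/-- Forward orbits are right differentiable. -/
theorem IsGeneratorOf.hasDerivWithinAt_right {G : E → E → Prop} {T : ℝ → E →L[ℂ] E}
    (hT : IsC0Semigroup T) (hG : IsGeneratorOf G T) {x y : E} (h : G x y) {t : ℝ} (ht : 0 ≤ t) :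
    HasDerivWithinAt (fun s => T s x) (T t y) (Ici t) t := by
  rw [hasDerivWithinAt_iff_tendsto_slope, Ici_sdiff_left]
  have h1 := hG.tendsto_slope (hG.orbit_mem hT h ht)
  have h2 : Tendsto (fun s : ℝ => s - t) (𝓝[>] t) (𝓝[>] 0) := by
    refine tendsto_nhdsWithin_iff.2 ⟨?_, ?_⟩
    · exact ((continuous_id.sub continuous_const).tendsto' t 0 (by simp)).mono_left
        nhdsWithin_le_nhds
    · filter_upwards [self_mem_nhdsWithin] with s hs
      exact sub_pos.2 (mem_Ioi.1 hs)
  refine (h1.comp h2).congr' ?_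
  filter_upwards [self_mem_nhdsWithin] with s hs
  have hs : t < s := hs
  simp only [Function.comp_apply, slope, vsub_eq_sub]
  rw [← hT.apply_add (by linarith) ht, sub_add_cancel]

/-- Classical solutions are orbits of the semigroup. -/
theorem IsGeneratorOf.eq_orbit {G : E → E → Prop} {T : ℝ → E →L[ℂ] E}
    (hT : IsC0Semigroup T) (hG : IsGeneratorOf G T) {M : ℝ}
    (hM : ∀ t : ℝ, 0 ≤ t → ∀ x, ‖T t x‖ ≤ M * ‖x‖) {x y : ℝ → E}
    (hx : ∀ t : ℝ, 0 ≤ t → HasDerivWithinAt x (y t) (Ici 0) t)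
    (hxy : ∀ t : ℝ, 0 ≤ t → G (x t) (y t)) {t : ℝ} (ht : 0 ≤ t) : x t = T t (x 0) := by
  -- No sign of `M` is assumed; a negative value is possible only when `E` is trivial.
  have hM0 : 0 ≤ M ∨ ∀ z : E, z = 0 := by
    by_contra! hcon
    obtain ⟨hneg, z, hz⟩ := hcon
    have := hM 0 le_rfl z
    have h2 := norm_pos_iff.2 hz
    nlinarith [norm_nonneg (T 0 z)]
  rcases hM0 with hM0 | hM0
  swap
  · rw [hM0 (x t), hM0 (T t (x 0))]
  have hxc : ContinuousOn x (Ici 0) := fun s hs => (hx s hs).continuousWithinAt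
  -- joint continuity of `s ↦ T (t - s) (x s)`
  have hcont : ContinuousOn (fun s => T (t - s) (x s)) (Icc 0 t) := by
    intro s hs
    have h1 : ContinuousWithinAt (fun r => T (t - r) (x s)) (Icc 0 t) s := by
      refine ((hT.cont (x s)) (t - s) (sub_nonneg.2 hs.2)).comp
        (f := fun r : ℝ => t - r) (by fun_prop) ?_
      intro r hr
      exact sub_nonneg.2 hr.2
    -- The family `T` is only strongly continuous, so the moving argument is split off and
    -- controlled by the uniform bound `M`.
    have h2 : Tendsto (fun r => T (t - r) (x r - x s)) (𝓝[Icc 0 t] s) (𝓝 0) := by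
      have h3 : Tendsto (fun r => M * ‖x r - x s‖) (𝓝[Icc 0 t] s) (𝓝 0) := by
        have h4 := ((hxc s hs.1).mono (Icc_subset_Ici_self : Icc 0 t ⊆ Ici 0))
        have h5 : Tendsto (fun r => ‖x r - x s‖) (𝓝[Icc 0 t] s) (𝓝 ‖x s - x s‖) :=
          (h4.sub continuousWithinAt_const).norm
        simpa using h5.const_mul M
      refine squeeze_zero_norm' ?_ h3
      filter_upwards [self_mem_nhdsWithin] with r hr
      exact hM _ (sub_nonneg.2 hr.2) _
    have h6 := h2.add h1
    rw [zero_add] at h6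
    refine h6.congr fun r => ?_
    simp
  -- Factoring `T (t - r)` out of the difference quotient leaves the slope of `x` minus the slope of
  -- the orbit through `x s`; both tend to `y s`.
  have hder : ∀ s ∈ Ico 0 t, HasDerivWithinAt (fun s => T (t - s) (x s)) 0 (Ici s) s := by
    intro s hs
    rw [hasDerivWithinAt_iff_tendsto_slope, Ici_sdiff_left]
    have h1 : Tendsto (fun r => slope x s r) (𝓝[>] s) (𝓝 (y s)) := by
      have := (hx s hs.1).mono (Ici_subset_Ici.2 hs.1)
      rwa [hasDerivWithinAt_iff_tendsto_slope, Ici_sdiff_left] at this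
    have h2 : Tendsto (fun s' : ℝ => s' - s) (𝓝[>] s) (𝓝[>] 0) := by
      refine tendsto_nhdsWithin_iff.2 ⟨?_, ?_⟩
      · exact ((continuous_id.sub continuous_const).tendsto' s 0 (by simp)).mono_left
          nhdsWithin_le_nhds
      · filter_upwards [self_mem_nhdsWithin] with s' hs
        exact sub_pos.2 (mem_Ioi.1 hs)
    have h3 := (hG.tendsto_slope (hxy s hs.1)).comp h2
    have h4 : Tendsto (fun r => M * ‖slope x s r - (r - s)⁻¹ • (T (r - s) (x s) - x s)‖)
        (𝓝[>] s) (𝓝 0) := by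
      have := ((h1.sub h3).norm).const_mul M
      simpa using this
    refine squeeze_zero_norm' ?_ h4
    have hmem : Ioo s t ∈ 𝓝[>] s := Ioo_mem_nhdsGT hs.2
    filter_upwards [hmem] with r hr
    have h5 : T (t - s) (x s) = T (t - r) (T (r - s) (x s)) := by
      rw [← hT.apply_add (by linarith [hr.2]) (by linarith [hr.1])]; congr 2; ring
    have h6 : slope (fun s => T (t - s) (x s)) s r =
        T (t - r) (slope x s r - (r - s)⁻¹ • (T (r - s) (x s) - x s)) := by
      simp only [slope, vsub_eq_sub]
      rw [h5, ← smul_sub, ← map_sub, ← Complex.coe_smul, ← Complex.coe_smul, map_smul]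
      congr 2
      abel
    rw [h6]
    exact hM _ (by linarith [hr.2]) _
  have := constant_of_has_deriv_right_zero hcont hder t (right_mem_Icc.2 ht)
  simpa [hT.zero] using this

theorem IsC0Semigroup.intervalIntegrable {T : ℝ → E →L[ℂ] E} (hT : IsC0Semigroup T) (x : E)
    {a b : ℝ} (ha : 0 ≤ a) (hb : 0 ≤ b) :
    IntervalIntegrable (fun s => T s x) volume a b :=
  ContinuousOn.intervalIntegrable ((hT.cont x).mono fun _ hs =>
    (le_min ha hb).trans hs.1)

/-- Leibniz rule for the application of complex linear operators that depend on a real parameter. -/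
theorem _root_.HasDerivWithinAt.complex_clm_apply {c : ℝ → W →L[ℂ] F} {c' : W →L[ℂ] F} {v : ℝ → W}
    {v' : W} {s : Set ℝ} {t : ℝ} (hc : HasDerivWithinAt c c' s t) (hv : HasDerivWithinAt v v' s t) :
    HasDerivWithinAt (fun r => c r (v r)) (c' (v t) + c t v') s t :=
  ((ContinuousLinearMap.restrictScalarsL ℂ W F ℝ ℝ).hasFDerivAt.comp_hasDerivWithinAt t
    hc).clm_apply hv

variable [CompleteSpace E]

theorem hasDerivWithinAt_integral_Ici {y : ℝ → E} (hy : ContinuousOn y (Ici 0)) {t : ℝ}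
    (ht : 0 ≤ t) :
    HasDerivWithinAt (fun s => ∫ r in (0 : ℝ)..s, y r) (y t) (Ici 0) t := by
  have hc : Continuous (fun s => y (max s 0)) :=
    hy.comp_continuous (by fun_prop) (fun s => mem_Ici.2 (le_max_right _ _))
  have h1 : HasDerivAt (fun s => ∫ r in (0 : ℝ)..s, y (max r 0)) (y (max t 0)) t :=
    intervalIntegral.integral_hasDerivAt_right (hc.intervalIntegrable _ _)
      (hc.stronglyMeasurableAtFilter _ _) hc.continuousAt
  rw [max_eq_left ht] at h1
  refine h1.hasDerivWithinAt.congr_of_mem (fun s hs => ?_) ht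
  refine intervalIntegral.integral_congr fun r hr => ?_
  rw [uIcc_of_le hs] at hr
  simp [max_eq_left hr.1]

/-- Orbits that start in the domain are classical solutions. -/
theorem IsGeneratorOf.hasDerivWithinAt {G : E → E → Prop} {T : ℝ → E →L[ℂ] E}
    (hT : IsC0Semigroup T) (hG : IsGeneratorOf G T) {x y : E} (h : G x y) {t : ℝ} (ht : 0 ≤ t) :
    HasDerivWithinAt (fun s => T s x) (T t y) (Ici 0) t := by
  -- Both sides are continuous with the same right derivative. The integral form upgrades the right
  -- derivative of the orbit to a derivative within `[0,∞)`.
  have key : ∀ s : ℝ, 0 ≤ s → T s x = x + ∫ r in (0 : ℝ)..s, T r y := by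
    intro s hs
    have hcont : ContinuousOn (fun r => T r x - ∫ r' in (0 : ℝ)..r, T r' y) (Icc 0 s) := by
      refine ((hT.cont x).mono Icc_subset_Ici_self).sub fun r hr => ?_
      exact ((hasDerivWithinAt_integral_Ici (hT.cont y) hr.1).continuousWithinAt).mono
        Icc_subset_Ici_self
    have := constant_of_has_deriv_right_zero hcont (fun r hr => by
      have h1 := hG.hasDerivWithinAt_right hT h hr.1
      have h2 := (hasDerivWithinAt_integral_Ici (hT.cont y) hr.1).mono
        (Ici_subset_Ici.2 hr.1)
      simpa using! h1.sub h2) s (right_mem_Icc.2 hs)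
    simp only [hT.zero, ContinuousLinearMap.coe_id', id_eq, intervalIntegral.integral_same,
      sub_zero] at this
    exact sub_eq_iff_eq_add.1 this
  exact ((hasDerivWithinAt_integral_Ici (hT.cont y) ht).const_add x).congr_of_mem key ht

/-- The domain of the generator is dense. -/
theorem IsGeneratorOf.exists_seq_tendsto {G : E → E → Prop} {T : ℝ → E →L[ℂ] E}
    (hT : IsC0Semigroup T) (hG : IsGeneratorOf G T) (x : E) :
    ∃ (X Y : ℕ → E), (∀ k, G (X k) (Y k)) ∧ Tendsto X atTop (𝓝 x) := by
  -- Time averages of an orbit lie in the domain: `T r` shifts the window of integration, so the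
  -- difference quotient involves only its two ends.
  have hdom : ∀ t : ℝ, 0 < t → G (t⁻¹ • ∫ s in (0 : ℝ)..t, T s x) (t⁻¹ • (T t x - x)) := by
    intro t ht
    apply hG.of_tendsto_slope
    have hF : ∀ r : ℝ, 0 ≤ r →
        HasDerivWithinAt (fun s => ∫ r in (0 : ℝ)..s, T r x) (T r x) (Ici 0) r :=
      fun r hr => hasDerivWithinAt_integral_Ici (hT.cont x) hr
    have h0 := (hF 0 le_rfl)
    have h1 : HasDerivWithinAt (fun s => ∫ r in (0 : ℝ)..(s + t), T r x) (T t x) (Ici 0) 0 := by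
      have := HasDerivWithinAt.scomp (h := fun s : ℝ => s + t) (h' := 1) (s := Ici 0) (0 : ℝ)
        (by simpa using hF t ht.le) ((hasDerivWithinAt_id _ _).add_const t)
        (fun s (hs : 0 ≤ s) => by simpa using add_nonneg hs ht.le)
      simpa [Function.comp_def] using this
    have h2 := (h1.sub h0).const_smul t⁻¹
    rw [hasDerivWithinAt_iff_tendsto_slope, Ici_sdiff_left] at h2
    simp only [hT.zero, ContinuousLinearMap.coe_id', id_eq] at h2
    refine h2.congr' ?_
    filter_upwards [self_mem_nhdsWithin] with r hr
    have hr : 0 ≤ r := le_of_lt hr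
    have h3 : T r (∫ s in (0 : ℝ)..t, T s x) = ∫ s in r..(r + t), T s x := by
      rw [← ContinuousLinearMap.intervalIntegral_comp_comm _ (hT.intervalIntegrable x le_rfl ht.le)]
      have : ∫ s in (0 : ℝ)..t, T r (T s x) = ∫ s in (0 : ℝ)..t, T (r + s) x := by
        refine intervalIntegral.integral_congr fun s hs => ?_
        rw [uIcc_of_le ht.le] at hs
        exact (hT.apply_add hr hs.1 x).symm
      rw [this, intervalIntegral.integral_comp_add_left (fun s => T s x), add_zero]
    have h4 : (∫ s in (0 : ℝ)..(r + t), T s x) - ∫ s in (0 : ℝ)..r, T s x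
        = ∫ s in r..(r + t), T s x :=
      intervalIntegral.integral_interval_sub_left (hT.intervalIntegrable x le_rfl (by linarith))
        (hT.intervalIntegrable x le_rfl hr)
    have h5 : T r (t⁻¹ • ∫ s in (0 : ℝ)..t, T s x) = t⁻¹ • T r (∫ s in (0 : ℝ)..t, T s x) := by
      rw [← Complex.coe_smul, map_smul, Complex.coe_smul]
    simp only [slope, vsub_eq_sub, sub_zero, Pi.sub_apply, Pi.smul_apply, h4, zero_add,
      intervalIntegral.integral_same, h5, h3]
  have hlim : Tendsto (fun t : ℝ => t⁻¹ • ∫ s in (0 : ℝ)..t, T s x) (𝓝[>] 0) (𝓝 x) := by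
    have h0 := hasDerivWithinAt_integral_Ici (hT.cont x) (le_refl (0 : ℝ))
    rw [hasDerivWithinAt_iff_tendsto_slope, Ici_sdiff_left] at h0
    simp only [hT.zero, ContinuousLinearMap.coe_id', id_eq] at h0
    exact h0.congr fun t => by simp [slope]
  have hseq : Tendsto (fun k : ℕ => 1 / ((k : ℝ) + 1)) atTop (𝓝[>] 0) :=
    tendsto_nhdsWithin_iff.2 ⟨tendsto_one_div_add_atTop_nhds_zero_nat,
      Eventually.of_forall fun k => mem_Ioi.2 (by positivity)⟩
  exact ⟨_, _, fun k => hdom (1 / ((k : ℝ) + 1)) (by positivity), hlim.comp hseq⟩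

/-! ### Triangular coupling with a bounded operator -/

section Triangular

set_option linter.unusedSectionVars false

variable [CompleteSpace W]

theorem hasDerivAt_exp_smul (A : W →L[ℂ] W) (t : ℝ) :
    HasDerivAt (fun s : ℝ => NormedSpace.exp (s • A)) (A * NormedSpace.exp (t • A)) t :=
  hasDerivAt_exp_smul_const' A t

theorem exp_add_smul (A : W →L[ℂ] W) (s t : ℝ) :
    NormedSpace.exp ((s + t) • A) = NormedSpace.exp (s • A) * NormedSpace.exp (t • A) := by
  let : NormedAlgebra ℚ (W →L[ℂ] W) := .restrictScalars ℚ ℂ _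
  rw [add_smul]
  exact NormedSpace.exp_add_of_commute (((Commute.refl A).smul_left s).smul_right t)

theorem exp_add_smul_apply (A : W →L[ℂ] W) (s t : ℝ) (w : W) :
    NormedSpace.exp (s • A) (NormedSpace.exp (t • A) w) = NormedSpace.exp ((s + t) • A) w := by
  rw [exp_add_smul]; rfl

theorem continuous_exp_smul (A : W →L[ℂ] W) :
    Continuous (fun s : ℝ => NormedSpace.exp (s • A)) :=
  continuous_iff_continuousAt.2 fun t => (hasDerivAt_exp_smul A t).continuousAt

/-- The forcing term `∫₀ᵗ e^{(t-s)A} B S(s) e ds`. -/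
def duhamel (A : W →L[ℂ] W) (B : E →L[ℂ] W) (S : ℝ → E →L[ℂ] E) (t : ℝ) (e : E) : W :=
  NormedSpace.exp (t • A) (∫ s in (0 : ℝ)..t, NormedSpace.exp ((-s) • A) (B (S s e)))

variable {A : W →L[ℂ] W} {B : E →L[ℂ] W} {S : ℝ → E →L[ℂ] E}

theorem continuousOn_duhamel_integrand (hS : IsC0Semigroup S) (e : E) :
    ContinuousOn (fun s : ℝ => NormedSpace.exp ((-s) • A) (B (S s e))) (Ici 0) :=
  ((continuous_exp_smul A).comp continuous_neg).continuousOn.clm_apply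
    (B.continuous.comp_continuousOn (hS.cont e))

theorem intervalIntegrable_duhamel (hS : IsC0Semigroup S) (e : E) {a b : ℝ} (ha : 0 ≤ a)
    (hb : 0 ≤ b) :
    IntervalIntegrable (fun s : ℝ => NormedSpace.exp ((-s) • A) (B (S s e))) volume a b :=
  ContinuousOn.intervalIntegrable ((continuousOn_duhamel_integrand hS e).mono fun _ hs =>
    (le_min ha hb).trans hs.1)

theorem hasDerivWithinAt_duhamel (hS : IsC0Semigroup S) (e : E) {t : ℝ} (ht : 0 ≤ t) :
    HasDerivWithinAt (fun s => duhamel A B S s e) (A (duhamel A B S t e) + B (S t e)) (Ici 0) t := by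
  have h1 := (hasDerivAt_exp_smul A t).hasDerivWithinAt (s := Ici 0)
  have h2 := hasDerivWithinAt_integral_Ici (continuousOn_duhamel_integrand (A := A) (B := B) hS e) ht
  have h3 := h1.complex_clm_apply h2
  refine h3.congr_deriv ?_
  have : NormedSpace.exp (t • A) (NormedSpace.exp ((-t) • A) (B (S t e))) = B (S t e) := by
    rw [exp_add_smul_apply]; simp
  rw [this]
  rfl

/-- This cocycle identity is the off-diagonal entry of the semigroup law for the block triangular
family. -/
theorem duhamel_add (hS : IsC0Semigroup S) (e : E) {s t : ℝ} (hs : 0 ≤ s) (ht : 0 ≤ t) :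
    duhamel A B S (s + t) e =
      NormedSpace.exp (s • A) (duhamel A B S t e) + duhamel A B S s (S t e) := by
  have h1 : ∫ r in (0 : ℝ)..(s + t), NormedSpace.exp ((-r) • A) (B (S r e)) =
      (∫ r in (0 : ℝ)..t, NormedSpace.exp ((-r) • A) (B (S r e))) +
      ∫ r in t..(s + t), NormedSpace.exp ((-r) • A) (B (S r e)) :=
    (intervalIntegral.integral_add_adjacent_intervals
      (intervalIntegrable_duhamel hS e le_rfl ht)
      (intervalIntegrable_duhamel hS e ht (add_nonneg hs ht))).symm
  have h2 : ∫ r in t..(s + t), NormedSpace.exp ((-r) • A) (B (S r e)) =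
      NormedSpace.exp ((-t) • A)
        (∫ r in (0 : ℝ)..s, NormedSpace.exp ((-r) • A) (B (S r (S t e)))) := by
    rw [← ContinuousLinearMap.intervalIntegral_comp_comm _
      (intervalIntegrable_duhamel hS (S t e) le_rfl hs)]
    have := intervalIntegral.integral_comp_add_right (a := 0) (b := s)
      (fun r => NormedSpace.exp ((-r) • A) (B (S r e))) t
    rw [zero_add] at this
    rw [← this]
    refine intervalIntegral.integral_congr fun r hr => ?_
    rw [uIcc_of_le hs] at hr
    rw [hS.apply_add hr.1 ht, exp_add_smul_apply]
    congr 3; ring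
  unfold duhamel
  rw [h1, h2, map_add]
  simp only [exp_add_smul_apply]
  congr 4
  ring

/-- With a common rate, the decay of the two factors multiplies to `exp (-μ t)` independently of the
integration variable, so integration over `[0,t]` costs a factor `t`. -/
theorem norm_duhamel_le (hS : IsC0Semigroup S) {M μ M' : ℝ} (hM : 0 ≤ M)
    (hA : ∀ t : ℝ, 0 ≤ t → ∀ w : W, ‖NormedSpace.exp (t • A) w‖ ≤ M * Real.exp (-μ * t) * ‖w‖)
    (hSb : ∀ t : ℝ, 0 ≤ t → ∀ e : E, ‖S t e‖ ≤ M' * Real.exp (-μ * t) * ‖e‖) {t : ℝ} (ht : 0 ≤ t)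
    (e : E) :
    ‖duhamel A B S t e‖ ≤ M * ‖B‖ * M' * (t * Real.exp (-μ * t)) * ‖e‖ := by
  unfold duhamel
  rw [← ContinuousLinearMap.intervalIntegral_comp_comm _
    (intervalIntegrable_duhamel hS e le_rfl ht)]
  have : ∀ s ∈ uIoc (0 : ℝ) t, ‖NormedSpace.exp (t • A) (NormedSpace.exp ((-s) • A) (B (S s e)))‖ ≤
      M * ‖B‖ * M' * Real.exp (-μ * t) * ‖e‖ := by
    intro s hs
    rw [uIoc_of_le ht] at hs
    rw [exp_add_smul_apply]
    calc _ ≤ M * Real.exp (-μ * (t + -s)) * ‖B (S s e)‖ := hA _ (by linarith [hs.2]) _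
      _ ≤ M * Real.exp (-μ * (t + -s)) * (‖B‖ * (M' * Real.exp (-μ * s) * ‖e‖)) := by
          gcongr
          exact (B.le_opNorm _).trans (by gcongr; exact hSb s hs.1.le e)
      _ = M * ‖B‖ * M' * (Real.exp (-μ * (t + -s)) * Real.exp (-μ * s)) * ‖e‖ := by ring
      _ = _ := by rw [← Real.exp_add]; congr 3; ring_nf
  refine (intervalIntegral.norm_integral_le_of_norm_le_const this).trans (le_of_eq ?_)
  rw [sub_zero, abs_of_nonneg ht]; ring

theorem duhamel_linear (hS : IsC0Semigroup S) {t : ℝ} (ht : 0 ≤ t) :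
    (∀ e e', duhamel A B S t (e + e') = duhamel A B S t e + duhamel A B S t e') ∧
    ∀ (c : ℂ) e, duhamel A B S t (c • e) = c • duhamel A B S t e := by
  constructor
  · intro e e'
    unfold duhamel
    rw [← map_add, ← intervalIntegral.integral_add (intervalIntegrable_duhamel hS e le_rfl ht)
      (intervalIntegrable_duhamel hS e' le_rfl ht)]
    simp
  · intro c e
    unfold duhamel
    rw [← map_smul, ← intervalIntegral.integral_smul]
    simp

/-- A strongly continuous, exponentially stable semigroup may be coupled, through a bounded operator
`B`, to a linear differential equation with bounded, exponentially stable operator `A`. -/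
theorem exists_triangular_semigroup {G : E → E → Prop} (A : W →L[ℂ] W) (B : E →L[ℂ] W)
    (hA : IsExpStable fun t : ℝ => NormedSpace.exp (t • A)) (hS : IsC0Semigroup S)
    (hG : IsGeneratorOf G S) (hSb : IsExpStable S) :
    ∃ T : ℝ → (W × E) →L[ℂ] (W × E), IsC0Semigroup T ∧
      IsGeneratorOf (fun x y => y.1 = A x.1 + B x.2 ∧ G x.2 y.2) T ∧ IsExpStable T := by
  obtain ⟨M, μ, hM, hμ, hA⟩ := hA
  obtain ⟨M', μ', hM', hμ', hSb⟩ := hSb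
  set ν := min μ μ' with hν
  have hν0 : 0 < ν := lt_min hμ hμ'
  have hM0 : 0 ≤ M := by linarith
  have hM0' : 0 ≤ M' := by linarith
  have hA : ∀ t : ℝ, 0 ≤ t → ∀ w : W,
      ‖NormedSpace.exp (t • A) w‖ ≤ M * Real.exp (-ν * t) * ‖w‖ := fun t ht w =>
    (hA t ht w).trans (by gcongr; exact min_le_left _ _)
  have hSb : ∀ t : ℝ, 0 ≤ t → ∀ e : E, ‖S t e‖ ≤ M' * Real.exp (-ν * t) * ‖e‖ := fun t ht w =>
    (hSb t ht w).trans (by gcongr; exact min_le_right _ _)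
  -- The cutoff `max t 0` makes the operator defined and bounded for every real `t`; only
  -- nonnegative times matter.
  let J : ℝ → E →L[ℂ] W := fun t =>
    LinearMap.mkContinuous
      { toFun := duhamel A B S (max t 0)
        map_add' := (duhamel_linear hS (le_max_right _ _)).1
        map_smul' := (duhamel_linear hS (le_max_right _ _)).2 }
      (M * ‖B‖ * M' * (max t 0 * Real.exp (-ν * max t 0)))
      (norm_duhamel_le hS hM0 hA hSb (le_max_right _ _))
  have hJ : ∀ t : ℝ, 0 ≤ t → ∀ e, J t e = duhamel A B S t e := by
    intro t ht e
    change duhamel A B S (max t 0) e = _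
    rw [max_eq_left ht]
  let T : ℝ → (W × E) →L[ℂ] (W × E) := fun t =>
    (((NormedSpace.exp (t • A)).comp (ContinuousLinearMap.fst ℂ W E)) +
      (J t).comp (ContinuousLinearMap.snd ℂ W E)).prod ((S t).comp (ContinuousLinearMap.snd ℂ W E))
  have hT : ∀ t : ℝ, 0 ≤ t → ∀ x : W × E,
      T t x = (NormedSpace.exp (t • A) x.1 + duhamel A B S t x.2, S t x.2) := by
    intro t ht x
    rw [← hJ t ht]
    rfl
  have hder : ∀ x : W × E, ∀ t : ℝ, 0 ≤ t → HasDerivWithinAt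
      (fun t : ℝ => NormedSpace.exp (t • A) x.1 + duhamel A B S t x.2)
      (A (NormedSpace.exp (t • A) x.1) + (A (duhamel A B S t x.2) + B (S t x.2))) (Ici 0) t := by
    intro x t ht
    refine HasDerivWithinAt.add ?_ (hasDerivWithinAt_duhamel hS x.2 ht)
    simpa using ((hasDerivAt_exp_smul A t).hasDerivWithinAt (s := Ici 0)).complex_clm_apply
      (hasDerivWithinAt_const t (Ici 0) x.1)
  refine ⟨T, ⟨?_, ?_, ?_⟩, ?_, ?_⟩
  · refine ContinuousLinearMap.ext fun x => ?_
    rw [hT 0 le_rfl]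
    simp [duhamel, hS.zero]
  · intro s t hs ht
    refine ContinuousLinearMap.ext fun x => ?_
    rw [ContinuousLinearMap.comp_apply, hT t ht, hT s hs, hT _ (add_nonneg hs ht)]
    simp only [duhamel_add hS _ hs ht, hS.apply_add hs ht, exp_add_smul_apply,
      map_add, add_assoc]
  · intro x
    have : ContinuousOn (fun t : ℝ =>
        (NormedSpace.exp (t • A) x.1 + duhamel A B S t x.2, S t x.2)) (Ici 0) :=
      ContinuousOn.prodMk (fun t ht => (hder x t ht).continuousWithinAt) (hS.cont x.2)
    exact this.congr fun t ht => hT t ht x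
  · intro x y
    -- Since `A` and `B` are bounded, the first component is right differentiable at 0 for every
    -- `x`; the domain is restricted only through the second component.
    have h1 : Tendsto (fun t : ℝ => ((t : ℂ)⁻¹ • (T t x - x)).1) (𝓝[>] 0)
        (𝓝 (A x.1 + B x.2)) := by
      have := hder x 0 le_rfl
      rw [hasDerivWithinAt_iff_tendsto_slope, Ici_sdiff_left] at this
      simp only [duhamel, hS.zero] at this
      simp only [zero_smul, NormedSpace.exp_zero, intervalIntegral.integral_same, map_zero,
        one_apply_eq_self, ContinuousLinearMap.coe_id', id_eq, zero_add] at this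
      refine this.congr' ?_
      filter_upwards [self_mem_nhdsWithin] with t ht
      rw [smul_inv_ofReal, hT t (le_of_lt ht)]
      simp [slope, duhamel]
    have h2 : ∀ t ∈ Ioi (0 : ℝ), ((t : ℂ)⁻¹ • (T t x - x)).2 = (t : ℂ)⁻¹ • (S t x.2 - x.2) := by
      intro t ht
      rw [hT t (le_of_lt ht)]; rfl
    rw [nhds_prod_eq, Filter.tendsto_prod_iff']
    constructor
    · rintro ⟨hy1, hy2⟩
      refine ⟨by rw [hy1]; exact h1, ?_⟩
      refine ((hG _ _).1 hy2).congr' ?_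
      filter_upwards [self_mem_nhdsWithin] with t ht using (h2 t ht).symm
    · rintro ⟨hy1, hy2⟩
      refine ⟨tendsto_nhds_unique hy1 h1, (hG _ _).2 (hy2.congr' ?_)⟩
      filter_upwards [self_mem_nhdsWithin] with t ht using h2 t ht
  -- Half of the rate is spent on the factor `t` of the Duhamel term: `t exp (-ν t) ≤ (2/ν) exp (-ν
  -- t/2)`.
  · refine ⟨M + M * ‖B‖ * M' * (2 / ν) + M', ν / 2, ?_, by positivity, ?_⟩
    · have : 0 ≤ M * ‖B‖ * M' * (2 / ν) := by positivity
      linarith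
    intro t ht x
    rw [hT t ht]
    have hexp : Real.exp (-ν * t) ≤ Real.exp (-(ν / 2) * t) :=
      Real.exp_le_exp.2 (by nlinarith)
    have htexp : t * Real.exp (-ν * t) ≤ (2 / ν) * Real.exp (-(ν / 2) * t) := by
      have h1 : ν / 2 * t ≤ Real.exp (ν / 2 * t) := by
        linarith [Real.add_one_le_exp (ν / 2 * t)]
      have h2 : t ≤ 2 / ν * Real.exp (ν / 2 * t) := by
        have : t = 2 / ν * (ν / 2 * t) := by field_simp
        calc t = 2 / ν * (ν / 2 * t) := this
          _ ≤ _ := by gcongr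
      calc t * Real.exp (-ν * t) ≤ 2 / ν * Real.exp (ν / 2 * t) * Real.exp (-ν * t) := by gcongr
        _ = 2 / ν * (Real.exp (ν / 2 * t) * Real.exp (-ν * t)) := by ring
        _ = _ := by rw [← Real.exp_add]; congr 2; ring
    have hx1 : ‖x.1‖ ≤ ‖x‖ := norm_fst_le x
    have hx2 : ‖x.2‖ ≤ ‖x‖ := norm_snd_le x
    have hw : ‖NormedSpace.exp (t • A) x.1 + duhamel A B S t x.2‖ ≤
        (M + M * ‖B‖ * M' * (2 / ν)) * Real.exp (-(ν / 2) * t) * ‖x‖ := by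
      calc _ ≤ M * Real.exp (-ν * t) * ‖x.1‖ +
            M * ‖B‖ * M' * (t * Real.exp (-ν * t)) * ‖x.2‖ :=
            (norm_add_le _ _).trans
              (add_le_add (hA t ht _) (norm_duhamel_le hS hM0 hA hSb ht _))
        _ ≤ M * Real.exp (-(ν / 2) * t) * ‖x‖ +
            M * ‖B‖ * M' * ((2 / ν) * Real.exp (-(ν / 2) * t)) * ‖x‖ := by gcongr
        _ = _ := by ring
    have he : ‖S t x.2‖ ≤ M' * Real.exp (-(ν / 2) * t) * ‖x‖ :=
      (hSb t ht _).trans (by gcongr)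
    rw [Prod.norm_def]
    have hpos : 0 ≤ M * ‖B‖ * M' * (2 / ν) := by positivity
    refine max_le (hw.trans ?_) (he.trans ?_)
    all_goals
      refine mul_le_mul_of_nonneg_right (mul_le_mul_of_nonneg_right ?_ (Real.exp_nonneg _))
        (norm_nonneg _)
      linarith

end Triangular

end Semigroup

/-! ### Exponential stability of Hurwitz matrices with simple eigenvalues -/

section Hurwitz

variable {W : Type*} [NormedAddCommGroup W] [NormedSpace ℂ W]

theorem exp_smul_apply_of_eigen [CompleteSpace W] {A : W →L[ℂ] W} {lam : ℂ} {w : W}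
    (h : A w = lam • w) (t : ℝ) :
    NormedSpace.exp (t • A) w = Complex.exp (lam * t) • w := by
  have hg : ∀ s : ℝ, HasDerivAt
      (fun s : ℝ => Complex.exp (-(lam * s)) • NormedSpace.exp (s • A) w) 0 s := by
    intro s
    have h1 : HasDerivAt (fun s : ℝ => NormedSpace.exp (s • A) w)
        ((NormedSpace.exp (s • A) * A) w) s := by
      rw [← hasDerivWithinAt_univ]
      simpa using (hasDerivAt_exp_smul_const A s).hasDerivWithinAt.complex_clm_apply
        (hasDerivWithinAt_const s univ w)
    have h2 : HasDerivAt (fun s : ℝ => Complex.exp (-(lam * s)))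
        (Complex.exp (-(lam * s)) * (-lam)) s := by
      have : HasDerivAt (fun s : ℝ => -(lam * (s : ℂ))) (-(lam * 1)) s :=
        ((Complex.ofRealCLM.hasDerivAt (x := s)).const_mul lam).neg
      simpa using this.cexp
    refine (h2.smul h1).congr_deriv ?_
    have : (NormedSpace.exp (s • A) * A) w = lam • NormedSpace.exp (s • A) w := by
      change NormedSpace.exp (s • A) (A w) = _
      rw [h, map_smul]
    rw [this, smul_smul, ← add_smul]
    ring_nf
    simp
  have hc := is_const_of_deriv_eq_zero (fun s => (hg s).differentiableAt) (fun s => (hg s).deriv)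
    t 0
  simp only [Complex.ofReal_zero, mul_zero, neg_zero, Complex.exp_zero, zero_smul,
    NormedSpace.exp_zero, one_smul, one_apply_eq_self] at hc
  conv_rhs => rw [← hc]
  rw [smul_smul, ← Complex.exp_add]
  simp

/-- A semisimple operator on a finite-dimensional space whose eigenvalues have negative real parts
generates an exponentially stable group. -/
theorem isExpStable_exp_of_isSemisimple [FiniteDimensional ℂ W] (A : W →L[ℂ] W)
    (hs : Module.End.IsSemisimple (A : Module.End ℂ W))
    (hA : ∀ lam : ℂ, Module.End.HasEigenvalue (A : Module.End ℂ W) lam → lam.re < 0) :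
    IsExpStable fun t : ℝ => NormedSpace.exp (t • A) := by
  have : CompleteSpace W := FiniteDimensional.complete ℂ W
  -- The gap between the finitely many eigenvalues and the imaginary axis; without eigenvalues any
  -- positive number serves.
  obtain ⟨μ, hμ, hμA⟩ : ∃ μ : ℝ, 0 < μ ∧
      ∀ lam : ℂ, Module.End.HasEigenvalue (A : Module.End ℂ W) lam → μ ≤ -lam.re := by
    have hfin : {lam | Module.End.HasEigenvalue (A : Module.End ℂ W) lam}.Finite :=
      Module.End.finite_hasEigenvalue _
    rcases Set.eq_empty_or_nonempty {lam | Module.End.HasEigenvalue (A : Module.End ℂ W) lam}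
      with he | hne
    · refine ⟨1, one_pos, fun lam hlam => ?_⟩
      have : lam ∈ {lam | Module.End.HasEigenvalue (A : Module.End ℂ W) lam} := hlam
      rw [he] at this
      exact this.elim
    · obtain ⟨lam0, h0, hmin⟩ := hfin.exists_minimalFor (fun lam : ℂ => -lam.re) _ hne
      refine ⟨-lam0.re, by linarith [hA lam0 h0], fun lam hlam => ?_⟩
      by_contra! hcon
      exact absurd (hmin hlam hcon.le) (not_le.2 hcon)
  -- The vectors whose orbits decay at rate `μ` form a subspace containing every eigenspace, and by
  -- semisimplicity the eigenspaces span `W`.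
  let V : Submodule ℂ W :=
    { carrier := {w | ∃ C : ℝ, ∀ t : ℝ, 0 ≤ t →
        ‖NormedSpace.exp (t • A) w‖ ≤ C * Real.exp (-μ * t)}
      zero_mem' := ⟨0, fun t _ => by simp⟩
      add_mem' := by
        rintro w w' ⟨C, hC⟩ ⟨C', hC'⟩
        refine ⟨C + C', fun t ht => ?_⟩
        rw [map_add, add_mul]
        exact (norm_add_le _ _).trans (add_le_add (hC t ht) (hC' t ht))
      smul_mem' := by
        rintro c w ⟨C, hC⟩
        refine ⟨‖c‖ * C, fun t ht => ?_⟩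
        rw [map_smul, norm_smul, mul_assoc]
        exact mul_le_mul_of_nonneg_left (hC t ht) (norm_nonneg _) }
  have hV : V = ⊤ := by
    rw [eq_top_iff, ← Module.End.IsSemisimple.iSup_eigenspace_eq_top hs]
    refine iSup_le fun lam => ?_
    intro w hw
    by_cases h0 : w = 0
    · rw [h0]; exact V.zero_mem
    have hev : Module.End.HasEigenvalue (A : Module.End ℂ W) lam :=
      Module.End.hasEigenvalue_of_hasEigenvector ⟨hw, h0⟩
    refine ⟨‖w‖, fun t ht => ?_⟩
    rw [exp_smul_apply_of_eigen (Module.End.mem_eigenspace_iff.1 hw), norm_smul,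
      Complex.norm_exp, mul_comm]
    gcongr
    have := hμA lam hev
    simp only [Complex.mul_re, Complex.ofReal_re, Complex.ofReal_im, mul_zero, sub_zero]
    nlinarith
  -- Decay on finitely many basis vectors, weighted by the norms of the coordinate functionals,
  -- gives a bound uniform in the vector.
  let b := Module.finBasis ℂ W
  have hb : ∀ i, ∃ C : ℝ, ∀ t : ℝ, 0 ≤ t →
      ‖NormedSpace.exp (t • A) (b i)‖ ≤ C * Real.exp (-μ * t) := fun i => by
    have : b i ∈ V := hV ▸ Submodule.mem_top
    exact this
  choose C hC using hb
  have hcoord : ∀ i, ∃ K : ℝ, 0 ≤ K ∧ ∀ w, ‖b.repr w i‖ ≤ K * ‖w‖ := fun i =>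
    ⟨‖(LinearMap.toContinuousLinearMap (b.coord i))‖, norm_nonneg _, fun w =>
      (LinearMap.toContinuousLinearMap (b.coord i)).le_opNorm w⟩
  choose K hK0 hK using hcoord
  refine ⟨max 1 (∑ i, K i * C i), μ, le_max_left _ _, hμ, fun t ht w => ?_⟩
  have hw : NormedSpace.exp (t • A) w = ∑ i, b.repr w i • NormedSpace.exp (t • A) (b i) := by
    conv_lhs => rw [← b.sum_repr w]
    rw [map_sum]
    simp only [map_smul]
  calc ‖NormedSpace.exp (t • A) w‖
      ≤ ∑ i, ‖b.repr w i • NormedSpace.exp (t • A) (b i)‖ := by rw [hw]; exact norm_sum_le _ _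
    _ ≤ ∑ i, (K i * ‖w‖) * (C i * Real.exp (-μ * t)) := by
        refine Finset.sum_le_sum fun i _ => ?_
        rw [norm_smul]
        exact mul_le_mul (hK i w) (hC i t ht) (norm_nonneg _)
          (mul_nonneg (hK0 i) (norm_nonneg _))
    _ = (∑ i, K i * C i) * Real.exp (-μ * t) * ‖w‖ := by
        rw [Finset.sum_mul, Finset.sum_mul]
        exact Finset.sum_congr rfl fun i _ => by ring
    _ ≤ _ := by gcongr; exact le_max_right _ _

theorem toEuclideanCLM_apply_eq_act {n : ℕ} (A : Matrix (Fin n) (Fin n) ℂ)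
    (v : EuclideanSpace ℂ (Fin n)) : Matrix.toEuclideanCLM (𝕜 := ℂ) A v = act A v := rfl

/-- Simple eigenvalues make the characteristic polynomial squarefree, and Cayley–Hamilton then makes
the matrix semisimple. Hence no Jordan blocks spoil the decay. -/
theorem isExpStable_exp_matrix {n : ℕ} {A : Matrix (Fin n) (Fin n) ℂ} (hA : IsHurwitz A)
    (hs : HasSimpleEigenvalues A) :
    IsExpStable fun t : ℝ => NormedSpace.exp (t • Matrix.toEuclideanCLM (𝕜 := ℂ) A) := by
  apply isExpStable_exp_of_isSemisimple
  · refine Module.End.isSemisimple_of_squarefree_aeval_eq_zero (p := A.charpoly) ?_ ?_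
    · exact ((Polynomial.nodup_roots_iff_of_splits A.charpoly_monic.ne_zero
        (IsAlgClosed.splits _)).1 hs).squarefree
    · have h2 := Polynomial.aeval_algHom_apply 
        (Matrix.toLpLinAlgEquiv (R := ℂ) (n := Fin n) 2).toAlgHom A A.charpoly
      rw [Matrix.aeval_self_charpoly, map_zero] at h2
      exact h2
  · intro lam hlam
    apply hA
    rw [← Matrix.spectrum_toLpLin 2]
    exact hlam.mem_spectrum

end Hurwitz

/-! ### Integration on triangles and by parts -/

/-- Fubini for the integrand cut off to `t < s`; the diagonal is a null set. It serves both
integration by parts and differentiation under integrals over the triangle. -/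
theorem integral_triangle_swap {E : Type*} [NormedAddCommGroup E] [NormedSpace ℝ E] {c d : ℝ}
    (hcd : c ≤ d) {φ : ℝ → ℝ → E}
    (hφ : IntegrableOn (Function.uncurry φ) (Ioc c d ×ˢ Ioc c d)) :
    ∫ t in c..d, ∫ s in t..d, φ t s = ∫ s in c..d, ∫ t in c..s, φ t s := by
  set ψ : ℝ → ℝ → E := fun t s => {p : ℝ × ℝ | p.1 < p.2}.indicator (Function.uncurry φ) (t, s)
    with hψ
  have hmeas : MeasurableSet {p : ℝ × ℝ | p.1 < p.2} := measurableSet_lt measurable_fst measurable_snd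
  have hint : IntegrableOn (Function.uncurry ψ) (uIoc c d ×ˢ uIoc c d) := by
    rw [uIoc_of_le hcd]
    exact hφ.indicator hmeas
  have h1 : ∫ t in c..d, ∫ s in t..d, φ t s = ∫ t in c..d, ∫ s in c..d, ψ t s := by
    refine intervalIntegral.integral_congr fun t ht => ?_
    rw [uIcc_of_le hcd] at ht
    rw [intervalIntegral.integral_of_le ht.2, intervalIntegral.integral_of_le hcd]
    have : ∀ s, ψ t s = (Ioi t).indicator (φ t) s := fun s => by
      simp [hψ, indicator_apply]
    simp_rw [this]
    rw [setIntegral_indicator measurableSet_Ioi]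
    congr 2
    ext s
    simp only [mem_Ioc, mem_inter_iff, mem_Ioi]
    exact ⟨fun h => ⟨⟨ht.1.trans_lt h.1, h.2⟩, h.1⟩, fun h => ⟨h.2, h.1.2⟩⟩
  have h2 : ∫ s in c..d, ∫ t in c..s, φ t s = ∫ s in c..d, ∫ t in c..d, ψ t s := by
    refine intervalIntegral.integral_congr fun s hs => ?_
    rw [uIcc_of_le hcd] at hs
    rw [intervalIntegral.integral_of_le hs.1, intervalIntegral.integral_of_le hcd]
    have : ∀ t, ψ t s = (Iio s).indicator (fun t => φ t s) t := fun t => by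
      simp [hψ, indicator_apply]
    simp_rw [this]
    rw [setIntegral_indicator measurableSet_Iio, integral_Ioc_eq_integral_Ioo]
    congr 2
    ext t
    simp only [mem_Ioc, mem_inter_iff, mem_Iio, mem_Ioo]
    exact ⟨fun h => ⟨⟨h.1, h.2.le.trans hs.2⟩, h.2⟩, fun h => ⟨h.1.1, h.2⟩⟩
  rw [h1, h2, intervalIntegral_intervalIntegral_swap hint]

theorem continuousOn_of_primitive {c d : ℝ} (hcd : c ≤ d) {a a' : ℝ → ℂ}
    (ha' : IntervalIntegrable a' volume c d)
    (ha : ∀ x ∈ Icc c d, a x = a c + ∫ t in c..x, a' t) : ContinuousOn a (Icc c d) := by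
  have := intervalIntegral.continuousOn_primitive_interval' ha' left_mem_uIcc
  rw [uIcc_of_le hcd] at this
  exact ((continuousOn_const (c := a c)).add this).congr ha

/-- The functions `a'` and `b'` are merely integrable, so no pointwise product rule holds; the
formula is Fubini for `a' t * b' s` on the triangle `t < s`. -/
theorem integral_primitive_mul {c d : ℝ} (hcd : c ≤ d) {a a' b b' : ℝ → ℂ}
    (ha' : IntervalIntegrable a' volume c d) (hb' : IntervalIntegrable b' volume c d)
    (ha : ∀ x ∈ Icc c d, a x = a c + ∫ t in c..x, a' t)
    (hb : ∀ x ∈ Icc c d, b x = b c + ∫ t in c..x, b' t) :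
    ∫ t in c..d, a' t * b t = a d * b d - a c * b c - ∫ t in c..d, a t * b' t := by
  have hsub : ∀ {x y : ℝ}, x ∈ Icc c d → y ∈ Icc c d → uIcc x y ⊆ uIcc c d := by
    intro x y hx hy
    rw [uIcc_of_le hcd]
    exact uIcc_subset_Icc hx hy
  have hcm : c ∈ Icc c d := left_mem_Icc.2 hcd
  have hdm : d ∈ Icc c d := right_mem_Icc.2 hcd
  have hb2 : ∀ x ∈ Icc c d, b x = b d - ∫ s in x..d, b' s := by
    intro x hx
    rw [hb x hx, hb d hdm, ← intervalIntegral.integral_add_adjacent_intervals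
      (hb'.mono_set (hsub hcm hx)) (hb'.mono_set (hsub hx hdm))]
    ring
  have hint : IntegrableOn (Function.uncurry fun t s => a' t * b' s) (Ioc c d ×ˢ Ioc c d) := by
    rw [IntegrableOn, Measure.volume_eq_prod, ← Measure.prod_restrict]
    exact Integrable.mul_prod ((intervalIntegrable_iff_integrableOn_Ioc_of_le hcd).1 ha')
      ((intervalIntegrable_iff_integrableOn_Ioc_of_le hcd).1 hb')
  have hbc : ContinuousOn b (uIcc c d) := uIcc_of_le hcd ▸ continuousOn_of_primitive hcd hb' hb
  have hac : ContinuousOn a (uIcc c d) := uIcc_of_le hcd ▸ continuousOn_of_primitive hcd ha' ha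
  have e1 : ∫ t in c..d, ∫ s in t..d, a' t * b' s = ∫ t in c..d, (a' t * b d - a' t * b t) := by
    refine intervalIntegral.integral_congr fun t ht => ?_
    rw [uIcc_of_le hcd] at ht
    simp only [intervalIntegral.integral_const_mul]
    rw [hb2 t ht]; ring
  have e2 : ∫ s in c..d, ∫ t in c..s, a' t * b' s = ∫ s in c..d, (a s * b' s - a c * b' s) := by
    refine intervalIntegral.integral_congr fun s hs => ?_
    rw [uIcc_of_le hcd] at hs
    simp only [intervalIntegral.integral_mul_const]
    rw [ha s hs]; ring
  have e3 := integral_triangle_swap hcd hint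
  rw [e1, e2, intervalIntegral.integral_sub (ha'.mul_const _) (ha'.mul_continuousOn hbc),
    intervalIntegral.integral_sub (hb'.continuousOn_mul hac) (hb'.const_mul _),
    intervalIntegral.integral_mul_const, intervalIntegral.integral_const_mul] at e3
  have e4 := ha d hdm
  have e5 := hb d hdm
  have e6 : (∫ t in c..d, a' t) = a d - a c := by rw [e4]; ring
  have e7 : (∫ t in c..d, b' t) = b d - b c := by rw [e5]; ring
  rw [e6, e7] at e3
  linear_combination -e3

/-! ### Square integrable functions on the unit interval -/

theorem integral_mu01 {E : Type*} [NormedAddCommGroup E] [NormedSpace ℝ E] (f : ℝ → E) :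
    ∫ x, f x ∂mu01 = ∫ x in (0 : ℝ)..1, f x := by
  rw [intervalIntegral.integral_of_le zero_le_one, ← integral_Icc_eq_integral_Ioc]

theorem memLp_mu01_of_continuousOn {f : ℝ → ℂ} (hf : ContinuousOn f (Icc 0 1)) :
    MemLp f 2 mu01 := by
  obtain ⟨C, hC⟩ := isCompact_Icc.exists_bound_of_continuousOn hf
  refine MemLp.of_bound (hf.aestronglyMeasurable measurableSet_Icc) C ?_
  exact (ae_restrict_iff' measurableSet_Icc).2 (Eventually.of_forall hC)

theorem intervalIntegrable_of_memLp {f : ℝ → ℂ} (hf : MemLp f 2 mu01) {a b : ℝ}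
    (ha : a ∈ Icc (0 : ℝ) 1) (hb : b ∈ Icc (0 : ℝ) 1) : IntervalIntegrable f volume a b := by
  have h1 : IntegrableOn f (Icc 0 1) := hf.integrable (by norm_num)
  have h2 : IntervalIntegrable f volume 0 1 :=
    (intervalIntegrable_iff_integrableOn_Icc_of_le zero_le_one).2 h1
  refine h2.mono_set ?_
  rw [uIcc_of_le (zero_le_one' ℝ)]
  exact uIcc_subset_Icc ha hb

theorem intervalIntegrable_of_continuousOn {f : ℝ → ℂ} (hf : ContinuousOn f (Icc 0 1)) {a b : ℝ}
    (ha : a ∈ Icc (0 : ℝ) 1) (hb : b ∈ Icc (0 : ℝ) 1) : IntervalIntegrable f volume a b :=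
  intervalIntegrable_of_memLp (memLp_mu01_of_continuousOn hf) ha hb

theorem intervalIntegral_congr_mu01 {f g : ℝ → ℂ} (h : f =ᵐ[mu01] g) {a b : ℝ}
    (ha : a ∈ Icc (0 : ℝ) 1) (hb : b ∈ Icc (0 : ℝ) 1) : ∫ x in a..b, f x = ∫ x in a..b, g x := by
  refine intervalIntegral.integral_congr_ae ?_
  filter_upwards [(ae_restrict_iff' measurableSet_Icc).1 h] with x hx hxab
  refine hx ?_
  have := uIoc_subset_uIcc hxab
  exact uIcc_subset_Icc ha hb this

theorem zero_mem_I : (0 : ℝ) ∈ Icc (0 : ℝ) 1 := left_mem_Icc.2 zero_le_one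

theorem one_mem_I : (1 : ℝ) ∈ Icc (0 : ℝ) 1 := right_mem_Icc.2 zero_le_one

theorem ae_mu01_of_eqOn {E : Type*} {f g : ℝ → E} (h : EqOn f g (Icc 0 1)) : f =ᵐ[mu01] g :=
  (ae_restrict_iff' measurableSet_Icc).2 (Eventually.of_forall h)

theorem eqOn_of_ae_mu01 {f g : ℝ → ℂ} (hf : ContinuousOn f (Icc 0 1))
    (hg : ContinuousOn g (Icc 0 1)) (h : f =ᵐ[mu01] g) : EqOn f g (Icc 0 1) :=
  Measure.eqOn_Icc_of_ae_eq volume zero_ne_one h hf hg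

/-- The class of a continuous function. -/
def contClass (f : ℝ → ℂ) (hf : ContinuousOn f (Icc 0 1)) : L2I :=
  (memLp_mu01_of_continuousOn hf).toLp f

theorem contClass_ae (f : ℝ → ℂ) (hf : ContinuousOn f (Icc 0 1)) :
    (contClass f hf : ℝ → ℂ) =ᵐ[mu01] f := MemLp.coeFn_toLp _

/-- Pairing with a continuous function, as a bounded functional. -/
def pairing (φ : ℝ → ℂ) (hφ : ContinuousOn φ (Icc 0 1)) : L2I →L[ℂ] ℂ :=
  innerSL ℂ (contClass (fun x => starRingEnd ℂ (φ x)) (Complex.continuous_conj.comp_continuousOn hφ))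

theorem pairing_eq {φ : ℝ → ℂ} (hφ : ContinuousOn φ (Icc 0 1)) {F : L2I} {f : ℝ → ℂ}
    (hF : (F : ℝ → ℂ) =ᵐ[mu01] f) : pairing φ hφ F = ∫ x in (0 : ℝ)..1, φ x * f x := by
  rw [pairing, innerSL_apply_apply, L2.inner_def, ← integral_mu01]
  refine integral_congr_ae ?_
  filter_upwards [hF, contClass_ae _ (Complex.continuous_conj.comp_continuousOn hφ)] with x h1 h2
  change _ = starRingEnd ℂ (φ x) at h2
  rw [RCLike.inner_apply, h1]
  erw [h2]
  simp [mul_comm]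

/-! ### Calculus for elements of `H²(0,1)` -/

namespace IsH2Jet

variable {F G : L2I} {f f1 f2 g g1 g2 : ℝ → ℂ}

theorem cont_one (h : IsH2Jet F f f1 f2) : ContinuousOn f1 (Icc 0 1) :=
  continuousOn_of_primitive zero_le_one
    (intervalIntegrable_of_memLp h.memLp zero_mem_I one_mem_I) h.deriv_two

theorem cont (h : IsH2Jet F f f1 f2) : ContinuousOn f (Icc 0 1) :=
  continuousOn_of_primitive zero_le_one
    (intervalIntegrable_of_continuousOn h.cont_one zero_mem_I one_mem_I) h.deriv_one

theorem add (hF : IsH2Jet F f f1 f2) (hG : IsH2Jet G g g1 g2) :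
    IsH2Jet (F + G) (fun x => f x + g x) (fun x => f1 x + g1 x) (fun x => f2 x + g2 x) where
  rep := by
    filter_upwards [Lp.coeFn_add F G, hF.rep, hG.rep] with x h1 h2 h3
    rw [h1, Pi.add_apply, h2, h3]
  memLp := hF.memLp.add hG.memLp
  deriv_one x hx := by
    rw [intervalIntegral.integral_add (intervalIntegrable_of_continuousOn hF.cont_one zero_mem_I hx)
      (intervalIntegrable_of_continuousOn hG.cont_one zero_mem_I hx), hF.deriv_one x hx,
      hG.deriv_one x hx]
    ring
  deriv_two x hx := by
    rw [intervalIntegral.integral_add (intervalIntegrable_of_memLp hF.memLp zero_mem_I hx)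
      (intervalIntegrable_of_memLp hG.memLp zero_mem_I hx), hF.deriv_two x hx, hG.deriv_two x hx]
    ring

theorem neg (hF : IsH2Jet F f f1 f2) :
    IsH2Jet (-F) (fun x => -f x) (fun x => -f1 x) (fun x => -f2 x) where
  rep := by
    filter_upwards [Lp.coeFn_neg F, hF.rep] with x h1 h2
    rw [h1, Pi.neg_apply, h2]
  memLp := hF.memLp.neg
  deriv_one x hx := by
    rw [intervalIntegral.integral_neg, hF.deriv_one x hx]; ring
  deriv_two x hx := by
    rw [intervalIntegral.integral_neg, hF.deriv_two x hx]; ring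

theorem sub (hF : IsH2Jet F f f1 f2) (hG : IsH2Jet G g g1 g2) :
    IsH2Jet (F - G) (fun x => f x - g x) (fun x => f1 x - g1 x) (fun x => f2 x - g2 x) := by
  simpa only [sub_eq_add_neg] using hF.add hG.neg

theorem hasDerivWithinAt (h : IsH2Jet F f f1 f2) {x : ℝ} (hx : x ∈ Icc (0 : ℝ) 1) :
    HasDerivWithinAt f (f1 x) (Icc 0 1) x := by
  have : Fact (x ∈ Icc (0 : ℝ) 1) := ⟨hx⟩
  have h1 := intervalIntegral.integral_hasDerivWithinAt_right (s := Icc 0 1) (t := Icc 0 1)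
    (intervalIntegrable_of_continuousOn h.cont_one zero_mem_I hx)
    (h.cont_one.stronglyMeasurableAtFilter_nhdsWithin measurableSet_Icc x)
    (h.cont_one x hx)
  exact (h1.const_add (f 0)).congr_of_mem h.deriv_one hx

/-- Green's formula. -/
theorem integral_mul_two (h : IsH2Jet F f f1 f2) {φ φ1 φ2 : ℝ → ℂ}
    (hφ : ∀ x, HasDerivAt φ (φ1 x) x) (hφ1 : ∀ x, HasDerivAt φ1 (φ2 x) x) (hφ2 : Continuous φ2) :
    ∫ x in (0 : ℝ)..1, φ x * f2 x = φ 1 * f1 1 - φ 0 * f1 0 - (φ1 1 * f 1 - φ1 0 * f 0) +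
      ∫ x in (0 : ℝ)..1, φ2 x * f x := by
  have hφ1c : Continuous φ1 := continuous_iff_continuousAt.2 fun x => (hφ1 x).continuousAt
  have p1 : ∀ x ∈ Icc (0 : ℝ) 1, φ x = φ 0 + ∫ t in (0 : ℝ)..x, φ1 t := fun x _ => by
    rw [intervalIntegral.integral_eq_sub_of_hasDerivAt (fun t _ => hφ t)
      (hφ1c.intervalIntegrable _ _)]; ring
  have p2 : ∀ x ∈ Icc (0 : ℝ) 1, φ1 x = φ1 0 + ∫ t in (0 : ℝ)..x, φ2 t := fun x _ => by
    rw [intervalIntegral.integral_eq_sub_of_hasDerivAt (fun t _ => hφ1 t)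
      (hφ2.intervalIntegrable _ _)]; ring
  have i1 := integral_primitive_mul zero_le_one
    (intervalIntegrable_of_memLp h.memLp zero_mem_I one_mem_I) (hφ1c.intervalIntegrable _ _)
    h.deriv_two p1
  have i2 := integral_primitive_mul zero_le_one
    (intervalIntegrable_of_continuousOn h.cont_one zero_mem_I one_mem_I)
    (hφ2.intervalIntegrable _ _) h.deriv_one p2
  simp only [mul_comm (φ _) (f2 _), mul_comm (φ2 _) (f _)]
  rw [i1, i2]
  ring

end IsH2Jet

/-! ### The cosine basis of `L²[0,1]` -/

/-- The function `x ↦ cos (j π x)`. -/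
def cosf (j : ℕ) (x : ℝ) : ℂ := (Real.cos (j * Real.pi * x) : ℂ)

theorem continuous_cosf (j : ℕ) : Continuous (cosf j) := by
  unfold cosf; fun_prop

theorem integral_cos_int (m : ℤ) :
    ∫ x in (0 : ℝ)..1, Real.cos (m * Real.pi * x) = if m = 0 then 1 else 0 := by
  split_ifs with h
  · simp [h]
  · have hm : (m : ℝ) * Real.pi ≠ 0 := mul_ne_zero (Int.cast_ne_zero.2 h) Real.pi_ne_zero
    rw [intervalIntegral.integral_comp_mul_left (fun x => Real.cos x) hm]
    simp [Real.sin_int_mul_pi]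

theorem integral_cos_mul_cos (i j : ℕ) :
    ∫ x in (0 : ℝ)..1, Real.cos (i * Real.pi * x) * Real.cos (j * Real.pi * x) =
      if i = j then (if j = 0 then 1 else 1 / 2) else 0 := by
  have h : ∀ x : ℝ, Real.cos (i * Real.pi * x) * Real.cos (j * Real.pi * x) =
      (1 / 2) * (Real.cos (((i - j : ℤ) : ℝ) * Real.pi * x) +
        Real.cos (((i + j : ℤ) : ℝ) * Real.pi * x)) := by
    intro x
    have h1 : ((i - j : ℤ) : ℝ) * Real.pi * x = i * Real.pi * x - j * Real.pi * x := by
      push_cast; ring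
    have h2 : ((i + j : ℤ) : ℝ) * Real.pi * x = i * Real.pi * x + j * Real.pi * x := by
      push_cast; ring
    rw [h1, h2, Real.cos_sub, Real.cos_add]; ring
  simp_rw [h]
  rw [intervalIntegral.integral_const_mul, intervalIntegral.integral_add
    (Continuous.intervalIntegrable (by fun_prop) _ _)
    (Continuous.intervalIntegrable (by fun_prop) _ _), integral_cos_int, integral_cos_int]
  by_cases hij : i = j
  · subst hij
    by_cases hi : i = 0
    · simp [hi]; norm_num
    · have : (i : ℤ) + i ≠ 0 := by omega
      simp [hi, this]
  · have h1 : (i : ℤ) - j ≠ 0 := by omega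
    have h2 : (i : ℤ) + j ≠ 0 := by omega
    simp [hij, h1, h2]

/-- Normalization of the cosine functions. -/
def cosNorm (j : ℕ) : ℝ := if j = 0 then 1 else √2

theorem cosNorm_ne_zero (j : ℕ) : (cosNorm j : ℂ) ≠ 0 := by
  unfold cosNorm
  split_ifs <;> simp

theorem cosNorm_sq (j : ℕ) : cosNorm j * cosNorm j = if j = 0 then 1 else 2 := by
  unfold cosNorm
  split_ifs <;> simp

/-- The normalized cosine functions, as elements of `L²[0,1]`. -/
def cosVec (j : ℕ) : L2I :=
  contClass (fun x => cosNorm j * cosf j x) (continuous_const.mul (continuous_cosf j)).continuousOn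

theorem cosVec_ae (j : ℕ) : (cosVec j : ℝ → ℂ) =ᵐ[mu01] fun x => cosNorm j * cosf j x :=
  contClass_ae _ _

/-- The cosine coefficients of a square integrable function. -/
def cosCoeff (F : L2I) (j : ℕ) : ℂ := ∫ x in (0 : ℝ)..1, cosf j x * F x

theorem cosCoeff_eq {F : L2I} {f : ℝ → ℂ} (hF : (F : ℝ → ℂ) =ᵐ[mu01] f) (j : ℕ) :
    cosCoeff F j = ∫ x in (0 : ℝ)..1, cosf j x * f x := by
  unfold cosCoeff
  refine intervalIntegral_congr_mu01 ?_ zero_mem_I one_mem_I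
  filter_upwards [hF] with x hx
  rw [hx]

theorem inner_cosVec (F : L2I) (j : ℕ) :
    inner ℂ (cosVec j) F = cosNorm j * cosCoeff F j := by
  rw [L2.inner_def, cosCoeff, ← intervalIntegral.integral_const_mul, ← integral_mu01]
  refine integral_congr_ae ?_
  filter_upwards [cosVec_ae j] with x h
  rw [RCLike.inner_apply, h]
  simp only [cosf, map_mul, Complex.conj_ofReal]
  ring

theorem orthonormal_cosVec : Orthonormal ℂ cosVec := by
  rw [orthonormal_iff_ite]
  intro i j
  rw [inner_cosVec, cosCoeff_eq (cosVec_ae j)]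
  have h : ∀ x : ℝ, cosf i x * ((cosNorm j : ℂ) * cosf j x) =
      (cosNorm j : ℂ) * ((Real.cos (i * Real.pi * x) * Real.cos (j * Real.pi * x) : ℝ) : ℂ) := by
    intro x; simp only [cosf]; push_cast; ring
  simp_rw [h]
  rw [intervalIntegral.integral_const_mul, intervalIntegral.integral_ofReal, integral_cos_mul_cos]
  by_cases hij : i = j
  · subst hij
    rw [if_pos rfl, if_pos rfl, ← mul_assoc, ← Complex.ofReal_mul, cosNorm_sq]
    by_cases hi : i = 0 <;> simp [hi]
  · simp [hij]

/-- The product-to-sum recurrence keeps powers of cos(πx) in the span of the cosines, which is what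
the Weierstrass argument for completeness needs. -/
theorem cosf_mul_cosf_one (j : ℕ) :
    (cosf 1 * cosf (j + 1) : ℝ → ℂ) = (1 / 2 : ℂ) • (cosf (j + 2) + cosf j) := by
  funext x
  simp only [cosf, Pi.mul_apply, Pi.smul_apply, Pi.add_apply, smul_eq_mul]
  have h1 : ((j + 2 : ℕ) : ℝ) * Real.pi * x =
      ((j + 1 : ℕ) : ℝ) * Real.pi * x + ((1 : ℕ) : ℝ) * Real.pi * x := by push_cast; ring
  have h2 : (j : ℝ) * Real.pi * x =
      ((j + 1 : ℕ) : ℝ) * Real.pi * x - ((1 : ℕ) : ℝ) * Real.pi * x := by push_cast; ring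
  rw [h1, h2, Real.cos_add, Real.cos_sub]
  push_cast
  ring

theorem cosf_one_pow_mem (k : ℕ) : (cosf 1 ^ k : ℝ → ℂ) ∈ Submodule.span ℂ (range cosf) := by
  have hmul : ∀ f ∈ Submodule.span ℂ (range cosf), cosf 1 * f ∈ Submodule.span ℂ (range cosf) := by
    intro f hf
    induction hf using Submodule.span_induction with
    | mem f hf =>
      obtain ⟨j, rfl⟩ := hf
      rcases j with _ | j
      · have : (cosf 1 * cosf 0 : ℝ → ℂ) = cosf 1 := by funext x; simp [cosf]
        rw [this]
        exact Submodule.subset_span ⟨1, rfl⟩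
      · rw [cosf_mul_cosf_one]
        exact Submodule.smul_mem _ _ (Submodule.add_mem _ (Submodule.subset_span ⟨_, rfl⟩)
          (Submodule.subset_span ⟨_, rfl⟩))
    | zero => simp
    | add f g _ _ hf hg => rw [mul_add]; exact Submodule.add_mem _ hf hg
    | smul c f _ hf => rw [mul_smul_comm]; exact Submodule.smul_mem _ _ hf
  induction k with
  | zero =>
    have : (cosf 1 ^ 0 : ℝ → ℂ) = cosf 0 := by funext x; simp [cosf]
    rw [this]
    exact Submodule.subset_span ⟨0, rfl⟩
  | succ k ih => rw [pow_succ']; exact hmul _ ih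

theorem contClass_mem_of_mem_span {f : ℝ → ℂ} (hf : f ∈ Submodule.span ℂ (range cosf)) :
    ∃ hc : ContinuousOn f (Icc 0 1), contClass f hc ∈ Submodule.span ℂ (range cosVec) := by
  induction hf using Submodule.span_induction with
  | mem f hf =>
    obtain ⟨j, rfl⟩ := hf
    refine ⟨(continuous_cosf j).continuousOn, ?_⟩
    have : contClass (cosf j) (continuous_cosf j).continuousOn = (cosNorm j : ℂ)⁻¹ • cosVec j := by
      apply Lp.ext
      filter_upwards [contClass_ae _ (continuous_cosf j).continuousOn, cosVec_ae j,
        Lp.coeFn_smul (cosNorm j : ℂ)⁻¹ (cosVec j)] with x h1 h2 h3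
      rw [h1, h3, Pi.smul_apply, h2, smul_eq_mul, inv_mul_cancel_left₀ (cosNorm_ne_zero j)]
    rw [this]
    exact Submodule.smul_mem _ _ (Submodule.subset_span ⟨j, rfl⟩)
  | zero =>
    refine ⟨continuousOn_const, ?_⟩
    have : contClass (0 : ℝ → ℂ) continuousOn_const = 0 := by
      apply Lp.ext
      filter_upwards [contClass_ae (0 : ℝ → ℂ) continuousOn_const, Lp.coeFn_zero ℂ 2 mu01]
        with x h1 h2
      rw [h1, h2]
    rw [this]
    exact Submodule.zero_mem _
  | add f g _ _ hf hg =>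
    obtain ⟨hf, hf'⟩ := hf
    obtain ⟨hg, hg'⟩ := hg
    exact ⟨hf.add hg, Submodule.add_mem _ hf' hg'⟩
  | smul c f _ hf =>
    obtain ⟨hf, hf'⟩ := hf
    exact ⟨hf.const_smul c, Submodule.smul_mem _ c hf'⟩

/-- In the variable y = cos(πx) a continuous function on [0,1] becomes continuous on [-1,1];
Weierstrass approximation of its real and imaginary parts gives uniform approximation by polynomials
in cos(πx). Continuous functions are dense in L². -/
theorem span_cosVec_dense : (Submodule.span ℂ (range cosVec)).topologicalClosure = ⊤ := by
  rw [eq_top_iff]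
  have hdense := BoundedContinuousFunction.toLp_denseRange ℂ mu01 ℂ (p := 2) (by norm_num)
  intro F _
  have hsub : range (BoundedContinuousFunction.toLp 2 mu01 ℂ (E := ℂ)) ⊆
      ((Submodule.span ℂ (range cosVec)).topologicalClosure : Set L2I) := by
    rintro _ ⟨g, rfl⟩
    rw [Submodule.topologicalClosure_coe, Metric.mem_closure_iff]
    intro ε hε
    have hcont : ContinuousOn (fun y => g (Real.arccos y / Real.pi)) (Icc (-1) 1) :=
      (g.continuous.comp (Real.continuous_arccos.div_const _)).continuousOn
    obtain ⟨p, hp⟩ := exists_polynomial_near_of_continuousOn (-1) 1 _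
      (Complex.continuous_re.comp_continuousOn hcont) (ε / 4) (by positivity)
    obtain ⟨r, hr⟩ := exists_polynomial_near_of_continuousOn (-1) 1 _
      (Complex.continuous_im.comp_continuousOn hcont) (ε / 4) (by positivity)
    have hpoly : ∀ p : Polynomial ℝ, (fun x : ℝ => ((p.eval (Real.cos (Real.pi * x)) : ℝ) : ℂ)) ∈
        Submodule.span ℂ (range cosf) := by
      intro p
      have : (fun x : ℝ => ((p.eval (Real.cos (Real.pi * x)) : ℝ) : ℂ)) =
          ∑ i ∈ Finset.range (p.natDegree + 1), (p.coeff i : ℂ) • (cosf 1 ^ i : ℝ → ℂ) := by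
        funext x
        rw [Polynomial.eval_eq_sum_range]
        simp [cosf]
      rw [this]
      exact Submodule.sum_mem _ fun i _ => Submodule.smul_mem _ _ (cosf_one_pow_mem i)
    obtain ⟨hc, hmem⟩ := contClass_mem_of_mem_span (Submodule.add_mem _ (hpoly p)
      (Submodule.smul_mem _ Complex.I (hpoly r)))
    refine ⟨_, hmem, ?_⟩
    rw [dist_eq_norm]
    have hb : ∀ᵐ x ∂mu01, ‖(BoundedContinuousFunction.toLp 2 mu01 ℂ g - contClass _ hc : L2I) x‖ ≤
        ε / 2 := by
      filter_upwards [Lp.coeFn_sub (BoundedContinuousFunction.toLp 2 mu01 ℂ g) (contClass _ hc),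
        BoundedContinuousFunction.coeFn_toLp (p := 2) mu01 ℂ g, contClass_ae _ hc,
        ae_restrict_mem measurableSet_Icc] with x h1 h2 h3 hx
      rw [h1, Pi.sub_apply, h2, h3]
      have hy : Real.cos (Real.pi * x) ∈ Icc (-1 : ℝ) 1 := Real.cos_mem_Icc _
      have hinv : Real.arccos (Real.cos (Real.pi * x)) / Real.pi = x := by
        rw [Real.arccos_cos (mul_nonneg Real.pi_pos.le hx.1)
          (mul_le_of_le_one_right Real.pi_pos.le hx.2)]
        field_simp
      have h4 := hp _ hy
      have h5 := hr _ hy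
      simp only [Function.comp_apply, hinv] at h4 h5
      refine (Complex.norm_le_abs_re_add_abs_im _).trans ?_
      simp only [Pi.add_apply, Pi.smul_apply, smul_eq_mul, Complex.sub_re, Complex.add_re,
        Complex.ofReal_re, Complex.mul_re, Complex.I_re, Complex.I_im, Complex.ofReal_im,
        Complex.sub_im, Complex.add_im, Complex.mul_im]
      rw [abs_sub_comm] at h4 h5
      have e1 : (g x).re - (Polynomial.eval (Real.cos (Real.pi * x)) p +
          (0 * Polynomial.eval (Real.cos (Real.pi * x)) r - 1 * 0)) =
          (g x).re - Polynomial.eval (Real.cos (Real.pi * x)) p := by ring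
      have e2 : (g x).im - (0 + (0 * 0 + 1 * Polynomial.eval (Real.cos (Real.pi * x)) r)) =
          (g x).im - Polynomial.eval (Real.cos (Real.pi * x)) r := by ring
      rw [e1, e2]
      linarith
    have := Lp.norm_le_of_ae_bound (by positivity) hb
    have hm : measureUnivNNReal mu01 = 1 := by
      rw [measureUnivNNReal]; simp
    rw [hm] at this
    simp at this
    linarith
  have hcl : closure (range (BoundedContinuousFunction.toLp 2 mu01 ℂ (E := ℂ))) ⊆
      ((Submodule.span ℂ (range cosVec)).topologicalClosure : Set L2I) :=
    closure_minimal hsub (Submodule.isClosed_topologicalClosure _)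
  exact hcl (hdense F)

/-- The cosine basis. -/
def cosBasis : HilbertBasis ℕ ℂ L2I :=
  HilbertBasis.mk orthonormal_cosVec span_cosVec_dense.ge

theorem cosBasis_repr (F : L2I) (j : ℕ) : cosBasis.repr F j = cosNorm j * cosCoeff F j := by
  rw [HilbertBasis.repr_apply_apply, cosBasis, HilbertBasis.coe_mk, inner_cosVec]

theorem ext_cosCoeff {F G : L2I} (h : ∀ j, cosCoeff F j = cosCoeff G j) : F = G := by
  apply cosBasis.repr.injective
  ext j
  rw [cosBasis_repr, cosBasis_repr, h]

/-! ### Diagonal semigroups -/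

section Diagonal

variable {ι H : Type*} [NormedAddCommGroup H] [InnerProductSpace ℂ H]

theorem hasSum_norm_sq_repr (b : HilbertBasis ι ℂ H) (x : H) :
    HasSum (fun j => ‖b.repr x j‖ ^ 2) (‖x‖ ^ 2) := by
  have h := lp.hasSum_norm (p := 2) (by norm_num) (b.repr x)
  simp only [LinearIsometryEquiv.norm_map] at h
  simpa using h

theorem exists_repr_eq (b : HilbertBasis ι ℂ H) {a : ι → ℂ}
    (ha : Summable fun j => ‖a j‖ ^ 2) : ∃ x : H, ∀ j, b.repr x j = a j := by
  have hmem : Memℓp a 2 := memℓp_gen (by simpa using ha)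
  exact ⟨b.repr.symm ⟨a, hmem⟩, fun j => by simp⟩

/-- Dominated convergence for the Parseval sum of `f t - y`. -/
theorem tendsto_of_repr (b : HilbertBasis ι ℂ H) {α : Type*} {l : Filter α} {f : α → H} {y : H}
    {bound : ι → ℝ} (hb : Summable bound)
    (hf : ∀ᶠ t in l, ∀ j, ‖b.repr (f t - y) j‖ ^ 2 ≤ bound j)
    (hlim : ∀ j, Tendsto (fun t => b.repr (f t - y) j) l (𝓝 0)) : Tendsto f l (𝓝 y) := by
  rw [tendsto_iff_norm_sub_tendsto_zero]
  have h1 : Tendsto (fun t => ∑' j, ‖b.repr (f t - y) j‖ ^ 2) l (𝓝 (∑' _ : ι, (0 : ℝ))) := by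
    refine tendsto_tsum_of_dominated_convergence hb (fun j => ?_) ?_
    · simpa using ((hlim j).norm.pow 2)
    · filter_upwards [hf] with t ht j
      rw [Real.norm_of_nonneg (by positivity)]
      exact ht j
  simp only [(hasSum_norm_sq_repr b _).tsum_eq, tsum_zero] at h1
  have h2 := h1.sqrt
  simpa using h2

/-- Mean value inequality with `|exp (lam s)| ≤ 1`. It bounds the difference quotients of `exp (lam
t)` by `|lam|`, which yields the majorant in the generator computation. -/
theorem norm_exp_mul_sub_one_le {lam : ℂ} (hlam : lam.re ≤ 0) {t : ℝ} (ht : 0 ≤ t) :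
    ‖Complex.exp (lam * t) - 1‖ ≤ ‖lam‖ * t := by
  have h : ∀ s ∈ Icc (0 : ℝ) t, HasDerivWithinAt (fun s : ℝ => Complex.exp (lam * s))
      (Complex.exp (lam * s) * lam) (Icc 0 t) s := by
    intro s _
    have h1 : HasDerivAt (fun s : ℝ => lam * (s : ℂ)) (lam * 1) s :=
      (Complex.ofRealCLM.hasDerivAt (x := s)).const_mul lam
    simpa using h1.cexp.hasDerivWithinAt
  have := norm_image_sub_le_of_norm_deriv_le_segment' (C := ‖lam‖) h (fun s hs => by
    rw [norm_mul, Complex.norm_exp]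
    have : Real.exp (lam * s).re ≤ 1 := Real.exp_le_one_iff.2 (by
      simpa using mul_nonpos_of_nonpos_of_nonneg hlam hs.1)
    exact mul_le_of_le_one_left (norm_nonneg _) this) t (right_mem_Icc.2 ht)
  simpa using this

/-- Diagonal operators whose eigenvalues lie in a half plane to the left of the imaginary axis
generate exponentially stable semigroups. -/
theorem exists_diagonal_semigroup (b : HilbertBasis ι ℂ H) (lam : ι → ℂ) {c : ℝ} (hc : 0 < c)
    (hlam : ∀ j, (lam j).re ≤ -c) :
    ∃ S : ℝ → H →L[ℂ] H, IsC0Semigroup S ∧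
      IsGeneratorOf (fun x y => ∀ j, b.repr y j = lam j * b.repr x j) S ∧ IsExpStable S := by
  have hexp : ∀ t : ℝ, 0 ≤ t → ∀ j, ‖Complex.exp (lam j * t)‖ ≤ Real.exp (-c * t) := by
    intro t ht j
    rw [Complex.norm_exp]
    refine Real.exp_le_exp.2 ?_
    simp only [Complex.mul_re, Complex.ofReal_re, Complex.ofReal_im, mul_zero, sub_zero]
    exact mul_le_mul_of_nonneg_right (hlam j) ht
  have hexp1 : ∀ t : ℝ, 0 ≤ t → ∀ j, ‖Complex.exp (lam j * t)‖ ≤ 1 := fun t ht j =>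
    (hexp t ht j).trans (Real.exp_le_one_iff.2 (by nlinarith))
  have hbd : ∀ t : ℝ, 0 ≤ t → ∀ x j, ‖Complex.exp (lam j * t) * b.repr x j‖ ^ 2 ≤
      Real.exp (-c * t) ^ 2 * ‖b.repr x j‖ ^ 2 := by
    intro t ht x j
    rw [norm_mul, mul_pow]
    gcongr
    exact hexp t ht j
  -- At negative times the multipliers may be unbounded in `j`, so time is truncated at 0.
  have hex : ∀ t : ℝ, ∀ x : H, ∃ y : H, ∀ j,
      b.repr y j = Complex.exp (lam j * (max t 0 : ℝ)) * b.repr x j := by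
    intro t x
    exact exists_repr_eq b (Summable.of_nonneg_of_le (fun _ => by positivity)
      (hbd _ (le_max_right _ _) x) ((hasSum_norm_sq_repr b x).summable.mul_left _))
  choose D hD using hex
  have hrepr_inj : ∀ {x y : H}, (∀ j, b.repr x j = b.repr y j) → x = y := fun h =>
    b.repr.injective (lp.ext (funext h))
  have hnorm : ∀ t x, ‖D t x‖ ≤ Real.exp (-c * max t 0) * ‖x‖ := by
    intro t x
    refine le_of_sq_le_sq ?_ (by positivity)
    rw [mul_pow]
    refine hasSum_le (fun j => ?_) (hasSum_norm_sq_repr b (D t x))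
      ((hasSum_norm_sq_repr b x).mul_left _)
    rw [hD]
    exact hbd _ (le_max_right _ _) x j
  let S : ℝ → H →L[ℂ] H := fun t => LinearMap.mkContinuous
    { toFun := D t
      map_add' := fun x y => hrepr_inj fun j => by
        simp only [map_add, lp.coeFn_add, Pi.add_apply, hD]; ring
      map_smul' := fun a x => hrepr_inj fun j => by
        simp only [map_smul, lp.coeFn_smul, Pi.smul_apply, hD, smul_eq_mul, RingHom.id_apply]
        ring } (Real.exp (-c * max t 0)) (hnorm t)
  have hS : ∀ t : ℝ, 0 ≤ t → ∀ x j, b.repr (S t x) j = Complex.exp (lam j * t) * b.repr x j := by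
    intro t ht x j
    change b.repr (D t x) j = _
    rw [hD, max_eq_left ht]
  have hsubr : ∀ x y : H, ∀ j, b.repr (x - y) j = b.repr x j - b.repr y j := fun x y j => by
    rw [map_sub]; rfl
  refine ⟨S, ⟨?_, ?_, ?_⟩, ?_, 1, c, le_rfl, hc, ?_⟩
  · ext x
    refine hrepr_inj fun j => ?_
    rw [hS 0 le_rfl]; simp
  · intro s t hs ht
    ext x
    refine hrepr_inj fun j => ?_
    rw [ContinuousLinearMap.comp_apply, hS _ hs, hS _ ht, hS _ (add_nonneg hs ht), ← mul_assoc,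
      ← Complex.exp_add]
    congr 2
    push_cast; ring
  · intro x s hs
    refine tendsto_of_repr b (bound := fun j => 2 ^ 2 * ‖b.repr x j‖ ^ 2)
      ((hasSum_norm_sq_repr b x).summable.mul_left _) ?_ fun j => ?_
    · filter_upwards [self_mem_nhdsWithin] with t ht j
      rw [hsubr, hS t ht, hS s hs, ← sub_mul, norm_mul, mul_pow]
      gcongr
      exact (norm_sub_le _ _).trans (by linarith [hexp1 t ht j, hexp1 s hs j])
    · have h1 : Tendsto (fun t : ℝ => Complex.exp (lam j * t) * b.repr x j -
          Complex.exp (lam j * s) * b.repr x j) (𝓝[Ici 0] s) (𝓝 0) := by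
        refine (Continuous.tendsto' (by fun_prop) s 0 (by ring)).mono_left nhdsWithin_le_nhds
      refine h1.congr' ?_
      filter_upwards [self_mem_nhdsWithin] with t ht
      rw [hsubr, hS t ht, hS s hs]
  · intro x y
    have hder : ∀ j, Tendsto (fun t : ℝ => (t : ℂ)⁻¹ * (Complex.exp (lam j * t) - 1))
        (𝓝[>] 0) (𝓝 (lam j)) := by
      intro j
      have h1 : HasDerivAt (fun s : ℝ => lam j * (s : ℂ)) (lam j * 1) 0 :=
        (Complex.ofRealCLM.hasDerivAt (x := 0)).const_mul (lam j)
      have h2 := h1.cexp.tendsto_slope_zero_right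
      simpa using h2
    have hq : ∀ t : ℝ, 0 < t → ∀ j, b.repr ((t : ℂ)⁻¹ • (S t x - x)) j =
        (t : ℂ)⁻¹ * (Complex.exp (lam j * t) - 1) * b.repr x j := by
      intro t ht j
      rw [map_smul, lp.coeFn_smul, Pi.smul_apply, hsubr, hS t ht.le, smul_eq_mul]
      ring
    constructor
    · intro hxy
      -- Each quotient differs from `lam j` by at most `2 |lam j|`, and `lam j` times the coordinate
      -- of `x` is the coordinate of `y`, which is square summable.
      refine tendsto_of_repr b (bound := fun j => 2 ^ 2 * ‖b.repr y j‖ ^ 2)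
        ((hasSum_norm_sq_repr b y).summable.mul_left _) ?_ fun j => ?_
      · filter_upwards [self_mem_nhdsWithin] with t ht j
        have ht : 0 < t := ht
        have := norm_exp_mul_sub_one_le ((hlam j).trans (by linarith)) ht.le
        have h3 : ‖(t : ℂ)⁻¹ * (Complex.exp (lam j * t) - 1)‖ ≤ ‖lam j‖ := by
          rw [norm_mul, norm_inv, Complex.norm_real, Real.norm_of_nonneg ht.le,
            inv_mul_le_iff₀ ht]
          linarith
        have h4 : ‖(t : ℂ)⁻¹ * (Complex.exp (lam j * t) - 1) - lam j‖ ≤ 2 * ‖lam j‖ :=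
          (norm_sub_le _ _).trans (by linarith)
        rw [hsubr, hq t ht, hxy, ← sub_mul, norm_mul, norm_mul, ← mul_pow, ← mul_assoc]
        gcongr
      · have h1 : Tendsto (fun t : ℝ => (t : ℂ)⁻¹ * (Complex.exp (lam j * t) - 1) * b.repr x j -
            lam j * b.repr x j) (𝓝[>] 0) (𝓝 0) := by
          simpa using ((hder j).mul_const (b.repr x j)).sub_const (lam j * b.repr x j)
        refine h1.congr' ?_
        filter_upwards [self_mem_nhdsWithin] with t ht
        rw [hsubr, hq t ht, hxy]
    · intro hlim j
      have h1 : Tendsto (fun t : ℝ => b.repr ((t : ℂ)⁻¹ • (S t x - x)) j) (𝓝[>] 0)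
          (𝓝 (b.repr y j)) := by
        simp only [HilbertBasis.repr_apply_apply]
        exact tendsto_const_nhds.inner hlim
      have h2 := (hder j).mul_const (b.repr x j)
      refine tendsto_nhds_unique h1 (h2.congr' ?_)
      filter_upwards [self_mem_nhdsWithin] with t ht
      rw [hq t ht]
  · intro t ht x
    have := hnorm t x
    rw [max_eq_left ht] at this
    rw [one_mul]
    exact this

end Diagonal

/-! ### The Schrödinger operator with Neumann boundary conditions -/

theorem hasDerivAt_cosf (j : ℕ) (x : ℝ) :
    HasDerivAt (cosf j) (-(j * Real.pi) * (Real.sin (j * Real.pi * x) : ℂ)) x := by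
  have h1 : HasDerivAt (fun x : ℝ => (j : ℝ) * Real.pi * x) (j * Real.pi) x := by
    simpa using (hasDerivAt_id x).const_mul ((j : ℝ) * Real.pi)
  have h2 := h1.cos.ofReal_comp
  refine h2.congr_deriv ?_
  push_cast; ring

theorem hasDerivAt_cosf_deriv (j : ℕ) (x : ℝ) :
    HasDerivAt (fun x : ℝ => -(j * Real.pi) * (Real.sin (j * Real.pi * x) : ℂ))
      (-((j : ℂ) * Real.pi) ^ 2 * cosf j x) x := by
  have h1 : HasDerivAt (fun x : ℝ => (j : ℝ) * Real.pi * x) (j * Real.pi) x := by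
    simpa using (hasDerivAt_id x).const_mul ((j : ℝ) * Real.pi)
  have h2 := h1.sin.ofReal_comp.const_mul (-((j : ℂ) * Real.pi))
  refine h2.congr_deriv ?_
  unfold cosf
  push_cast; ring

/-- In Green's formula the derivative of the cosine vanishes at both ends, so only the Neumann data
of `f` survive. -/
theorem IsH2Jet.integral_cosf_mul_two {F : L2I} {f f1 f2 : ℝ → ℂ} (h : IsH2Jet F f f1 f2) (j : ℕ) :
    ∫ x in (0 : ℝ)..1, cosf j x * f2 x = cosf j 1 * f1 1 - cosf j 0 * f1 0 -
      ((j : ℂ) * Real.pi) ^ 2 * cosCoeff F j := by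
  have hg := h.integral_mul_two (hasDerivAt_cosf j) (hasDerivAt_cosf_deriv j)
    (continuous_const.mul (continuous_cosf j))
  rw [hg, cosCoeff_eq h.rep]
  have h1 : Real.sin (j * Real.pi * 1) = 0 := by rw [mul_one]; exact Real.sin_nat_mul_pi j
  rw [h1]
  simp only [mul_zero, Real.sin_zero, Complex.ofReal_zero, zero_mul, sub_zero, mul_assoc,
    intervalIntegral.integral_const_mul]
  ring

theorem ae_eq_of_integral_cosf {f g : ℝ → ℂ} (hf : MemLp f 2 mu01) (hg : MemLp g 2 mu01)
    (h : ∀ j, ∫ x in (0 : ℝ)..1, cosf j x * f x = ∫ x in (0 : ℝ)..1, cosf j x * g x) :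
    f =ᵐ[mu01] g := by
  have : hf.toLp f = hg.toLp g := ext_cosCoeff fun j => by
    rw [cosCoeff_eq hf.coeFn_toLp, cosCoeff_eq hg.coeFn_toLp, h]
  exact (MemLp.toLp_eq_toLp_iff hf hg).1 this

namespace IsH2Jet

variable {F : L2I} {f f1 f2 g g1 g2 : ℝ → ℂ}

theorem eqOn (hf : IsH2Jet F f f1 f2) (hg : IsH2Jet F g g1 g2) : EqOn f g (Icc 0 1) :=
  eqOn_of_ae_mu01 hf.cont hg.cont (hf.rep.symm.trans hg.rep)

theorem eqOn_one (hf : IsH2Jet F f f1 f2) (hg : IsH2Jet F g g1 g2) : EqOn f1 g1 (Icc 0 1) := by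
  intro x hx
  have h1 := hf.hasDerivWithinAt hx
  have h2 := (hg.hasDerivWithinAt hx).congr_of_mem (hf.eqOn hg) hx
  exact (uniqueDiffOn_Icc zero_lt_one x hx).eq_deriv _ h1 h2

/-- The cosine coefficients of the second derivative are determined by the class and by the boundary
values of the first derivative; completeness gives uniqueness. -/
theorem ae_eq_two (hf : IsH2Jet F f f1 f2) (hg : IsH2Jet F g g1 g2) : f2 =ᵐ[mu01] g2 :=
  ae_eq_of_integral_cosf hf.memLp hg.memLp fun j => by
    rw [hf.integral_cosf_mul_two, hg.integral_cosf_mul_two, hf.eqOn_one hg zero_mem_I,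
      hf.eqOn_one hg one_mem_I]

end IsH2Jet

/-- Graph of `φ ↦ -i φ'' - c φ` with the Neumann boundary conditions `φ'(0) = φ'(1) = 0`. -/
def NeumannOp (c : ℝ) (F G : L2I) : Prop :=
  ∃ f f1 f2 : ℝ → ℂ, IsH2Jet F f f1 f2 ∧ f1 0 = 0 ∧ f1 1 = 0 ∧
    (G : ℝ → ℂ) =ᵐ[mu01] fun x => -Complex.I * f2 x - (c : ℂ) * f x

/-- The eigenvalues of the Neumann operator. -/
def neumannEigenvalue (c : ℝ) (j : ℕ) : ℂ := Complex.I * ((j : ℂ) * Real.pi) ^ 2 - c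

/-- The converse recovers the exact domain: the relation between coefficients alone forces `F` to be
in H² and to satisfy the Neumann conditions. -/
theorem neumannOp_iff (c : ℝ) (F G : L2I) :
    NeumannOp c F G ↔ ∀ j, cosCoeff G j = neumannEigenvalue c j * cosCoeff F j := by
  constructor
  · rintro ⟨f, f1, f2, hF, h0, h1, hG⟩ j
    have hi2 : IntervalIntegrable (fun x => cosf j x * f2 x) volume 0 1 :=
      (intervalIntegrable_of_memLp hF.memLp zero_mem_I one_mem_I).continuousOn_mul
        (continuous_cosf j).continuousOn
    have hi0 : IntervalIntegrable (fun x => cosf j x * f x) volume 0 1 :=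
      intervalIntegrable_of_continuousOn ((continuous_cosf j).continuousOn.mul hF.cont)
        zero_mem_I one_mem_I
    rw [cosCoeff_eq hG]
    have : ∀ x, cosf j x * (-Complex.I * f2 x - (c : ℂ) * f x) =
        -Complex.I * (cosf j x * f2 x) - c * (cosf j x * f x) := fun x => by ring
    simp_rw [this]
    rw [intervalIntegral.integral_sub (hi2.const_mul _) (hi0.const_mul _),
      intervalIntegral.integral_const_mul, intervalIntegral.integral_const_mul,
      hF.integral_cosf_mul_two, h0, h1, ← cosCoeff_eq hF.rep]
    unfold neumannEigenvalue
    ring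
  · intro h
    -- The only possible second derivative, obtained by solving `G = -i f'' - c f`.
    set f2 : ℝ → ℂ := fun x => Complex.I * (G x + c * F x) with hf2
    have hf2m : MemLp f2 2 mu01 :=
      ((Lp.memLp G).add ((Lp.memLp F).const_mul (c : ℂ))).const_mul Complex.I
    have hf2i : IntervalIntegrable f2 volume 0 1 :=
      intervalIntegrable_of_memLp hf2m zero_mem_I one_mem_I
    have hf2c : ∀ j, ∫ x in (0 : ℝ)..1, cosf j x * f2 x =
        -((j : ℂ) * Real.pi) ^ 2 * cosCoeff F j := by
      intro j
      have hiG : IntervalIntegrable (fun x => cosf j x * G x) volume 0 1 :=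
        (intervalIntegrable_of_memLp (Lp.memLp G) zero_mem_I one_mem_I).continuousOn_mul
          (continuous_cosf j).continuousOn
      have hiF : IntervalIntegrable (fun x => cosf j x * F x) volume 0 1 :=
        (intervalIntegrable_of_memLp (Lp.memLp F) zero_mem_I one_mem_I).continuousOn_mul
          (continuous_cosf j).continuousOn
      have : ∀ x, cosf j x * f2 x =
          Complex.I * (cosf j x * G x) + Complex.I * c * (cosf j x * F x) := fun x => by
        simp only [hf2]; ring
      simp_rw [this]
      rw [intervalIntegral.integral_add (hiG.const_mul _) (hiF.const_mul _),
        intervalIntegral.integral_const_mul, intervalIntegral.integral_const_mul]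
      change Complex.I * cosCoeff G j + Complex.I * c * cosCoeff F j = _
      rw [h, neumannEigenvalue]
      linear_combination ((j : ℂ) * Real.pi) ^ 2 * cosCoeff F j * Complex.I_sq
    set f1 : ℝ → ℂ := fun x => ∫ t in (0 : ℝ)..x, f2 t with hf1
    have hf10 : f1 0 = 0 := by simp [hf1]
    -- The relation for `j = 0` says that `f2` has mean zero, which is the Neumann condition at 1
    -- for its primitive.
    have hf11 : f1 1 = 0 := by
      have := hf2c 0
      simpa [cosf] using this
    have hf1c : ContinuousOn f1 (Icc 0 1) :=
      continuousOn_of_primitive zero_le_one hf2i fun x _ => by rw [hf10, zero_add]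
    set k : ℝ → ℂ := fun x => ∫ t in (0 : ℝ)..x, f1 t with hk
    have hk0 : k 0 = 0 := by simp [hk]
    have hkc : ContinuousOn k (Icc 0 1) := continuousOn_of_primitive zero_le_one
      (intervalIntegrable_of_continuousOn hf1c zero_mem_I one_mem_I) fun x _ => by
        rw [hk0, zero_add]
    -- Green's formula determines the coefficients with `j > 0`, where `(jπ)² ≠ 0`; the integration
    -- constant matches the remaining one, the mean.
    set a : ℂ := cosCoeff F 0 - ∫ x in (0 : ℝ)..1, k x with ha
    have hfc : ContinuousOn (fun x => a + k x) (Icc 0 1) := continuousOn_const.add hkc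
    have hjet : IsH2Jet (contClass (fun x => a + k x) hfc) (fun x => a + k x) f1 f2 :=
      { rep := contClass_ae _ _
        memLp := hf2m
        deriv_one := fun x _ => by simp [hk]
        deriv_two := fun x _ => by rw [hf10, zero_add] }
    have hF : F = contClass (fun x => a + k x) hfc := by
      refine ext_cosCoeff fun j => ?_
      rcases Nat.eq_zero_or_pos j with rfl | hj
      · rw [cosCoeff_eq hjet.rep]
        simp only [cosf, Nat.cast_zero, zero_mul, Real.cos_zero, Complex.ofReal_one, one_mul]
        rw [intervalIntegral.integral_add intervalIntegrable_const
          (intervalIntegrable_of_continuousOn hkc zero_mem_I one_mem_I)]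
        simp [ha]
      · have h1 := hjet.integral_cosf_mul_two j
        rw [hf10, hf11, hf2c] at h1
        have hne : ((j : ℂ) * Real.pi) ^ 2 ≠ 0 := by
          have : (j : ℂ) ≠ 0 := Nat.cast_ne_zero.2 hj.ne'
          have hpi : (Real.pi : ℂ) ≠ 0 := Complex.ofReal_ne_zero.2 Real.pi_ne_zero
          exact pow_ne_zero 2 (mul_ne_zero this hpi)
        apply mul_left_cancel₀ hne
        linear_combination -h1
    refine ⟨_, f1, f2, hF ▸ hjet, hf10, hf11, ?_⟩
    have hrep : (F : ℝ → ℂ) =ᵐ[mu01] fun x => a + k x := hF ▸ hjet.rep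
    filter_upwards [hrep] with x hx
    simp only [hf2]
    rw [← hx]
    linear_combination (G x + c * F x) * Complex.I_sq

theorem exists_neumann_semigroup {c : ℝ} (hc : 0 < c) :
    ∃ S : ℝ → L2I →L[ℂ] L2I, IsC0Semigroup S ∧ IsGeneratorOf (NeumannOp c) S ∧ IsExpStable S := by
  obtain ⟨S, hS, hG, hst⟩ := exists_diagonal_semigroup cosBasis (neumannEigenvalue c) hc (fun j => by
    have : (neumannEigenvalue c j) = ((((j : ℝ) * Real.pi) ^ 2 : ℝ) : ℂ) * Complex.I - (c : ℂ) := by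
      unfold neumannEigenvalue; push_cast; ring
    rw [this, Complex.sub_re, Complex.re_ofReal_mul]
    simp)
  refine ⟨S, hS, fun x y => ?_, hst⟩
  rw [← hG, neumannOp_iff]
  refine forall_congr' fun j => ?_
  rw [cosBasis_repr, cosBasis_repr, mul_left_comm]
  exact (mul_right_inj' (cosNorm_ne_zero j)).symm

/-! ### The integral equation for the kernel in characteristic coordinates -/

section Goursat

/-- The integral of `H(t-σ) u(t,σ)` over `t ∈ [σ,a]`. -/
def charIntegral (H : ℝ → ℂ) (u : ℝ × ℝ → ℂ) (a σ : ℝ) : ℂ := ∫ t in σ..a, H (t - σ) * u (t, σ)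

/-- The integral of `charIntegral` over `σ ∈ [0,s]`. -/
def charVolume (H : ℝ → ℂ) (u : ℝ × ℝ → ℂ) (a s : ℝ) : ℂ := ∫ σ in (0 : ℝ)..s, charIntegral H u a σ

/-- The right-hand side of the integral equation for `u(a,s) = p(a-s,a+s)`. -/
def goursatRHS (H D : ℝ → ℂ) (q : ℝ) (u : ℝ × ℝ → ℂ) (a s : ℝ) : ℂ :=
  D a + D s - D 0 + 2 * Complex.I * q * (∫ σ in (0 : ℝ)..s, u (σ, σ)) +
    (charVolume H u s s + charVolume H u a s)

variable {H D : ℝ → ℂ} {q : ℝ} {u v : ℝ × ℝ → ℂ}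

theorem continuous_charIntegral (hH : Continuous H) (hu : Continuous u) :
    Continuous fun z : ℝ × ℝ => charIntegral H u z.1 z.2 := by
  have h : (fun z : ℝ × ℝ => charIntegral H u z.1 z.2) = fun z : ℝ × ℝ =>
      (∫ t in (0 : ℝ)..z.1, H (t - z.2) * u (t, z.2)) -
      ∫ t in (0 : ℝ)..z.2, H (t - z.2) * u (t, z.2) := by
    funext z
    have hc : Continuous fun t : ℝ => H (t - z.2) * u (t, z.2) := by fun_prop
    exact (intervalIntegral.integral_interval_sub_left (hc.intervalIntegrable _ _)
      (hc.intervalIntegrable _ _)).symm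
  rw [h]
  have hc : Continuous (Function.uncurry fun (z : ℝ × ℝ) (t : ℝ) => H (t - z.2) * u (t, z.2)) := by
    unfold Function.uncurry; fun_prop
  exact (intervalIntegral.continuous_parametric_intervalIntegral_of_continuous hc
    continuous_fst).sub
    (intervalIntegral.continuous_parametric_intervalIntegral_of_continuous hc continuous_snd)

theorem continuous_charVolume (hH : Continuous H) (hu : Continuous u) :
    Continuous fun z : ℝ × ℝ => charVolume H u z.1 z.2 := by
  have hc : Continuous (Function.uncurry fun (z : ℝ × ℝ) (σ : ℝ) => charIntegral H u z.1 σ) :=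
    (continuous_charIntegral hH hu).comp (by fun_prop : Continuous fun w : (ℝ × ℝ) × ℝ =>
      (w.1.1, w.2))
  exact intervalIntegral.continuous_parametric_intervalIntegral_of_continuous hc continuous_snd

theorem continuous_goursatRHS (hH : Continuous H) (hD : Continuous D) (hu : Continuous u) :
    Continuous fun z : ℝ × ℝ => goursatRHS H D q u z.1 z.2 := by
  have h1 : Continuous fun z : ℝ × ℝ => charVolume H u z.2 z.2 :=
    (continuous_charVolume hH hu).comp (continuous_snd.prodMk continuous_snd)
  have h2 : Continuous fun s : ℝ => ∫ σ in (0 : ℝ)..s, u (σ, σ) :=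
    intervalIntegral.continuous_primitive (fun a b =>
      Continuous.intervalIntegrable (by fun_prop) _ _) 0
  have h3 : Continuous fun z : ℝ × ℝ => ∫ σ in (0 : ℝ)..z.2, u (σ, σ) := h2.comp continuous_snd
  have h4 := continuous_charVolume hH hu
  unfold goursatRHS
  fun_prop

/-- Sets on which the integral equation is meaningful. -/
def IsCharDomain (Ω : Set (ℝ × ℝ)) : Prop :=
  ∀ z ∈ Ω, 0 ≤ z.2 ∧ z.2 ≤ 1 ∧ 0 ≤ z.1 ∧ z.1 ≤ 1 ∧ ∀ σ ∈ Icc 0 z.2,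
    (∀ t ∈ uIcc σ z.1, (t, σ) ∈ Ω) ∧ ∀ t ∈ uIcc σ z.2, (t, σ) ∈ Ω

theorem norm_charIntegral_sub_le (hH : Continuous H) (hu : Continuous u) (hv : Continuous v)
    {B C a σ : ℝ} (hB : ∀ t ∈ Icc (-1 : ℝ) 1, ‖H t‖ ≤ B) (hσ : 0 ≤ σ) (hσ1 : σ ≤ 1) (ha : 0 ≤ a)
    (ha1 : a ≤ 1) (hC : 0 ≤ C) (huv : ∀ t ∈ uIcc σ a, ‖u (t, σ) - v (t, σ)‖ ≤ C) :
    ‖charIntegral H u a σ - charIntegral H v a σ‖ ≤ B * C := by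
  have hB0 : 0 ≤ B := (norm_nonneg _).trans (hB 0 (by norm_num))
  unfold charIntegral
  rw [← intervalIntegral.integral_sub (Continuous.intervalIntegrable (by fun_prop) _ _)
    (Continuous.intervalIntegrable (by fun_prop) _ _)]
  have := intervalIntegral.norm_integral_le_of_norm_le_const (a := σ) (b := a) (C := B * C)
    (f := fun t => H (t - σ) * u (t, σ) - H (t - σ) * v (t, σ)) (fun t ht => by
      have ht' := uIoc_subset_uIcc ht
      rw [← mul_sub, norm_mul]
      refine mul_le_mul (hB _ ?_) (huv t ht') (norm_nonneg _) hB0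
      have := uIcc_subset_Icc ⟨hσ, hσ1⟩ ⟨ha, ha1⟩ ht'
      exact ⟨by linarith [this.1], by linarith [this.2]⟩)
  refine this.trans (mul_le_of_le_one_right (by positivity) ?_)
  rw [abs_le]; constructor <;> linarith

/-- Every term depending on `u` is an integral over `σ ∈ [0,s]`; integrating the weight `exp (κ σ)`
gains the factor `1/κ`, which makes the map contractive for large `κ`. -/
theorem norm_goursatRHS_sub_le (hH : Continuous H) (hu : Continuous u) (hv : Continuous v)
    {Ω : Set (ℝ × ℝ)} (hΩ : IsCharDomain Ω) {B κ d : ℝ} (hB : ∀ t ∈ Icc (-1 : ℝ) 1, ‖H t‖ ≤ B)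
    (hκ : 0 < κ) (hd : 0 ≤ d)
    (huv : ∀ z ∈ Ω, ‖u z - v z‖ ≤ Real.exp (κ * z.2) * d) {a s : ℝ} (hz : (a, s) ∈ Ω) :
    ‖goursatRHS H D q u a s - goursatRHS H D q v a s‖ ≤
      (2 * |q| + 2 * B) / κ * (Real.exp (κ * s) * d) := by
  obtain ⟨hs0, hs1, ha0, ha1, hσ⟩ := hΩ _ hz
  have hB0 : 0 ≤ B := (norm_nonneg _).trans (hB 0 (by norm_num))
  simp only at hs0 hs1 ha0 ha1 hσ
  have hcR : ∀ (w : ℝ × ℝ → ℂ), Continuous w → ∀ b, Continuous fun σ => charIntegral H w b σ :=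
    fun w hw b => (continuous_charIntegral hH hw).comp (by fun_prop : Continuous fun σ : ℝ => (b, σ))
  have e : goursatRHS H D q u a s - goursatRHS H D q v a s = ∫ σ in (0 : ℝ)..s,
      (2 * Complex.I * q * (u (σ, σ) - v (σ, σ)) +
        ((charIntegral H u s σ - charIntegral H v s σ) +
          (charIntegral H u a σ - charIntegral H v a σ))) := by
    have i1 : IntervalIntegrable (fun σ => u (σ, σ)) volume 0 s :=
      Continuous.intervalIntegrable (by fun_prop) _ _
    have i2 : IntervalIntegrable (fun σ => v (σ, σ)) volume 0 s :=
      Continuous.intervalIntegrable (by fun_prop) _ _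
    have i3 := (hcR u hu s).intervalIntegrable (μ := volume) 0 s
    have i4 := (hcR v hv s).intervalIntegrable (μ := volume) 0 s
    have i5 := (hcR u hu a).intervalIntegrable (μ := volume) 0 s
    have i6 := (hcR v hv a).intervalIntegrable (μ := volume) 0 s
    rw [intervalIntegral.integral_add ((i1.sub i2).const_mul _) ((i3.sub i4).add (i5.sub i6)),
      intervalIntegral.integral_add (i3.sub i4) (i5.sub i6),
      intervalIntegral.integral_sub i3 i4, intervalIntegral.integral_sub i5 i6,
      intervalIntegral.integral_const_mul, intervalIntegral.integral_sub i1 i2]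
    unfold goursatRHS charVolume
    ring
  have hint : ∫ σ in (0 : ℝ)..s, Real.exp (κ * σ) = (Real.exp (κ * s) - 1) / κ := by
    rw [intervalIntegral.integral_comp_mul_left (fun x => Real.exp x) hκ.ne']
    simp; field_simp
  rw [e]
  calc _ ≤ ∫ σ in (0 : ℝ)..s, (2 * |q| + 2 * B) * d * Real.exp (κ * σ) := by
        refine intervalIntegral.norm_integral_le_of_norm_le hs0 (ae_of_all _ fun σ hσ' => ?_)
          (Continuous.intervalIntegrable (by fun_prop) _ _)
        have hm : σ ∈ Icc 0 s := ⟨hσ'.1.le, hσ'.2⟩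
        obtain ⟨h1, h2⟩ := hσ σ hm
        have hpos : 0 ≤ Real.exp (κ * σ) * d := by positivity
        have n1 := norm_charIntegral_sub_le hH hu hv hB hm.1 (hm.2.trans hs1) hs0 hs1 hpos
          (fun t ht => huv _ (h2 t ht))
        have n2 := norm_charIntegral_sub_le hH hu hv hB hm.1 (hm.2.trans hs1) ha0 ha1 hpos
          (fun t ht => huv _ (h1 t ht))
        have n3 : ‖2 * Complex.I * q * (u (σ, σ) - v (σ, σ))‖ ≤
            2 * |q| * (Real.exp (κ * σ) * d) := by
          rw [norm_mul]
          simp only [norm_mul, Complex.norm_ofNat, Complex.norm_I, mul_one, Complex.norm_real,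
            Real.norm_eq_abs]
          gcongr
          exact huv _ (h2 σ left_mem_uIcc)
        refine (norm_add_le _ _).trans ((add_le_add n3 ((norm_add_le _ _).trans
          (add_le_add n1 n2))).trans (le_of_eq ?_))
        ring
    _ = (2 * |q| + 2 * B) * d * ((Real.exp (κ * s) - 1) / κ) := by
        rw [intervalIntegral.integral_const_mul, hint]
    _ ≤ (2 * |q| + 2 * B) * d * (Real.exp (κ * s) / κ) := by
        gcongr; linarith
    _ = _ := by ring

theorem isCharDomain_square : IsCharDomain (Icc (0 : ℝ) 1 ×ˢ Icc (0 : ℝ) 1) := by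
  rintro ⟨a, s⟩ ⟨ha, hs⟩
  refine ⟨hs.1, hs.2, ha.1, ha.2, fun σ hσ => ?_⟩
  have hσ1 : σ ∈ Icc (0 : ℝ) 1 := ⟨hσ.1, hσ.2.trans hs.2⟩
  exact ⟨fun t ht => ⟨uIcc_subset_Icc hσ1 ha ht, hσ1⟩, fun t ht => ⟨uIcc_subset_Icc hσ1 hs ht, hσ1⟩⟩

/-- The integral equation has a continuous solution on the unit square. -/
theorem exists_goursat_solution (hH : Continuous H) (hD : Continuous D) (q : ℝ) :
    ∃ u : ℝ × ℝ → ℂ, Continuous u ∧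
      ∀ a ∈ Icc (0 : ℝ) 1, ∀ s ∈ Icc (0 : ℝ) 1, u (a, s) = goursatRHS H D q u a s := by
  obtain ⟨B, hB⟩ := isCompact_Icc.exists_bound_of_continuousOn (hH.continuousOn (s := Icc (-1) 1))
  have hB0 : 0 ≤ B := (norm_nonneg _).trans (hB 0 (by norm_num))
  -- Chosen so that `(2|q| + 2B)/κ ≤ 1/2`; the summand 1 keeps `κ` positive.
  set κ : ℝ := 2 * (2 * |q| + 2 * B) + 1 with hκ
  have hκ0 : 0 < κ := by positivity
  -- The iteration is run on `exp (-κ s) u`, so that the plain sup distance acts as the weighted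
  -- one; projecting the arguments onto the square extends the result continuously to the plane.
  let ext : C(Icc (0 : ℝ) 1 × Icc (0 : ℝ) 1, ℂ) → ℝ × ℝ → ℂ := fun U z =>
    (Real.exp (κ * z.2) : ℂ) * U (projIcc 0 1 zero_le_one z.1, projIcc 0 1 zero_le_one z.2)
  have hext : ∀ U, Continuous (ext U) := by
    intro U
    have : Continuous (projIcc (0 : ℝ) 1 zero_le_one) := continuous_projIcc
    simp only [ext]
    fun_prop
  let Φ : C(Icc (0 : ℝ) 1 × Icc (0 : ℝ) 1, ℂ) → C(Icc (0 : ℝ) 1 × Icc (0 : ℝ) 1, ℂ) := fun U =>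
    ⟨fun z => (Real.exp (-(κ * z.2)) : ℂ) * goursatRHS H D q (ext U) z.1 z.2, by
      have h1 : Continuous fun z : Icc (0 : ℝ) 1 × Icc (0 : ℝ) 1 =>
          goursatRHS H D q (ext U) z.1 z.2 :=
        (continuous_goursatRHS hH hD (hext U)).comp
          (by fun_prop : Continuous fun z : Icc (0 : ℝ) 1 × Icc (0 : ℝ) 1 => ((z.1 : ℝ), (z.2 : ℝ)))
      fun_prop⟩
  have hcontr : ContractingWith (1 / 2) Φ := by
    refine ⟨by rw [← NNReal.coe_lt_coe]; norm_num, LipschitzWith.of_dist_le_mul fun U V => ?_⟩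
    rw [ContinuousMap.dist_le (by positivity)]
    rintro ⟨⟨a, ha⟩, ⟨s, hs⟩⟩
    have hle := norm_goursatRHS_sub_le (D := D) (q := q) hH (hext U) (hext V) isCharDomain_square hB
      hκ0 (dist_nonneg (x := U) (y := V)) (fun z _ => by
        simp only [ext]
        rw [← mul_sub, norm_mul, Complex.norm_real, Real.norm_of_nonneg (Real.exp_nonneg _),
          ← dist_eq_norm]
        gcongr
        exact ContinuousMap.dist_apply_le_dist _) (a := a) (s := s) ⟨ha, hs⟩
    change dist ((Real.exp (-(κ * s)) : ℂ) * goursatRHS H D q (ext U) a s)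
      ((Real.exp (-(κ * s)) : ℂ) * goursatRHS H D q (ext V) a s) ≤ _
    rw [dist_eq_norm, ← mul_sub, norm_mul, Complex.norm_real, Real.norm_of_nonneg (Real.exp_nonneg _)]
    calc _ ≤ Real.exp (-(κ * s)) * ((2 * |q| + 2 * B) / κ * (Real.exp (κ * s) * dist U V)) := by
          gcongr
      _ = (2 * |q| + 2 * B) / κ * dist U V * (Real.exp (-(κ * s)) * Real.exp (κ * s)) := by ring
      _ = (2 * |q| + 2 * B) / κ * dist U V := by rw [← Real.exp_add]; simp
      _ ≤ _ := by
          gcongr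
          rw [div_le_iff₀ hκ0, hκ]
          push_cast
          linarith
  have hfix := hcontr.fixedPoint_isFixedPt
  set U := ContractingWith.fixedPoint Φ hcontr
  refine ⟨ext U, hext U, fun a ha s hs => ?_⟩
  have h1 : U (⟨a, ha⟩, ⟨s, hs⟩) = (Real.exp (-(κ * s)) : ℂ) * goursatRHS H D q (ext U) a s := by
    conv_lhs => rw [← hfix.eq]
    rfl
  change (Real.exp (κ * s) : ℂ) * U (projIcc 0 1 zero_le_one a, projIcc 0 1 zero_le_one s) = _
  rw [projIcc_of_mem zero_le_one ha, projIcc_of_mem zero_le_one hs, h1, ← mul_assoc,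
    ← Complex.ofReal_mul, ← Real.exp_add]
  simp

/-- Uniqueness for the integral equation. -/
theorem goursat_solution_unique (hH : Continuous H) (hu : Continuous u) (hv : Continuous v)
    {Ω : Set (ℝ × ℝ)} (hΩ : IsCharDomain Ω) (hΩc : IsCompact Ω)
    (hu' : ∀ z ∈ Ω, u z = goursatRHS H D q u z.1 z.2)
    (hv' : ∀ z ∈ Ω, v z = goursatRHS H D q v z.1 z.2) : EqOn u v Ω := by
  rcases Ω.eq_empty_or_nonempty with rfl | hne
  · exact eqOn_empty _ _
  obtain ⟨B, hB⟩ := isCompact_Icc.exists_bound_of_continuousOn (hH.continuousOn (s := Icc (-1) 1))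
  have hB0 : 0 ≤ B := (norm_nonneg _).trans (hB 0 (by norm_num))
  set κ : ℝ := 2 * (2 * |q| + 2 * B) + 1 with hκ
  have hκ0 : 0 < κ := by positivity
  -- At a maximum of the weighted difference, the contraction estimate bounds this maximum by half
  -- of itself.
  obtain ⟨z0, hz0, hmax⟩ := hΩc.exists_isMaxOn hne
    (f := fun z => Real.exp (-(κ * z.2)) * ‖u z - v z‖) (by fun_prop)
  set d := Real.exp (-(κ * z0.2)) * ‖u z0 - v z0‖ with hd
  have hd0 : 0 ≤ d := by positivity
  have huv : ∀ z ∈ Ω, ‖u z - v z‖ ≤ Real.exp (κ * z.2) * d := by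
    intro z hz
    have h1 : Real.exp (-(κ * z.2)) * ‖u z - v z‖ ≤ d := hmax hz
    calc ‖u z - v z‖ = Real.exp (κ * z.2) * (Real.exp (-(κ * z.2)) * ‖u z - v z‖) := by
          rw [← mul_assoc, ← Real.exp_add]; simp
      _ ≤ _ := by gcongr
  have h2 := norm_goursatRHS_sub_le (D := D) (q := q) hH hu hv hΩ hB hκ0 hd0 huv
    (a := z0.1) (s := z0.2) hz0
  rw [← hu' z0 hz0, ← hv' z0 hz0] at h2
  have h3 : d ≤ (2 * |q| + 2 * B) / κ * d := by
    calc d ≤ Real.exp (-(κ * z0.2)) * ((2 * |q| + 2 * B) / κ * (Real.exp (κ * z0.2) * d)) := by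
          rw [hd]; gcongr
      _ = (2 * |q| + 2 * B) / κ * d * (Real.exp (-(κ * z0.2)) * Real.exp (κ * z0.2)) := by ring
      _ = _ := by rw [← Real.exp_add]; simp
  have h4 : (2 * |q| + 2 * B) / κ ≤ 1 / 2 := by
    rw [div_le_iff₀ hκ0, hκ]; linarith
  have h5 : d = 0 := by nlinarith
  intro z hz
  have := huv z hz
  rw [h5, mul_zero] at this
  exact sub_eq_zero.1 (norm_le_zero_iff.1 this)

/-! ### Differentiability of the solution -/

/-- After Fubini, `a` occurs only as an upper limit of integration, so neither `H` nor `u` has to be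
differentiated. -/
theorem hasDerivAt_charVolume_fst (hH : Continuous H) (hu : Continuous u) (a s : ℝ) :
    HasDerivAt (fun a => charVolume H u a s) (∫ σ in (0 : ℝ)..s, H (a - σ) * u (a, σ)) a := by
  have hk : Continuous (Function.uncurry fun (t σ : ℝ) => H (t - σ) * u (t, σ)) := by
    unfold Function.uncurry; fun_prop
  have hk2 : Continuous (Function.uncurry fun (σ t : ℝ) => H (t - σ) * u (t, σ)) := by
    unfold Function.uncurry; fun_prop
  have e : ∀ a, charVolume H u a s =
      (∫ t in (0 : ℝ)..a, ∫ σ in (0 : ℝ)..s, H (t - σ) * u (t, σ)) -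
        ∫ σ in (0 : ℝ)..s, ∫ t in (0 : ℝ)..σ, H (t - σ) * u (t, σ) := by
    intro a
    rw [intervalIntegral_intervalIntegral_swap, ← intervalIntegral.integral_sub]
    · unfold charVolume charIntegral
      refine intervalIntegral.integral_congr fun σ _ => ?_
      have hc : Continuous fun t : ℝ => H (t - σ) * u (t, σ) := by fun_prop
      exact (intervalIntegral.integral_interval_sub_left (hc.intervalIntegrable _ _)
        (hc.intervalIntegrable _ _)).symm
    · exact (intervalIntegral.continuous_parametric_intervalIntegral_of_continuous hk2
        continuous_const).intervalIntegrable _ _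
    · exact (intervalIntegral.continuous_parametric_intervalIntegral_of_continuous hk2
        continuous_id).intervalIntegrable _ _
    · have hK : IsCompact (uIcc (0 : ℝ) a ×ˢ uIcc (0 : ℝ) s) := isCompact_uIcc.prod isCompact_uIcc
      exact (hk.continuousOn.integrableOn_compact hK).mono_set
        (prod_mono uIoc_subset_uIcc uIoc_subset_uIcc)
  simp_rw [e]
  have hc : Continuous fun t : ℝ => ∫ σ in (0 : ℝ)..s, H (t - σ) * u (t, σ) :=
    intervalIntegral.continuous_parametric_intervalIntegral_of_continuous hk continuous_const
  exact (hc.integral_hasStrictDerivAt 0 a).hasDerivAt.sub_const _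

theorem hasDerivAt_charVolume_snd (hH : Continuous H) (hu : Continuous u) (a s : ℝ) :
    HasDerivAt (fun s => charVolume H u a s) (charIntegral H u a s) s := by
  have hc : Continuous fun σ => charIntegral H u a σ :=
    (continuous_charIntegral hH hu).comp (by fun_prop : Continuous fun σ : ℝ => (a, σ))
  exact (hc.integral_hasStrictDerivAt 0 s).hasDerivAt

/-- The `a`-derivative of `charVolume`. -/
theorem continuous_charVolume_fst_deriv (hH : Continuous H) (hu : Continuous u) :
    Continuous fun z : ℝ × ℝ => ∫ σ in (0 : ℝ)..z.2, H (z.1 - σ) * u (z.1, σ) := by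
  have hk : Continuous (Function.uncurry fun (z : ℝ × ℝ) (σ : ℝ) => H (z.1 - σ) * u (z.1, σ)) := by
    unfold Function.uncurry; fun_prop
  exact intervalIntegral.continuous_parametric_intervalIntegral_of_continuous hk continuous_snd

/-- Chain rule along a curve for a function with continuous partial derivatives. -/
theorem hasDerivAt_comp_of_partial {f f₁ f₂ : ℝ × ℝ → ℂ} {z0 : ℝ × ℝ}
    (h₁ : ∀ᶠ z in 𝓝 z0, HasDerivAt (fun t => f (t, z.2)) (f₁ z) z.1)
    (h₂ : ∀ᶠ z in 𝓝 z0, HasDerivAt (fun t => f (z.1, t)) (f₂ z) z.2)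
    (c₁ : ContinuousAt f₁ z0) (c₂ : ContinuousAt f₂ z0) {a s : ℝ → ℝ} {a' s' r : ℝ}
    (ha : HasDerivAt a a' r) (hs : HasDerivAt s s' r) (hz : (a r, s r) = z0) :
    HasDerivAt (fun r => f (a r, s r)) (f₁ z0 * a' + f₂ z0 * s') r := by
  have hc : Continuous fun w : ℂ => ContinuousLinearMap.toSpanSingleton ℝ w :=
    (ContinuousLinearMap.toSpanSingletonCLE (𝕜 := ℝ) (E := ℂ)).continuous
  have key := hasStrictFDerivAt_uncurry_coprod (𝕜 := ℝ) (u := z0) (f := fun a s => f (a, s))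
    (f₁ := fun a s => ContinuousLinearMap.toSpanSingleton ℝ (f₁ (a, s)))
    (f₂ := fun a s => ContinuousLinearMap.toSpanSingleton ℝ (f₂ (a, s)))
    (by filter_upwards [h₁] with z hz using hz.hasFDerivAt)
    (by filter_upwards [h₂] with z hz using hz.hasFDerivAt)
    (hc.continuousAt.comp c₁) (hc.continuousAt.comp c₂)
  subst hz
  have := key.hasFDerivAt.comp_hasDerivAt r (ha.prodMk hs)
  refine this.congr_deriv ?_
  rw [ContinuousLinearMap.coprod_apply]
  change a' • f₁ (a r, s r) + s' • f₂ (a r, s r) = _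
  simp [mul_comm]

theorem hasDerivAt_charVolume_comp (hH : Continuous H) (hu : Continuous u) {a s : ℝ → ℝ}
    {a' s' r : ℝ} (ha : HasDerivAt a a' r) (hs : HasDerivAt s s' r) :
    HasDerivAt (fun r => charVolume H u (a r) (s r))
      ((∫ σ in (0 : ℝ)..s r, H (a r - σ) * u (a r, σ)) * a' + charIntegral H u (a r) (s r) * s') r := by
  have h₁ : ∀ z : ℝ × ℝ, HasDerivAt (fun t => charVolume H u t z.2)
      (∫ σ in (0 : ℝ)..z.2, H (z.1 - σ) * u (z.1, σ)) z.1 :=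
    fun z => hasDerivAt_charVolume_fst hH hu z.1 z.2
  have h₂ : ∀ z : ℝ × ℝ, HasDerivAt (fun t => charVolume H u z.1 t)
      (charIntegral H u z.1 z.2) z.2 := fun z => hasDerivAt_charVolume_snd hH hu z.1 z.2
  have c₁ := continuous_charVolume_fst_deriv hH hu
  have c₂ := continuous_charIntegral hH hu
  generalize hf₁ : (fun z : ℝ × ℝ => ∫ σ in (0 : ℝ)..z.2, H (z.1 - σ) * u (z.1, σ)) = f₁ at c₁
  have hf₁' : ∀ z : ℝ × ℝ, ∫ σ in (0 : ℝ)..z.2, H (z.1 - σ) * u (z.1, σ) = f₁ z := fun z => by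
    rw [← hf₁]
  simp only [hf₁'] at h₁
  have := hasDerivAt_comp_of_partial (z0 := (a r, s r)) (f := fun z => charVolume H u z.1 z.2)
    (Eventually.of_forall h₁) (Eventually.of_forall h₂) c₁.continuousAt c₂.continuousAt ha hs rfl
  rw [← hf₁' (a r, s r)] at this
  exact this

end Goursat

/-! ### Existence and uniqueness of the kernel -/

variable {nr nd : ℕ}

theorem exists_continuous_extension {f : ℝ → ℂ} (hf : ContinuousOn f (Icc 0 1)) :
    ∃ g : ℝ → ℂ, Continuous g ∧ EqOn g f (Icc 0 1) :=
  ⟨IccExtend zero_le_one ((Icc 0 1).domRestrict f), hf.domRestrict.Icc_extend',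
    fun x hx => by rw [IccExtend_of_mem _ _ hx]; rfl⟩

theorem mem_I_of_mem_triangle {z : ℝ × ℝ} (hz : z ∈ triangle) :
    z.1 ∈ Icc (0 : ℝ) 1 ∧ z.2 ∈ Icc (0 : ℝ) 1 :=
  ⟨⟨hz.1, hz.2.1.trans hz.2.2⟩, ⟨hz.1.trans hz.2.1, hz.2.2⟩⟩

/-- A continuous retraction of the plane onto the triangle. -/
def triRetract (z : ℝ × ℝ) : ℝ × ℝ :=
  (max 0 (min z.1 (max 0 (min z.2 1))), max 0 (min z.2 1))

theorem continuous_triRetract : Continuous triRetract := by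
  unfold triRetract; fun_prop

theorem triRetract_mem (z : ℝ × ℝ) : triRetract z ∈ triangle :=
  ⟨le_max_left _ _, max_le (le_max_left _ _) (min_le_right _ _),
    max_le zero_le_one (min_le_right _ _)⟩

theorem triRetract_eq {z : ℝ × ℝ} (hz : z ∈ triangle) : triRetract z = z := by
  obtain ⟨h1, h2, h3⟩ := hz
  have e : max 0 (min z.2 1) = z.2 := by rw [min_eq_left h3, max_eq_right (h1.trans h2)]
  unfold triRetract
  rw [e, min_eq_left h2, max_eq_right h1]

theorem exists_continuous_extension_triangle {f : ℝ × ℝ → ℂ} (hf : ContinuousOn f triangle) :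
    ∃ g : ℝ × ℝ → ℂ, Continuous g ∧ EqOn g f triangle :=
  ⟨fun z => f (triRetract z), hf.comp_continuous continuous_triRetract triRetract_mem,
    fun z hz => by simp only [triRetract_eq hz]⟩

theorem hasDerivAt_goursatRHS {H D D' : ℝ → ℂ} {q : ℝ} {u : ℝ × ℝ → ℂ} (hH : Continuous H)
    (hu : Continuous u) (hD : ∀ x, HasDerivAt D (D' x) x) {a s : ℝ → ℝ} {a' s' r : ℝ}
    (ha : HasDerivAt a a' r) (hs : HasDerivAt s s' r) :
    HasDerivAt (fun r => goursatRHS H D q u (a r) (s r))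
      ((D' (a r) + ∫ σ in (0 : ℝ)..s r, H (a r - σ) * u (a r, σ)) * a' +
        (D' (s r) + 2 * Complex.I * q * u (s r, s r) +
          (∫ σ in (0 : ℝ)..s r, H (s r - σ) * u (s r, σ)) + charIntegral H u (a r) (s r)) * s') r := by
  have h1 := hasDerivAt_charVolume_comp hH hu ha hs
  have h2 := hasDerivAt_charVolume_comp hH hu hs hs
  have h3 : HasDerivAt (fun r => D (a r)) (D' (a r) * a') r := by
    simpa [mul_comm, Function.comp_def] using! HasDerivAt.scomp r (hD (a r)) ha
  have h4 : HasDerivAt (fun r => D (s r)) (D' (s r) * s') r := by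
    simpa [mul_comm, Function.comp_def] using! HasDerivAt.scomp r (hD (s r)) hs
  have hc : Continuous fun σ : ℝ => u (σ, σ) := by fun_prop
  have h5 : HasDerivAt (fun r => ∫ σ in (0 : ℝ)..s r, u (σ, σ)) (u (s r, s r) * s') r := by
    simpa [mul_comm, Function.comp_def] using!
      HasDerivAt.scomp r (hc.integral_hasStrictDerivAt 0 (s r)).hasDerivAt hs
  have h6 : charIntegral H u (s r) (s r) = 0 := by simp [charIntegral]
  rw [h6, zero_mul, add_zero] at h2
  have := (((h3.add h4).sub_const (D 0)).add (h5.const_mul (2 * Complex.I * q))).add (h2.add h1)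
  refine this.congr_deriv ?_
  ring

theorem exists_isKernel (P : PlantData nr nd) (c : ℝ) (hh : ContinuousOn P.h (Icc 0 1)) :
    ∃ p px pξ : ℝ × ℝ → ℂ, IsKernel P c p px pξ := by
  obtain ⟨hE, hEc, hEq⟩ := exists_continuous_extension hh
  set H : ℝ → ℂ := fun x => Complex.I * (hE x + c) with hH
  set D' : ℝ → ℂ := fun x => -(Complex.I / 2) * (hE x + c) with hD'
  set D : ℝ → ℂ := fun x => -(Complex.I / 2) * (∫ s in (0 : ℝ)..x, (hE s + c)) - Complex.I * P.q
    with hD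
  have hHc : Continuous H := by fun_prop
  have hD'c : Continuous D' := by fun_prop
  have hDd : ∀ x, HasDerivAt D (D' x) x := fun x => by
    have hc : Continuous fun s => hE s + c := by fun_prop
    exact ((hc.integral_hasStrictDerivAt 0 x).hasDerivAt.const_mul _).sub_const _
  have hDc : Continuous D := continuous_iff_continuousAt.2 fun x => (hDd x).continuousAt
  obtain ⟨u, hu, hufix⟩ := exists_goursat_solution hHc hDc P.q
  set Pa : ℝ × ℝ → ℂ := fun w => D' w.1 + ∫ σ in (0 : ℝ)..w.2, H (w.1 - σ) * u (w.1, σ) with hPa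
  set Ps : ℝ × ℝ → ℂ := fun w => D' w.2 + 2 * Complex.I * P.q * u (w.2, w.2) +
    (∫ σ in (0 : ℝ)..w.2, H (w.2 - σ) * u (w.2, σ)) + charIntegral H u w.1 w.2 with hPs
  have hVc := continuous_charVolume_fst_deriv hHc hu
  have hPac : Continuous Pa := (hD'c.comp continuous_fst).add hVc
  have hPsc : Continuous Ps := by
    have h1 : Continuous fun w : ℝ × ℝ => ∫ σ in (0 : ℝ)..w.2, H (w.2 - σ) * u (w.2, σ) :=
      hVc.comp (continuous_snd.prodMk continuous_snd)
    have h2 := continuous_charIntegral hHc hu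
    exact ((by fun_prop : Continuous fun w : ℝ × ℝ =>
      D' w.2 + 2 * Complex.I * P.q * u (w.2, w.2)).add h1).add h2
  set ch : ℝ × ℝ → ℝ × ℝ := fun z => ((z.1 + z.2) / 2, (z.2 - z.1) / 2) with hch
  have hchc : Continuous ch := by fun_prop
  -- The right-hand side of the integral equation is differentiable on the whole plane, whereas `u`
  -- agrees with it only on the unit square; hence `p` is defined through it.
  set p : ℝ × ℝ → ℂ := fun z => goursatRHS H D P.q u (ch z).1 (ch z).2 with hp
  have hpu : ∀ z ∈ triangle, p z = u (ch z) := by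
    rintro ⟨x, ξ⟩ ⟨h1, h2, h3⟩
    simp only at h1 h2 h3
    exact (hufix _ ⟨by simp only [hch]; linarith, by simp only [hch]; linarith⟩ _
      ⟨by simp only [hch]; linarith, by simp only [hch]; linarith⟩).symm
  refine ⟨p, fun z => (Pa (ch z) - Ps (ch z)) / 2, fun z => (Pa (ch z) + Ps (ch z)) / 2, ?_⟩
  refine
    { cont := ((continuous_goursatRHS hHc hDc hu).comp hchc).continuousOn
      cont_x := Continuous.continuousOn (by fun_prop)
      cont_ξ := Continuous.continuousOn (by fun_prop)
      partial_x := ?_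
      partial_ξ := ?_
      wave := ?_
      left := ?_
      diag := ?_ }
  · intro x ξ _ _ _
    have ha : HasDerivAt (fun r : ℝ => (r + ξ) / 2) (1 / 2) x :=
      ((hasDerivAt_id x).add_const ξ).div_const 2
    have hs : HasDerivAt (fun r : ℝ => (ξ - r) / 2) (-1 / 2) x :=
      ((hasDerivAt_id x).const_sub ξ).div_const 2
    refine (hasDerivAt_goursatRHS (q := P.q) hHc hu hDd ha hs).congr_deriv ?_
    simp only [hPa, hPs, hch]
    push_cast
    ring
  · intro x ξ _ _ _
    have ha : HasDerivAt (fun r : ℝ => (x + r) / 2) (1 / 2) ξ :=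
      ((hasDerivAt_id ξ).const_add x).div_const 2
    have hs : HasDerivAt (fun r : ℝ => (r - x) / 2) (1 / 2) ξ :=
      ((hasDerivAt_id ξ).sub_const x).div_const 2
    refine (hasDerivAt_goursatRHS (q := P.q) hHc hu hDd ha hs).congr_deriv ?_
    simp only [hPa, hPs, hch]
    push_cast
    ring
  · intro x ξ hx hxξ hξ
    set a := (x + ξ) / 2 with ha
    set s := (ξ - x) / 2 with hs
    -- Moving in the direction (1,1) changes only the first characteristic coordinate. Since `p_ξ -
    -- p_x` is the `s`-derivative, only the upper limit of `charIntegral` varies.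
    have e : (fun r : ℝ => (Pa (ch (x + r, ξ + r)) + Ps (ch (x + r, ξ + r))) / 2 -
        (Pa (ch (x + r, ξ + r)) - Ps (ch (x + r, ξ + r))) / 2) = fun r =>
        (D' s + 2 * Complex.I * P.q * u (s, s) + ∫ σ in (0 : ℝ)..s, H (s - σ) * u (s, σ)) +
          charIntegral H u (a + r) s := by
      funext r
      have h1 : ch (x + r, ξ + r) = (a + r, s) := by
        simp only [hch, ha, hs]
        congr 1 <;> ring
      rw [h1]
      simp only [hPs]
      ring
    rw [e]
    have hk : Continuous fun t : ℝ => H (t - s) * u (t, s) := by fun_prop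
    have h2 : HasDerivAt (fun r : ℝ => charIntegral H u (a + r) s) (H (a - s) * u (a, s)) 0 := by
      have h3 := (hk.integral_hasStrictDerivAt s (a + 0)).hasDerivAt
      have h4 := HasDerivAt.scomp (h := fun r : ℝ => a + r) (0 : ℝ) h3
        ((hasDerivAt_id (0 : ℝ)).const_add a)
      simpa [Function.comp_def, charIntegral] using h4
    refine (h2.const_add _).congr_deriv ?_
    have h5 : a - s = x := by simp only [ha, hs]; ring
    have h6 : (P.h x : ℂ) = hE x := (hEq ⟨hx.le, by linarith⟩).symm
    rw [hpu (x, ξ) ⟨hx.le, hxξ.le, hξ.le⟩, h5, h6]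
  · intro ξ hξ
    have h1 : ch (0, ξ) = (ξ / 2, ξ / 2) := by simp [hch]
    have h2 : charIntegral H u (ξ / 2) (ξ / 2) = 0 := by simp [charIntegral]
    rw [hpu (0, ξ) ⟨le_rfl, hξ.1, hξ.2⟩, h1]
    simp only [hPa, hPs, h2]
    ring
  · intro x hx
    have h1 : ch (x, x) = (x, 0) := by simp [hch]
    have h2 : ∫ s in (0 : ℝ)..x, (hE s + c) = ∫ s in (0 : ℝ)..x, (P.h s + (c : ℂ)) := by
      refine intervalIntegral.integral_congr fun s hs => ?_
      have := uIcc_subset_Icc zero_mem_I hx hs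
      simp only [hEq this]
    simp only [hp, h1, goursatRHS, charVolume, intervalIntegral.integral_same]
    simp only [hD, h2]
    simp

/-- Any kernel solves the integral equation in characteristic coordinates. -/
theorem IsKernel.goursat {P : PlantData nr nd} {c : ℝ} {p px pξ : ℝ × ℝ → ℂ}
    (hk : IsKernel P c p px pξ) {hE : ℝ → ℂ} (hEc : Continuous hE) (hEq : EqOn hE P.h (Icc 0 1))
    {u : ℝ × ℝ → ℂ} (hu : Continuous u)
    (hup : ∀ z ∈ triangle, u ((z.1 + z.2) / 2, (z.2 - z.1) / 2) = p z) {a s : ℝ} (hs : 0 ≤ s)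
    (hsa : s ≤ a) (has : a + s ≤ 1) :
    u (a, s) = goursatRHS (fun x => Complex.I * (hE x + c))
      (fun x => -(Complex.I / 2) * (∫ s in (0 : ℝ)..x, (hE s + c)) - Complex.I * P.q) P.q u a s := by
  set H : ℝ → ℂ := fun x => Complex.I * (hE x + c) with hH
  set D : ℝ → ℂ := fun x => -(Complex.I / 2) * (∫ s in (0 : ℝ)..x, (hE s + c)) - Complex.I * P.q
    with hD
  have hHc : Continuous H := by fun_prop
  have hup' : ∀ a s : ℝ, 0 ≤ s → s ≤ a → a + s ≤ 1 → u (a, s) = p (a - s, a + s) := by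
    intro a s h1 h2 h3
    rw [← hup (a - s, a + s) ⟨by simpa using h2, by simpa using by linarith, by simpa using h3⟩]
    congr 2 <;> ring
  obtain ⟨gx, gxc, gxe⟩ := exists_continuous_extension_triangle hk.cont_x
  obtain ⟨gξ, gξc, gξe⟩ := exists_continuous_extension_triangle hk.cont_ξ
  -- The function `p_ξ - p_x` in characteristic coordinates: its derivative along `a` is given by
  -- the wave equation, and it is itself the derivative of `u` along `s`.
  set m : ℝ → ℝ → ℂ := fun a s => gξ (a - s, a + s) - gx (a - s, a + s) with hm
  have hDu : ∀ x ∈ Icc (0 : ℝ) 1, u (x, 0) = D x := by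
    intro x hx
    rw [hup' x 0 le_rfl hx.1 (by simpa using hx.2), sub_zero, add_zero, hk.diag x hx]
    have h2 : ∫ s in (0 : ℝ)..x, (hE s + c) = ∫ s in (0 : ℝ)..x, (P.h s + (c : ℂ)) := by
      refine intervalIntegral.integral_congr fun s hs => ?_
      have := uIcc_subset_Icc zero_mem_I hx hs
      simp only [hEq this]
    simp only [hD, h2]
  have hopen : IsOpen {z : ℝ × ℝ | 0 < z.1 ∧ z.1 < z.2 ∧ z.2 < 1} :=
    (isOpen_lt continuous_const continuous_fst).inter
      ((isOpen_lt continuous_fst continuous_snd).inter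
        (isOpen_lt continuous_snd continuous_const))
  -- transport along the characteristics of direction `(1,1)`
  have step1 : ∀ a s : ℝ, 0 < s → s ≤ a → a + s ≤ 1 → m a s = m s s + charIntegral H u a s := by
    intro a s h1 h2 h3
    have hftc := intervalIntegral.integral_eq_sub_of_hasDerivAt_of_le h2
      (f := fun t => m t s) (f' := fun t => H (t - s) * u (t, s))
      (Continuous.continuousOn (by fun_prop)) (fun t ht => by
        have hx : 0 < t - s := sub_pos.2 ht.1
        have hξ : t + s < 1 := by linarith [ht.2]
        have hw := hk.wave (t - s) (t + s) hx (by linarith) hξ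
        have he : (fun r : ℝ => m (t + r) s) =ᶠ[𝓝 0] fun r =>
            pξ (t - s + r, t + s + r) - px (t - s + r, t + s + r) := by
          have hc : Continuous fun r : ℝ => (t - s + r, t + s + r) := by fun_prop
          have hmem : ∀ᶠ r in 𝓝 (0 : ℝ), (t - s + r, t + s + r) ∈
              {z : ℝ × ℝ | 0 < z.1 ∧ z.1 < z.2 ∧ z.2 < 1} :=
            hc.continuousAt.eventually_mem (hopen.mem_nhds (by
              refine ⟨?_, ?_, ?_⟩ <;> simp only [add_zero] <;> linarith))
          filter_upwards [hmem] with r hr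
          have ht : (t - s + r, t + s + r) ∈ triangle := ⟨hr.1.le, hr.2.1.le, hr.2.2.le⟩
          have e1 : t + r - s = t - s + r := by ring
          have e2 : t + r + s = t + s + r := by ring
          simp only [hm]
          rw [e1, e2, gxe ht, gξe ht]
        have hw2 := hw.congr_of_eventuallyEq he
        have hw3 := HasDerivAt.scomp (h := fun r : ℝ => r - t) (h' := 1) t
          (by simpa using hw2) (by simpa using (hasDerivAt_id t).sub_const t)
        have hH' : H (t - s) = Complex.I * (P.h (t - s) + c) := by
          simp only [hH]; rw [hEq ⟨hx.le, by linarith⟩]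
        have hu' := hup' t s h1.le ht.1.le hξ.le
        rw [hH', hu']
        simpa [Function.comp_def] using hw3)
      (Continuous.intervalIntegrable (by fun_prop) _ _)
    unfold charIntegral
    rw [hftc]; ring
  -- transport along the characteristics of direction `(-1,1)`
  have step2 : ∀ a s : ℝ, 0 ≤ s → s ≤ a → a + s ≤ 1 → u (a, s) = D a + ∫ σ in (0 : ℝ)..s, m a σ := by
    intro a s h1 h2 h3
    have hftc := intervalIntegral.integral_eq_sub_of_hasDerivAt_of_le h1
      (f := fun σ => u (a, σ)) (f' := fun σ => m a σ)
      (Continuous.continuousOn (by fun_prop)) (fun σ hσ => by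
        have hz : (a - σ, a + σ) ∈ {z : ℝ × ℝ | 0 < z.1 ∧ z.1 < z.2 ∧ z.2 < 1} :=
          ⟨by simp only; linarith [hσ.2], by simp only; linarith [hσ.1],
            by simp only; linarith [hσ.2]⟩
        have hnear := hopen.mem_nhds hz
        have ht : (a - σ, a + σ) ∈ triangle := ⟨hz.1.le, hz.2.1.le, hz.2.2.le⟩
        have hcx : ContinuousAt px (a - σ, a + σ) := gxc.continuousAt.congr (by
          filter_upwards [hnear] with w hw using gxe ⟨hw.1.le, hw.2.1.le, hw.2.2.le⟩)
        have hcξ : ContinuousAt pξ (a - σ, a + σ) := gξc.continuousAt.congr (by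
          filter_upwards [hnear] with w hw using gξe ⟨hw.1.le, hw.2.1.le, hw.2.2.le⟩)
        have hd := hasDerivAt_comp_of_partial (f := p) (f₁ := px) (f₂ := pξ)
          (z0 := (a - σ, a + σ)) (a := fun r => a - r) (s := fun r => a + r)
          (by filter_upwards [hnear] with w hw using hk.partial_x _ _ hw.1 hw.2.1 hw.2.2)
          (by filter_upwards [hnear] with w hw using hk.partial_ξ _ _ hw.1 hw.2.1 hw.2.2)
          hcx hcξ ((hasDerivAt_id σ).const_sub a) ((hasDerivAt_id σ).const_add a) rfl
        have he : (fun r : ℝ => u (a, r)) =ᶠ[𝓝 σ] fun r => p (a - r, a + r) := by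
          filter_upwards [Ioo_mem_nhds hσ.1 hσ.2] with r hr
          exact hup' a r hr.1.le (hr.2.le.trans h2) (by linarith [hr.2])
        refine (hd.congr_of_eventuallyEq he).congr_deriv ?_
        simp only [hm]
        rw [gxe ht, gξe ht]
        push_cast
        ring)
      (Continuous.intervalIntegrable (by fun_prop) _ _)
    rw [hftc, hDu a ⟨h1.trans h2, by linarith⟩]
    ring
  -- the boundary `x = 0`
  have step3 : ∀ y : ℝ, 0 ≤ y → y ≤ 1 →
      u (y / 2, y / 2) - u (0, 0) = ∫ ξ in (0 : ℝ)..y, gξ (0, ξ) := by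
    intro y hy0 hy1
    rcases hy0.eq_or_lt with rfl | hy0
    · simp
    have hc1 : Continuous fun x : ℝ => u ((x + y) / 2, (y - x) / 2) - u (x, 0) := by fun_prop
    have hcP : Continuous (Function.uncurry fun (x : ℝ) (ξ : ℝ) => gξ (x, ξ)) := by
      unfold Function.uncurry; fun_prop
    have hc2 : Continuous fun x : ℝ => (∫ ξ in (0 : ℝ)..y, gξ (x, ξ)) - ∫ ξ in (0 : ℝ)..x, gξ (x, ξ) :=
      (intervalIntegral.continuous_parametric_intervalIntegral_of_continuous hcP
        continuous_const).sub
        (intervalIntegral.continuous_parametric_intervalIntegral_of_continuous hcP continuous_id)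
    -- The partial derivative is available only inside the triangle. The integrated identity holds
    -- for `0 < x < y` and passes to `x = 0` by continuity.
    have heq : EqOn (fun x : ℝ => u ((x + y) / 2, (y - x) / 2) - u (x, 0))
        (fun x : ℝ => (∫ ξ in (0 : ℝ)..y, gξ (x, ξ)) - ∫ ξ in (0 : ℝ)..x, gξ (x, ξ)) (Ioo 0 y) := by
      intro x hx
      have hi : ∀ b b', IntervalIntegrable (fun ξ => gξ (x, ξ)) volume b b' := fun b b' =>
        Continuous.intervalIntegrable (by fun_prop) _ _
      have hftc := intervalIntegral.integral_eq_sub_of_hasDerivAt_of_le hx.2.le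
        (f := fun ξ => u ((x + ξ) / 2, (ξ - x) / 2)) (f' := fun ξ => gξ (x, ξ))
        (Continuous.continuousOn (by fun_prop)) (fun ξ hξ => by
          have hd := hk.partial_ξ x ξ hx.1 hξ.1 (by linarith [hξ.2])
          have he : (fun r : ℝ => u ((x + r) / 2, (r - x) / 2)) =ᶠ[𝓝 ξ] fun r => p (x, r) := by
            filter_upwards [Ioo_mem_nhds hξ.1 hξ.2] with r hr
            exact hup (x, r) ⟨hx.1.le, hr.1.le, by linarith [hr.2]⟩
          rw [gξe ⟨hx.1.le, hξ.1.le, by linarith [hξ.2]⟩]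
          exact hd.congr_of_eventuallyEq he) (hi _ _)
      simp only
      rw [intervalIntegral.integral_interval_sub_left (hi _ _) (hi _ _), hftc]
      have e1 : (x + x) / 2 = x := by ring
      rw [e1, sub_self, zero_div]
    have h0 := heq.closure hc1 hc2
    rw [closure_Ioo hy0.ne] at h0
    have := h0 (left_mem_Icc.2 hy0.le)
    simpa using this
  have hint : ∀ (b t : ℝ), IntervalIntegrable (fun σ => charIntegral H u b σ) volume 0 t :=
    fun b t => Continuous.intervalIntegrable ((continuous_charIntegral hHc hu).comp
      (by fun_prop : Continuous fun σ : ℝ => (b, σ))) _ _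
  have hmd : IntervalIntegrable (fun σ => m σ σ) volume 0 s :=
    Continuous.intervalIntegrable (by fun_prop) _ _
  have hm1 : ∀ b, s ≤ b → b + s ≤ 1 →
      ∫ σ in (0 : ℝ)..s, m b σ = (∫ σ in (0 : ℝ)..s, m σ σ) + charVolume H u b s := by
    intro b hb hbs
    unfold charVolume
    rw [← intervalIntegral.integral_add hmd (hint b s)]
    refine intervalIntegral.integral_congr_ae (ae_of_all _ fun σ hσ => ?_)
    rw [uIoc_of_le hs] at hσ
    exact step1 b σ hσ.1 (hσ.2.trans hb) (by linarith [hσ.2])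
  have h2s : 2 * s ≤ 1 := by linarith
  -- On the edge x = 0 the boundary condition replaces `-p_x` by `i q p`, and the integral of `p_ξ`
  -- telescopes; the factor 1/2 comes from `ξ = 2σ`.
  have hm2 : ∫ σ in (0 : ℝ)..s, m σ σ =
      (u (s, s) - u (0, 0)) / 2 + Complex.I * P.q * ∫ σ in (0 : ℝ)..s, u (σ, σ) := by
    have h1 : ∫ σ in (0 : ℝ)..s, m σ σ =
        ∫ σ in (0 : ℝ)..s, (gξ (0, 2 * σ) + Complex.I * P.q * u (σ, σ)) := by
      refine intervalIntegral.integral_congr fun σ hσ => ?_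
      rw [uIcc_of_le hs] at hσ
      have hσ2 : 2 * σ ∈ Icc (0 : ℝ) 1 := ⟨by linarith [hσ.1], by linarith [hσ.2]⟩
      have hl := hk.left (2 * σ) hσ2
      have e1 : u (σ, σ) = p (0, 2 * σ) := by
        rw [hup' σ σ hσ.1 le_rfl (by linarith [hσ.2]), sub_self, two_mul]
      have e2 : σ + σ = 2 * σ := by ring
      simp only [hm, sub_self, e2, e1]
      rw [gxe (show ((0 : ℝ), 2 * σ) ∈ triangle from ⟨le_rfl, hσ2.1, hσ2.2⟩)]
      linear_combination -hl
    have h3 := step3 (2 * s) (by linarith) h2s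
    have h4 : ∫ σ in (0 : ℝ)..s, gξ (0, 2 * σ) = (1 / 2) * ∫ ξ in (0 : ℝ)..(2 * s), gξ (0, ξ) := by
      rw [intervalIntegral.integral_comp_mul_left (fun ξ => gξ (0, ξ)) two_ne_zero]
      simp
    have e3 : 2 * s / 2 = s := by ring
    rw [e3] at h3
    rw [h1, intervalIntegral.integral_add (Continuous.intervalIntegrable (by fun_prop) _ _)
      (Continuous.intervalIntegrable (by fun_prop) _ _), intervalIntegral.integral_const_mul, h4,
      ← h3]
    ring
  have hs1 := step2 s s hs le_rfl (by linarith)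
  rw [hm1 s le_rfl (by linarith)] at hs1
  have ha1 := step2 a s hs hsa has
  rw [hm1 a hsa has] at ha1
  have h0 : u (0, 0) = D 0 := hDu 0 zero_mem_I
  rw [ha1]
  unfold goursatRHS
  rw [h0] at hm2
  -- The edge relation and the formula for `u (s, s)` together eliminate both `u (s, s)` and the
  -- integral of `m σ σ`.
  linear_combination 2 * hm2 + hs1

theorem interior_triangle_dense : triangle ⊆ closure {z : ℝ × ℝ | 0 < z.1 ∧ z.1 < z.2 ∧ z.2 < 1} := by
  rintro ⟨x, ξ⟩ ⟨h1, h2, h3⟩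
  simp only at h1 h2 h3
  -- Every point is approached along the segment to the interior point (1/3, 2/3).
  have hlim : Tendsto (fun t : ℝ => ((1 - t) * x + t * (1 / 3), (1 - t) * ξ + t * (2 / 3))) (𝓝[>] 0)
      (𝓝 (x, ξ)) := by
    refine (Continuous.tendsto' (by fun_prop) 0 _ (by simp)).mono_left nhdsWithin_le_nhds
  refine mem_closure_of_tendsto hlim ?_
  filter_upwards [Ioo_mem_nhdsGT (zero_lt_one' ℝ)] with t ht
  obtain ⟨ht0, ht1⟩ := ht
  refine ⟨?_, ?_, ?_⟩ <;> nlinarith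

/-- Both kernels solve the same integral equation in characteristic coordinates. Their partial
derivatives then agree in the interior and, by continuity, on the closed triangle. -/
theorem IsKernel.unique {P : PlantData nr nd} {c : ℝ} (hh : ContinuousOn P.h (Icc 0 1))
    {p px pξ p' px' pξ' : ℝ × ℝ → ℂ} (hk : IsKernel P c p px pξ) (hk' : IsKernel P c p' px' pξ') :
    EqOn p' p triangle ∧ EqOn px' px triangle ∧ EqOn pξ' pξ triangle := by
  obtain ⟨hE, hEc, hEq⟩ := exists_continuous_extension hh
  have hHc : Continuous fun x => Complex.I * (hE x + (c : ℂ)) := by fun_prop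
  -- The image of the triangle in characteristic coordinates: a kernel determines `u` only there,
  -- and the integral equation on this set uses no values outside it.
  set Ω : Set (ℝ × ℝ) := {z | 0 ≤ z.2 ∧ z.2 ≤ z.1 ∧ z.1 + z.2 ≤ 1} with hΩ
  have hΩd : IsCharDomain Ω := by
    rintro ⟨a, s⟩ ⟨h1, h2, h3⟩
    simp only at h1 h2 h3
    refine ⟨h1, by simp only; linarith, by simp only; linarith, by simp only; linarith,
      fun σ hσ => ⟨fun t ht => ?_, fun t ht => ?_⟩⟩
    · rw [uIcc_of_le (hσ.2.trans h2)] at ht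
      exact ⟨hσ.1, ht.1, by simp only; linarith [ht.2, hσ.2]⟩
    · rw [uIcc_of_le hσ.2] at ht
      exact ⟨hσ.1, ht.1, by simp only; linarith [ht.2, hσ.2]⟩
  have hΩc : IsCompact Ω := by
    refine (isCompact_Icc (a := ((0 : ℝ), (0 : ℝ))) (b := (1, 1))).of_isClosed_subset ?_ ?_
    · exact (isClosed_le continuous_const continuous_snd).inter
        ((isClosed_le continuous_snd continuous_fst).inter
          (isClosed_le (continuous_fst.add continuous_snd) continuous_const))
    · rintro ⟨a, s⟩ ⟨h1, h2, h3⟩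
      simp only at h1 h2 h3
      exact ⟨⟨by simp only; linarith, h1⟩, ⟨by simp only; linarith, by simp only; linarith⟩⟩
  have hrep : ∀ {p px pξ : ℝ × ℝ → ℂ}, IsKernel P c p px pξ → ∃ u : ℝ × ℝ → ℂ, Continuous u ∧
      (∀ z ∈ triangle, u ((z.1 + z.2) / 2, (z.2 - z.1) / 2) = p z) ∧
      ∀ z ∈ Ω, u z = goursatRHS (fun x => Complex.I * (hE x + c))
        (fun x => -(Complex.I / 2) * (∫ s in (0 : ℝ)..x, (hE s + c)) - Complex.I * P.q)
        P.q u z.1 z.2 := by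
    intro p px pξ hk
    obtain ⟨g, gc, ge⟩ := exists_continuous_extension_triangle hk.cont
    have h1 : ∀ z ∈ triangle, g ((z.1 + z.2) / 2 - (z.2 - z.1) / 2,
        (z.1 + z.2) / 2 + (z.2 - z.1) / 2) = p z := by
      rintro ⟨x, ξ⟩ hz
      rw [← ge hz]
      congr 2 <;> ring
    have hc : Continuous fun w : ℝ × ℝ => g (w.1 - w.2, w.1 + w.2) := by fun_prop
    exact ⟨fun w => g (w.1 - w.2, w.1 + w.2), hc, h1, fun z hz =>
      hk.goursat hEc hEq hc h1 hz.1 hz.2.1 hz.2.2⟩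
  obtain ⟨u, hu, hup, hur⟩ := hrep hk
  obtain ⟨v, hv, hvp, hvr⟩ := hrep hk'
  have huv := goursat_solution_unique hHc hv hu hΩd hΩc hvr hur
  have hp : EqOn p' p triangle := by
    intro z hz
    rw [← hup z hz, ← hvp z hz]
    obtain ⟨h1, h2, h3⟩ := hz
    exact huv ⟨by simp only; linarith, by simp only; linarith, by simp only; linarith⟩
  have hopen : IsOpen {z : ℝ × ℝ | 0 < z.1 ∧ z.1 < z.2 ∧ z.2 < 1} :=
    (isOpen_lt continuous_const continuous_fst).inter
      ((isOpen_lt continuous_fst continuous_snd).inter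
        (isOpen_lt continuous_snd continuous_const))
  have hsub : {z : ℝ × ℝ | 0 < z.1 ∧ z.1 < z.2 ∧ z.2 < 1} ⊆ triangle := fun z hz =>
    ⟨hz.1.le, hz.2.1.le, hz.2.2.le⟩
  refine ⟨hp, ?_, ?_⟩
  · refine EqOn.of_subset_closure ?_ hk'.cont_x hk.cont_x hsub interior_triangle_dense
    rintro ⟨x, ξ⟩ hz
    have he : (fun r => p' (r, ξ)) =ᶠ[𝓝 x] fun r => p (r, ξ) := by
      have hc : Continuous fun r : ℝ => (r, ξ) := by fun_prop
      filter_upwards [hc.continuousAt.eventually_mem (hopen.mem_nhds hz)] with r hr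
      exact hp (hsub hr)
    exact (hk'.partial_x x ξ hz.1 hz.2.1 hz.2.2).unique
      ((hk.partial_x x ξ hz.1 hz.2.1 hz.2.2).congr_of_eventuallyEq he)
  · refine EqOn.of_subset_closure ?_ hk'.cont_ξ hk.cont_ξ hsub interior_triangle_dense
    rintro ⟨x, ξ⟩ hz
    have he : (fun r => p' (x, r)) =ᶠ[𝓝 ξ] fun r => p (x, r) := by
      have hc : Continuous fun r : ℝ => (x, r) := by fun_prop
      filter_upwards [hc.continuousAt.eventually_mem (hopen.mem_nhds hz)] with r hr
      exact hp (hsub hr)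
    exact (hk'.partial_ξ x ξ hz.1 hz.2.1 hz.2.2).unique
      ((hk.partial_ξ x ξ hz.1 hz.2.1 hz.2.2).congr_of_eventuallyEq he)

/-! ### The Volterra operator -/

/-- The Volterra integral `∫ₓ¹ k(x,ξ) f(ξ) dξ`. -/
def volt (k : ℝ × ℝ → ℂ) (f : ℝ → ℂ) (x : ℝ) : ℂ := ∫ ξ in x..(1 : ℝ), k (x, ξ) * f ξ

theorem backstep_eq (p : ℝ × ℝ → ℂ) (f : ℝ → ℂ) (x : ℝ) : backstep p f x = f x - volt p f x := rfl

theorem exists_bounded_extension_triangle {k : ℝ × ℝ → ℂ} (hk : ContinuousOn k triangle) :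
    ∃ (g : ℝ × ℝ → ℂ) (C : ℝ), Continuous g ∧ EqOn g k triangle ∧ 0 ≤ C ∧ ∀ z, ‖g z‖ ≤ C := by
  have hc : IsCompact triangle := by
    refine (isCompact_Icc (a := ((0 : ℝ), (0 : ℝ))) (b := (1, 1))).of_isClosed_subset ?_ ?_
    · exact (isClosed_le continuous_const continuous_fst).inter
        ((isClosed_le continuous_fst continuous_snd).inter
          (isClosed_le continuous_snd continuous_const))
    · intro z hz
      obtain ⟨h1, h2⟩ := mem_I_of_mem_triangle hz
      exact ⟨⟨h1.1, h2.1⟩, ⟨h1.2, h2.2⟩⟩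
  obtain ⟨C, hC⟩ := hc.exists_bound_of_continuousOn hk
  exact ⟨fun z => k (triRetract z), C, hk.comp_continuous continuous_triRetract triRetract_mem,
    fun z hz => by simp only [triRetract_eq hz], (norm_nonneg _).trans (hC _ (triRetract_mem 0)),
    fun z => hC _ (triRetract_mem z)⟩

theorem mem_triangle_of_uIcc {x ξ : ℝ} (hx : x ∈ Icc (0 : ℝ) 1) (hξ : ξ ∈ uIcc x 1) :
    (x, ξ) ∈ triangle := by
  rw [uIcc_of_le hx.2] at hξ
  exact ⟨hx.1, hξ.1, hξ.2⟩

theorem volt_congr {k k' : ℝ × ℝ → ℂ} (hk : EqOn k k' triangle) {f f' : ℝ → ℂ}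
    (hf : f =ᵐ[mu01] f') {x : ℝ} (hx : x ∈ Icc (0 : ℝ) 1) : volt k f x = volt k' f' x := by
  have h1 : volt k f x = volt k' f x :=
    intervalIntegral.integral_congr fun ξ hξ => by
      simp only [hk (mem_triangle_of_uIcc hx hξ)]
  rw [h1]
  refine intervalIntegral_congr_mu01 ?_ hx one_mem_I
  filter_upwards [hf] with ξ hξ
  rw [hξ]

theorem intervalIntegrable_volt {k : ℝ × ℝ → ℂ} (hk : ContinuousOn k triangle) {f : ℝ → ℂ}
    (hf : MemLp f 2 mu01) {x : ℝ} (hx : x ∈ Icc (0 : ℝ) 1) :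
    IntervalIntegrable (fun ξ => k (x, ξ) * f ξ) volume x 1 := by
  refine (intervalIntegrable_of_memLp hf hx one_mem_I).continuousOn_mul ?_
  exact hk.comp (by fun_prop) fun ξ hξ => mem_triangle_of_uIcc hx hξ

theorem volt_add {k : ℝ × ℝ → ℂ} (hk : ContinuousOn k triangle) {f g : ℝ → ℂ}
    (hf : MemLp f 2 mu01) (hg : MemLp g 2 mu01) {x : ℝ} (hx : x ∈ Icc (0 : ℝ) 1) :
    volt k (fun x => f x + g x) x = volt k f x + volt k g x := by
  unfold volt
  rw [← intervalIntegral.integral_add (intervalIntegrable_volt hk hf hx)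
    (intervalIntegrable_volt hk hg hx)]
  simp only [mul_add]

theorem volt_const_mul (k : ℝ × ℝ → ℂ) (c : ℂ) (f : ℝ → ℂ) (x : ℝ) :
    volt k (fun x => c * f x) x = c * volt k f x := by
  unfold volt
  rw [← intervalIntegral.integral_const_mul]
  congr 1
  funext ξ
  ring

instance isProbabilityMeasure_mu01 : IsProbabilityMeasure mu01 := ⟨by simp⟩

theorem norm_volt_le {k : ℝ × ℝ → ℂ} {C : ℝ} (hC : ∀ z ∈ triangle, ‖k z‖ ≤ C) (F : L2I) {x : ℝ}
    (hx : x ∈ Icc (0 : ℝ) 1) : ‖volt k F x‖ ≤ C * ‖F‖ := by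
  have hC0 : 0 ≤ C := (norm_nonneg _).trans (hC (0, 0) ⟨le_rfl, le_rfl, zero_le_one⟩)
  have hF1 : Integrable (F : ℝ → ℂ) mu01 := (Lp.memLp F).integrable (by norm_num)
  have h1 : ∫ ξ in (0 : ℝ)..1, ‖F ξ‖ ≤ ‖F‖ := by
    rw [← integral_mu01, integral_norm_eq_lintegral_enorm hF1.aestronglyMeasurable, Lp.norm_def]
    refine ENNReal.toReal_mono (Lp.eLpNorm_ne_top F) ?_
    rw [← eLpNorm_one_eq_lintegral_enorm]
    exact eLpNorm_le_eLpNorm_of_exponent_le (by norm_num) hF1.aestronglyMeasurable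
  have hi : IntervalIntegrable (fun ξ => ‖F ξ‖) volume 0 1 :=
    (intervalIntegrable_of_memLp (Lp.memLp F) zero_mem_I one_mem_I).norm
  have hi2 : IntervalIntegrable (fun ξ => ‖F ξ‖) volume x 1 :=
    (intervalIntegrable_of_memLp (Lp.memLp F) hx one_mem_I).norm
  calc ‖volt k F x‖ ≤ ∫ ξ in x..(1 : ℝ), C * ‖F ξ‖ := by
        refine intervalIntegral.norm_integral_le_of_norm_le hx.2 (ae_of_all _ fun ξ hξ => ?_)
          (hi2.const_mul C)
        rw [norm_mul]
        gcongr
        exact hC _ ⟨hx.1, hξ.1.le, hξ.2⟩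
    _ = C * ∫ ξ in x..(1 : ℝ), ‖F ξ‖ := intervalIntegral.integral_const_mul _ _
    _ ≤ C * ∫ ξ in (0 : ℝ)..1, ‖F ξ‖ := by
        gcongr
        exact intervalIntegral.integral_mono_interval hx.1 hx.2 le_rfl
          (ae_of_all _ fun _ => norm_nonneg _) hi
    _ ≤ C * ‖F‖ := by gcongr

/-- The variable limit is absorbed into an indicator that, for almost every `ξ`, is locally constant
near the given point; dominated convergence then suffices for `f` in L². -/
theorem continuousOn_volt {k : ℝ × ℝ → ℂ} (hk : ContinuousOn k triangle) {f : ℝ → ℂ}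
    (hf : MemLp f 2 mu01) : ContinuousOn (volt k f) (Icc 0 1) := by
  obtain ⟨g, C, hgc, hge, hC0, hgC⟩ := exists_bounded_extension_triangle hk
  have hf1 : Integrable f mu01 := hf.integrable (by norm_num)
  have hcont : Continuous fun x => ∫ ξ, (Ioi x).indicator (fun ξ => g (x, ξ) * f ξ) ξ ∂mu01 := by
    refine continuous_iff_continuousAt.2 fun x0 => ?_
    refine continuousAt_of_dominated (bound := fun ξ => C * ‖f ξ‖) ?_ ?_ (hf1.norm.const_mul C) ?_
    · refine Eventually.of_forall fun x => ?_
      refine AEStronglyMeasurable.indicator ?_ measurableSet_Ioi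
      exact (Continuous.aestronglyMeasurable (by fun_prop)).mul hf1.aestronglyMeasurable
    · refine Eventually.of_forall fun x => ae_of_all _ fun ξ => ?_
      refine (norm_indicator_le_norm_self _ _).trans ?_
      rw [norm_mul]
      gcongr
      exact hgC _
    · have hne : ∀ᵐ ξ ∂mu01, ξ ≠ x0 := by
        refine ae_restrict_of_ae ?_
        simp [ae_iff]
      filter_upwards [hne] with ξ hξ
      rcases lt_or_gt_of_ne hξ with h | h
      · have : (fun x => (Ioi x).indicator (fun ξ => g (x, ξ) * f ξ) ξ) =ᶠ[𝓝 x0] fun _ => 0 := by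
          filter_upwards [Ioi_mem_nhds h] with x hx
          exact indicator_of_notMem (fun h' => lt_asymm (mem_Ioi.1 hx) h') _
        exact continuousAt_const.congr this.symm
      · have : (fun x => (Ioi x).indicator (fun ξ => g (x, ξ) * f ξ) ξ) =ᶠ[𝓝 x0]
            fun x => g (x, ξ) * f ξ := by
          filter_upwards [Iio_mem_nhds h] with x hx
          exact indicator_of_mem (mem_Ioi.2 hx) _
        exact (Continuous.continuousAt (by fun_prop)).congr this.symm
  refine hcont.continuousOn.congr fun x hx => ?_
  change volt k f x = ∫ ξ, (Ioi x).indicator (fun ξ => g (x, ξ) * f ξ) ξ ∂mu01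
  rw [volt_congr hge.symm (ae_eq_refl f) hx, volt, intervalIntegral.integral_of_le hx.2,
    setIntegral_indicator measurableSet_Ioi]
  refine setIntegral_congr_set (ae_of_all _ fun ξ => ?_) |>.trans rfl
  refine propext ⟨fun h => ⟨⟨hx.1.trans h.1.le, h.2⟩, h.1⟩, fun h => ⟨h.2, h.1.2⟩⟩

theorem norm_contClass_le {f : ℝ → ℂ} (hf : ContinuousOn f (Icc 0 1)) {C : ℝ} (hC0 : 0 ≤ C)
    (hC : ∀ x ∈ Icc (0 : ℝ) 1, ‖f x‖ ≤ C) : ‖contClass f hf‖ ≤ C := by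
  have h : ∀ᵐ x ∂mu01, ‖contClass f hf x‖ ≤ C := by
    filter_upwards [contClass_ae f hf, ae_restrict_mem measurableSet_Icc] with x h1 h2
    rw [h1]
    exact hC x h2
  have := Lp.norm_le_of_ae_bound hC0 h
  have hm : measureUnivNNReal mu01 = 1 := by rw [measureUnivNNReal]; simp
  rw [hm] at this
  simpa using this

/-- The Volterra operator on `L²[0,1]`. -/
theorem exists_voltCLM {k : ℝ × ℝ → ℂ} (hk : ContinuousOn k triangle) :
    ∃ K : L2I →L[ℂ] L2I, ∀ F : L2I, (K F : ℝ → ℂ) =ᵐ[mu01] volt k F := by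
  obtain ⟨g, C, hgc, hge, hC0, hgC⟩ := exists_bounded_extension_triangle hk
  have hkC : ∀ z ∈ triangle, ‖k z‖ ≤ C := fun z hz => hge hz ▸ hgC z
  let K : L2I →L[ℂ] L2I := LinearMap.mkContinuous
    { toFun := fun F => contClass (volt k F) (continuousOn_volt hk (Lp.memLp F))
      map_add' := fun F G => by
        apply Lp.ext
        filter_upwards [contClass_ae _ (continuousOn_volt hk (Lp.memLp (F + G))),
          contClass_ae _ (continuousOn_volt hk (Lp.memLp F)),
          contClass_ae _ (continuousOn_volt hk (Lp.memLp G)),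
          Lp.coeFn_add (contClass _ (continuousOn_volt hk (Lp.memLp F)))
            (contClass _ (continuousOn_volt hk (Lp.memLp G))),
          ae_restrict_mem measurableSet_Icc] with x h1 h2 h3 h4 hx
        rw [h1, h4, Pi.add_apply, h2, h3, ← volt_add hk (Lp.memLp F) (Lp.memLp G) hx]
        exact volt_congr (fun _ _ => rfl) (Lp.coeFn_add F G) hx
      map_smul' := fun a F => by
        apply Lp.ext
        filter_upwards [contClass_ae _ (continuousOn_volt hk (Lp.memLp (a • F))),
          contClass_ae _ (continuousOn_volt hk (Lp.memLp F)),
          Lp.coeFn_smul a (contClass _ (continuousOn_volt hk (Lp.memLp F))),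
          ae_restrict_mem measurableSet_Icc] with x h1 h2 h3 hx
        rw [h1, RingHom.id_apply, h3, Pi.smul_apply, h2, smul_eq_mul, ← volt_const_mul]
        exact volt_congr (fun _ _ => rfl) (Lp.coeFn_smul a F) hx }
    C (fun F => norm_contClass_le (continuousOn_volt hk (Lp.memLp F)) (by positivity)
      fun x hx => norm_volt_le hkC F hx)
  exact ⟨K, fun F => contClass_ae _ (continuousOn_volt hk (Lp.memLp F))⟩

/-- The iterates of the Volterra operator. -/
theorem volt_iterate_bound {k : ℝ × ℝ → ℂ} (hk : ContinuousOn k triangle) {C : ℝ}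
    (hC : ∀ z ∈ triangle, ‖k z‖ ≤ C) {K : L2I →L[ℂ] L2I}
    (hK : ∀ F : L2I, (K F : ℝ → ℂ) =ᵐ[mu01] volt k F) (F : L2I) (n : ℕ) :
    ∃ f : ℝ → ℂ, ContinuousOn f (Icc 0 1) ∧ ((K ^ (n + 1)) F : ℝ → ℂ) =ᵐ[mu01] f ∧
      ∀ x ∈ Icc (0 : ℝ) 1, ‖f x‖ ≤ C ^ (n + 1) / (n.factorial : ℝ) * ‖F‖ * (1 - x) ^ n := by
  have hC0 : 0 ≤ C := (norm_nonneg _).trans (hC (0, 0) ⟨le_rfl, le_rfl, zero_le_one⟩)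
  induction n with
  | zero =>
    refine ⟨volt k F, continuousOn_volt hk (Lp.memLp F), by simpa using hK F, fun x hx => ?_⟩
    simpa using norm_volt_le hC F hx
  | succ n ih =>
    obtain ⟨f, hf, hfe, hfb⟩ := ih
    have hfm := memLp_mu01_of_continuousOn hf
    refine ⟨volt k f, continuousOn_volt hk hfm, ?_, fun x hx => ?_⟩
    · rw [pow_succ' K (n + 1)]
      change (K ((K ^ (n + 1)) F) : ℝ → ℂ) =ᵐ[mu01] _
      filter_upwards [hK ((K ^ (n + 1)) F), ae_restrict_mem measurableSet_Icc] with x h1 hx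
      rw [h1, volt_congr (fun _ _ => rfl) hfe hx]
    -- Each further iterate integrates a power of `1 - ξ` and gains the factor `1/(n+1)`, whence the
    -- factorial.
    · have hint : ∫ ξ in x..(1 : ℝ), (1 - ξ) ^ n = (1 - x) ^ (n + 1) / (n + 1) := by
        rw [intervalIntegral.integral_comp_sub_left (fun y => y ^ n)]
        simp [integral_pow]
      calc ‖volt k f x‖ ≤ ∫ ξ in x..(1 : ℝ),
            C * (C ^ (n + 1) / (n.factorial : ℝ) * ‖F‖) * (1 - ξ) ^ n := by
            refine intervalIntegral.norm_integral_le_of_norm_le hx.2 (ae_of_all _ fun ξ hξ => ?_)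
              (Continuous.intervalIntegrable (by fun_prop) _ _)
            rw [norm_mul, mul_assoc]
            exact mul_le_mul (hC _ ⟨hx.1, hξ.1.le, hξ.2⟩) (hfb ξ ⟨hx.1.trans hξ.1.le, hξ.2⟩)
              (norm_nonneg _) hC0
        _ = _ := by
            rw [intervalIntegral.integral_const_mul, hint, Nat.factorial_succ]
            push_cast
            field_simp
            ring

/-- Some power of the Volterra operator `K` has norm less than 1, so `1 - K ^ (n+1)` is invertible;
being the product of `1 - K` with a commuting geometric sum, it forces `1 - K` to be invertible. -/
theorem exists_volterra_equiv {p : ℝ × ℝ → ℂ} (hp : ContinuousOn p triangle) :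
    ∃ Φ : L2I ≃L[ℂ] L2I, ∀ (F : L2I) (f : ℝ → ℂ), (F : ℝ → ℂ) =ᵐ[mu01] f →
      (Φ F : ℝ → ℂ) =ᵐ[mu01] backstep p f := by
  obtain ⟨g, C, hgc, hge, hC0, hgC⟩ := exists_bounded_extension_triangle hp
  have hpC : ∀ z ∈ triangle, ‖p z‖ ≤ C := fun z hz => hge hz ▸ hgC z
  obtain ⟨K, hK⟩ := exists_voltCLM hp
  have hnorm : ∀ n : ℕ, ‖K ^ (n + 1)‖ ≤ C * (C ^ n / (n.factorial : ℝ)) := by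
    intro n
    refine ContinuousLinearMap.opNorm_le_bound _ (by positivity) fun F => ?_
    obtain ⟨f, hf, hfe, hfb⟩ := volt_iterate_bound hp hpC hK F n
    have : (K ^ (n + 1)) F = contClass f hf := Lp.ext (hfe.trans (contClass_ae f hf).symm)
    rw [this]
    refine norm_contClass_le hf (by positivity) fun x hx => (hfb x hx).trans ?_
    have h1 : (1 - x) ^ n ≤ 1 := pow_le_one₀ (by linarith [hx.2]) (by linarith [hx.1])
    calc _ ≤ C ^ (n + 1) / (n.factorial : ℝ) * ‖F‖ * 1 := by gcongr
      _ = _ := by ring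
  have hlim : Tendsto (fun n : ℕ => C * (C ^ n / (n.factorial : ℝ))) atTop (𝓝 0) := by
    simpa using (FloorSemiring.tendsto_pow_div_factorial_atTop C).const_mul C
  obtain ⟨n, hn⟩ := (hlim.eventually (gt_mem_nhds (zero_lt_one' ℝ))).exists
  have hunit : IsUnit (1 - K ^ (n + 1)) := (Units.oneSub _ ((hnorm n).trans_lt hn)).isUnit
  have hunit2 : IsUnit (1 - K) := by
    rw [← mul_neg_geom_sum] at hunit
    refine ((Commute.isUnit_mul_iff ?_).1 hunit).1
    exact (((Commute.one_left _).sub_left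
      (Commute.sum_right _ _ _ fun i _ => (Commute.refl K).pow_right i)))
  refine ⟨ContinuousLinearEquiv.unitsEquiv ℂ L2I hunit2.unit, fun F f hF => ?_⟩
  change ((F - K F : L2I) : ℝ → ℂ) =ᵐ[mu01] _
  filter_upwards [Lp.coeFn_sub F (K F), hF, hK F, ae_restrict_mem measurableSet_Icc]
    with x h1 h2 h3 hx
  rw [h1, Pi.sub_apply, h2, h3, backstep_eq, volt_congr (fun _ _ => rfl) hF hx]

theorem continuousOn_backstep {p : ℝ × ℝ → ℂ} (hp : ContinuousOn p triangle) {f : ℝ → ℂ}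
    (hf : ContinuousOn f (Icc 0 1)) : ContinuousOn (backstep p f) (Icc 0 1) :=
  hf.sub (continuousOn_volt hp (memLp_mu01_of_continuousOn hf))

/-- `F_o` is invertible on continuous functions. -/
theorem exists_continuous_backstep_eq {p : ℝ × ℝ → ℂ} (hp : ContinuousOn p triangle) {g : ℝ → ℂ}
    (hg : ContinuousOn g (Icc 0 1)) :
    ∃ γ : ℝ → ℂ, ContinuousOn γ (Icc 0 1) ∧ ∀ x ∈ Icc (0 : ℝ) 1, backstep p γ x = g x := by
  obtain ⟨Φ, hΦ⟩ := exists_volterra_equiv hp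
  set F := Φ.symm (contClass g hg) with hF
  have h1 := hΦ F F (ae_eq_refl _)
  rw [hF, Φ.apply_symm_apply, ← hF] at h1
  have hFm := Lp.memLp F
  -- The L² solution equals this function almost everywhere, and the right side is continuous
  -- because Volterra integrals are.
  set γ : ℝ → ℂ := fun x => g x + volt p F x with hγ
  have hγc : ContinuousOn γ (Icc 0 1) := hg.add (continuousOn_volt hp hFm)
  have hFγ : (F : ℝ → ℂ) =ᵐ[mu01] γ := by
    filter_upwards [h1, contClass_ae g hg] with x h2 h3
    rw [h3, backstep_eq] at h2
    simp only [hγ]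
    rw [h2]; ring
  refine ⟨γ, hγc, fun x hx => ?_⟩
  rw [backstep_eq, ← volt_congr (fun _ _ => rfl) hFγ hx]
  simp only [hγ]
  ring

theorem backstep_injOn {p : ℝ × ℝ → ℂ} (hp : ContinuousOn p triangle) {f g : ℝ → ℂ}
    (hf : ContinuousOn f (Icc 0 1)) (hg : ContinuousOn g (Icc 0 1))
    (h : EqOn (backstep p f) (backstep p g) (Icc 0 1)) : EqOn f g (Icc 0 1) := by
  obtain ⟨Φ, hΦ⟩ := exists_volterra_equiv hp
  have h1 : contClass f hf = contClass g hg := by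
    apply Φ.injective
    apply Lp.ext
    exact (hΦ _ _ (contClass_ae f hf)).trans ((ae_mu01_of_eqOn h).trans
      (hΦ _ _ (contClass_ae g hg)).symm)
  exact eqOn_of_ae_mu01 hf hg ((contClass_ae f hf).symm.trans (h1 ▸ contClass_ae g hg))

/-! ### Differentiation of integrals over the triangle -/

theorem integral_eq_sub_of_partial_fst {φ φ' : ℝ × ℝ → ℂ} (hφ : ContinuousOn φ triangle)
    (hφ' : Continuous φ')
    (hd : ∀ x ξ : ℝ, 0 < x → x < ξ → ξ < 1 → HasDerivAt (fun s => φ (s, ξ)) (φ' (x, ξ)) x)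
    {x y ξ : ℝ} (hx : 0 ≤ x) (hxy : x ≤ y) (hy : y ≤ ξ) (hξ : ξ < 1) :
    ∫ t in x..y, φ' (t, ξ) = φ (y, ξ) - φ (x, ξ) := by
  refine intervalIntegral.integral_eq_sub_of_hasDerivAt_of_le hxy
    (f := fun t => φ (t, ξ)) ?_ (fun t ht => hd t ξ (hx.trans_lt ht.1) (ht.2.trans_le hy) hξ)
    (Continuous.intervalIntegrable (by fun_prop) _ _)
  exact hφ.comp (f := fun t : ℝ => (t, ξ)) (by fun_prop)
    fun t ht => ⟨hx.trans ht.1, ht.2.trans hy, hξ.le⟩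

theorem hasDerivWithinAt_of_eq_integral {V ψ : ℝ → ℂ} (hψ : ContinuousOn ψ (Icc 0 1))
    (hV : ∀ x ∈ Icc (0 : ℝ) 1, V x = ∫ t in x..1, ψ t) {x : ℝ} (hx : x ∈ Icc (0 : ℝ) 1) :
    HasDerivWithinAt V (-ψ x) (Icc 0 1) x := by
  obtain ⟨g, hg, hge⟩ := exists_continuous_extension hψ
  have h1 : ∀ y ∈ Icc (0 : ℝ) 1, V y = ∫ t in y..1, g t := fun y hy => by
    rw [hV y hy]
    refine intervalIntegral.integral_congr fun t ht => ?_
    rw [uIcc_of_le hy.2] at ht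
    exact (hge ⟨hy.1.trans ht.1, ht.2⟩).symm
  rw [← hge hx]
  exact (intervalIntegral.integral_hasDerivAt_left (hg.intervalIntegrable _ _)
    hg.aestronglyMeasurable.stronglyMeasurableAtFilter hg.continuousAt).hasDerivWithinAt.congr_of_mem
    h1 hx

theorem primitive_of_hasDerivWithinAt {f f' : ℝ → ℂ} (hf' : ContinuousOn f' (Icc 0 1))
    (hf : ∀ x ∈ Icc (0 : ℝ) 1, HasDerivWithinAt f (f' x) (Icc 0 1) x) :
    ∀ x ∈ Icc (0 : ℝ) 1, f x = f 0 + ∫ t in (0 : ℝ)..x, f' t := fun x hx => by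
  have hsub : Icc 0 x ⊆ Icc (0 : ℝ) 1 := Icc_subset_Icc_right hx.2
  rw [intervalIntegral.integral_eq_sub_of_hasDerivAt_of_le hx.1
    (fun t ht => (hf t (hsub ht)).continuousWithinAt.mono hsub)
    (fun t ht => (hf t (hsub ⟨ht.1.le, ht.2.le⟩)).hasDerivAt
      (Icc_mem_nhds ht.1 (ht.2.trans_le hx.2)))
    (intervalIntegrable_of_continuousOn hf' zero_mem_I hx)]
  ring

/-- The derivative in `x` is known only inside the triangle. Integrating it and exchanging the order
of integration shows the function to be the integral of a continuous one, up to the endpoints. -/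
theorem hasDerivWithinAt_integral_triangle {φ φ' : ℝ × ℝ → ℂ} (hφ : ContinuousOn φ triangle)
    (hφ' : ContinuousOn φ' triangle)
    (hd : ∀ x ξ : ℝ, 0 < x → x < ξ → ξ < 1 → HasDerivAt (fun s => φ (s, ξ)) (φ' (x, ξ)) x)
    {x : ℝ} (hx : x ∈ Icc (0 : ℝ) 1) :
    HasDerivWithinAt (fun x => ∫ ξ in x..(1 : ℝ), φ (x, ξ))
      (-φ (x, x) + ∫ ξ in x..(1 : ℝ), φ' (x, ξ)) (Icc 0 1) x := by
  obtain ⟨g, hg, hge⟩ := exists_continuous_extension_triangle hφ'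
  have hdiag : ContinuousOn (fun t => φ (t, t)) (Icc (0 : ℝ) 1) :=
    hφ.comp (f := fun t : ℝ => (t, t)) (by fun_prop) fun t ht => ⟨ht.1, le_rfl, ht.2⟩
  have hvolt : ContinuousOn (fun t => ∫ ξ in t..(1 : ℝ), φ' (t, ξ)) (Icc (0 : ℝ) 1) := by
    have := continuousOn_volt hφ' (memLp_mu01_of_continuousOn
      (continuousOn_const (c := (1 : ℂ)) (s := Icc 0 1)))
    refine this.congr fun t _ => ?_
    simp [volt]
  have key := hasDerivWithinAt_of_eq_integral (V := fun x => ∫ ξ in x..(1 : ℝ), φ (x, ξ))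
    (hdiag.sub hvolt) (fun x hx => ?_) hx
  · convert key using 1
    simp only [Pi.sub_apply]
    ring
  have hd' : ∀ x ξ : ℝ, 0 < x → x < ξ → ξ < 1 → HasDerivAt (fun s => φ (s, ξ)) (g (x, ξ)) x :=
    fun x ξ h1 h2 h3 => by rw [hge ⟨h1.le, h2.le, h3.le⟩]; exact hd x ξ h1 h2 h3
  have hdi : IntervalIntegrable (fun t => φ (t, t)) volume x 1 :=
    intervalIntegrable_of_continuousOn hdiag hx one_mem_I
  have hswap := integral_triangle_swap (φ := fun t ξ => g (t, ξ)) hx.2 (by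
    refine IntegrableOn.mono_set (t := Icc x 1 ×ˢ Icc x 1) ?_
      (prod_mono Ioc_subset_Icc_self Ioc_subset_Icc_self)
    exact hg.continuousOn.integrableOn_compact (isCompact_Icc.prod isCompact_Icc))
  have e1 : ∫ t in x..(1 : ℝ), ∫ ξ in t..(1 : ℝ), g (t, ξ)
      = ∫ t in x..(1 : ℝ), ∫ ξ in t..(1 : ℝ), φ' (t, ξ) := by
    refine intervalIntegral.integral_congr fun t ht => ?_
    rw [uIcc_of_le hx.2] at ht
    refine intervalIntegral.integral_congr fun ξ hξ => ?_
    rw [uIcc_of_le ht.2] at hξ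
    exact hge ⟨hx.1.trans ht.1, hξ.1, hξ.2⟩
  have e2 : ∫ ξ in x..(1 : ℝ), φ (x, ξ)
      = ∫ ξ in x..(1 : ℝ), (φ (ξ, ξ) - ∫ t in x..ξ, g (t, ξ)) := by
    rw [intervalIntegral.integral_of_le hx.2, intervalIntegral.integral_of_le hx.2,
      integral_Ioc_eq_integral_Ioo, integral_Ioc_eq_integral_Ioo]
    refine setIntegral_congr_fun measurableSet_Ioo fun ξ hξ => ?_
    rw [integral_eq_sub_of_partial_fst hφ hg hd' hx.1 hξ.1.le le_rfl hξ.2]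
    ring
  have hprim : Continuous fun ξ => ∫ t in x..ξ, g (t, ξ) :=
    (intervalIntegral.continuous_parametric_primitive_of_continuous (a₀ := x)
      (f := fun ξ t => g (t, ξ)) (by fun_prop)).comp (continuous_id.prodMk continuous_id)
  rw [e2, intervalIntegral.integral_sub hdi (hprim.intervalIntegrable _ _), ← hswap, e1]
  simp only [Pi.sub_apply]
  rw [intervalIntegral.integral_sub hdi (intervalIntegrable_of_continuousOn hvolt hx one_mem_I)]

/-! ### Regularity of the backstepping transformation -/

theorem eqOn_triangle_of_interior {f g : ℝ × ℝ → ℂ} (hf : ContinuousOn f triangle)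
    (hg : ContinuousOn g triangle)
    (h : ∀ x ξ : ℝ, 0 < x → x < ξ → ξ < 1 → f (x, ξ) = g (x, ξ)) : EqOn f g triangle := by
  obtain ⟨f', hf', hfe⟩ := exists_continuous_extension_triangle hf
  obtain ⟨g', hg', hge⟩ := exists_continuous_extension_triangle hg
  have h1 : EqOn f' g' (closure {z : ℝ × ℝ | 0 < z.1 ∧ z.1 < z.2 ∧ z.2 < 1}) := by
    refine EqOn.closure (fun z hz => ?_) hf' hg'
    have hz' : z ∈ triangle := ⟨hz.1.le, hz.2.1.le, hz.2.2.le⟩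
    rw [hfe hz', hge hz']
    exact h z.1 z.2 hz.1 hz.2.1 hz.2.2
  intro z hz
  rw [← hfe hz, ← hge hz]
  exact h1 (interior_triangle_dense hz)

namespace IsKernel

variable {P : PlantData nr nd} {c : ℝ} {p px pξ : ℝ × ℝ → ℂ}

/-- The integrated form of `partial_ξ` makes sense on the edges as well and is carried there by
density of the interior. -/
theorem integral_partial_ξ (hk : IsKernel P c p px pξ) :
    ∀ z ∈ triangle, p z = p (z.1, z.1) + ∫ s in z.1..z.2, pξ (z.1, s) := by
  obtain ⟨g, hg, hge⟩ := exists_continuous_extension_triangle hk.cont_ξ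
  have hF : Continuous fun z : ℝ × ℝ => ∫ s in z.1..z.2, g (z.1, s) := by
    have h1 := intervalIntegral.continuous_parametric_primitive_of_continuous (a₀ := (0 : ℝ))
      (μ := volume) (f := fun x t => g (x, t)) (by fun_prop)
    have h2 : ∀ z : ℝ × ℝ, ∫ s in z.1..z.2, g (z.1, s)
        = (∫ s in (0 : ℝ)..z.2, g (z.1, s)) - ∫ s in (0 : ℝ)..z.1, g (z.1, s) := fun z => by
      rw [intervalIntegral.integral_interval_sub_left] <;>
        exact Continuous.intervalIntegrable (by fun_prop) _ _
    simp_rw [h2]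
    exact h1.sub (h1.comp (f := fun z : ℝ × ℝ => (z.1, z.1)) (by fun_prop))
  have hdiag : ContinuousOn (fun z : ℝ × ℝ => p (z.1, z.1)) triangle :=
    hk.cont.comp (f := fun z : ℝ × ℝ => (z.1, z.1)) (by fun_prop)
      fun z hz => ⟨hz.1, le_rfl, hz.2.1.trans hz.2.2⟩
  intro z hz
  have e : ∫ s in z.1..z.2, pξ (z.1, s) = ∫ s in z.1..z.2, g (z.1, s) := by
    refine intervalIntegral.integral_congr fun s hs => ?_
    rw [uIcc_of_le hz.2.1] at hs
    have hm : (z.1, s) ∈ triangle := ⟨hz.1, hs.1, hs.2.trans hz.2.2⟩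
    exact (hge hm).symm
  rw [e]
  refine eqOn_triangle_of_interior hk.cont (hdiag.add hF.continuousOn) (fun x ξ h1 h2 h3 => ?_) hz
  rw [Pi.add_apply]
  rw [intervalIntegral.integral_eq_sub_of_hasDerivAt_of_le h2.le (f := fun s => p (x, s)) ?_
    (fun s hs => ?_) (Continuous.intervalIntegrable (by fun_prop) _ _)]
  · ring
  · exact hk.cont.comp (f := fun s : ℝ => (x, s)) (by fun_prop)
      fun s hs => ⟨h1.le, hs.1, hs.2.trans h3.le⟩
  · rw [hge ⟨h1.le, hs.1.le, (hs.2.trans h3).le⟩]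
    exact hk.partial_ξ x s h1 hs.1 (hs.2.trans h3)

/-- The edge ξ = 1 lies outside the region where `partial_x` is required, but the integrated
identity in `x` extends to it by continuity. -/
theorem hasDerivWithinAt_right (hk : IsKernel P c p px pξ) {x : ℝ} (hx : x ∈ Icc (0 : ℝ) 1) :
    HasDerivWithinAt (fun x => p (x, 1)) (px (x, 1)) (Icc 0 1) x := by
  obtain ⟨g, hg, hge⟩ := exists_continuous_extension_triangle hk.cont_x
  have hF : Continuous fun z : ℝ × ℝ => ∫ s in (0 : ℝ)..z.1, g (s, z.2) :=
    (intervalIntegral.continuous_parametric_primitive_of_continuous (a₀ := (0 : ℝ))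
      (μ := volume) (f := fun x t => g (t, x)) (by fun_prop)).comp
      (f := fun z : ℝ × ℝ => (z.2, z.1)) (by fun_prop)
  have hleft : ContinuousOn (fun z : ℝ × ℝ => p (0, z.2)) triangle :=
    hk.cont.comp (f := fun z : ℝ × ℝ => ((0 : ℝ), z.2)) (by fun_prop)
      fun z hz => ⟨le_rfl, hz.1.trans hz.2.1, hz.2.2⟩
  have h1 := eqOn_triangle_of_interior hk.cont (hleft.add hF.continuousOn) fun x ξ h1 h2 h3 => by
    rw [Pi.add_apply]
    rw [integral_eq_sub_of_partial_fst hk.cont hg (fun x ξ k1 k2 k3 => ?_) le_rfl h1.le h2.le h3]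
    · ring
    · rw [hge ⟨k1.le, k2.le, k3.le⟩]
      exact hk.partial_x x ξ k1 k2 k3
  have h2 : HasDerivAt (fun x => p (0, 1) + ∫ s in (0 : ℝ)..x, g (s, 1)) (g (x, 1)) x := by
    have hgc : Continuous fun s : ℝ => g (s, 1) := by fun_prop
    exact (intervalIntegral.integral_hasDerivAt_right (hgc.intervalIntegrable _ _)
      hgc.aestronglyMeasurable.stronglyMeasurableAtFilter hgc.continuousAt).const_add _
  rw [← hge ⟨hx.1, hx.2, le_rfl⟩]
  exact h2.hasDerivWithinAt.congr_of_mem (fun y hy => h1 ⟨hy.1, hy.2, le_rfl⟩) hx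

theorem hasDerivWithinAt_diag (hk : IsKernel P c p px pξ) (hh : ContinuousOn P.h (Icc 0 1)) {x : ℝ}
    (hx : x ∈ Icc (0 : ℝ) 1) :
    HasDerivWithinAt (fun x => p (x, x)) (-(Complex.I / 2) * (P.h x + c)) (Icc 0 1) x := by
  obtain ⟨g, hg, hge⟩ := exists_continuous_extension hh
  have hgc : Continuous fun s => g s + (c : ℂ) := by fun_prop
  have h2 : HasDerivAt (fun x => -(Complex.I / 2) * (∫ s in (0 : ℝ)..x, (g s + (c : ℂ)))
      - Complex.I * P.q) (-(Complex.I / 2) * (g x + c)) x :=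
    ((intervalIntegral.integral_hasDerivAt_right (hgc.intervalIntegrable _ _)
      hgc.aestronglyMeasurable.stronglyMeasurableAtFilter hgc.continuousAt).const_mul _).sub_const _
  rw [← hge hx]
  refine h2.hasDerivWithinAt.congr_of_mem (fun y hy => ?_) hx
  rw [hk.diag y hy]
  congr 2
  refine intervalIntegral.integral_congr fun s hs => ?_
  rw [uIcc_of_le hy.1] at hs
  rw [hge ⟨hs.1, hs.2.trans hy.2⟩]

/-- Integration by parts in the second variable. -/
theorem volt_partial_ξ (hk : IsKernel P c p px pξ) {v v' : ℝ → ℂ} (hv' : MemLp v' 2 mu01)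
    (hv : ∀ x ∈ Icc (0 : ℝ) 1, v x = v 0 + ∫ t in (0 : ℝ)..x, v' t) {x : ℝ}
    (hx : x ∈ Icc (0 : ℝ) 1) :
    volt pξ v x = p (x, 1) * v 1 - p (x, x) * v x - volt p v' x := by
  refine integral_primitive_mul hx.2 (a := fun ξ => p (x, ξ)) ?_
    (intervalIntegrable_of_memLp hv' hx one_mem_I)
    (fun ξ hξ => hk.integral_partial_ξ (x, ξ) ⟨hx.1, hξ.1, hξ.2⟩) fun ξ hξ => ?_
  · refine ContinuousOn.intervalIntegrable ?_
    rw [uIcc_of_le hx.2]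
    exact hk.cont_ξ.comp (f := fun s : ℝ => (x, s)) (by fun_prop)
      fun s hs => ⟨hx.1, hs.1, hs.2⟩
  · have hξ' : ξ ∈ Icc (0 : ℝ) 1 := ⟨hx.1.trans hξ.1, hξ.2⟩
    rw [hv ξ hξ', hv x hx, ← intervalIntegral.integral_add_adjacent_intervals
      (intervalIntegrable_of_memLp hv' zero_mem_I hx) (intervalIntegrable_of_memLp hv' hx hξ')]
    ring

theorem hasDerivWithinAt_volt (hk : IsKernel P c p px pξ) {v : ℝ → ℂ}
    (hv : ContinuousOn v (Icc 0 1)) {x : ℝ} (hx : x ∈ Icc (0 : ℝ) 1) :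
    HasDerivWithinAt (volt p v) (-(p (x, x) * v x) + volt px v x) (Icc 0 1) x := by
  have hv2 : ContinuousOn (fun z : ℝ × ℝ => v z.2) triangle :=
    hv.comp continuousOn_snd fun z hz => (mem_I_of_mem_triangle hz).2
  exact hasDerivWithinAt_integral_triangle (φ := fun z => p z * v z.2)
    (φ' := fun z => px z * v z.2) (hk.cont.mul hv2) (hk.cont_x.mul hv2)
    (fun x ξ h1 h2 h3 => (hk.partial_x x ξ h1 h2 h3).mul_const (v ξ)) hx

/-- The substitution `ξ ↦ x + 1 - ξ` preserves `[x,1]`, and for fixed new `ξ` the point `(x, x + 1 -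
ξ)` moves in the direction (1,1). Thus the wave equation supplies the derivative of `p_ξ - p_x`, at
the price of differentiating `v`. -/
theorem hasDerivWithinAt_volt_sub (hk : IsKernel P c p px pξ) (hh : ContinuousOn P.h (Icc 0 1))
    {v v' : ℝ → ℂ} (hv' : ContinuousOn v' (Icc 0 1))
    (hv : ∀ x ∈ Icc (0 : ℝ) 1, HasDerivWithinAt v (v' x) (Icc 0 1) x)
    {x : ℝ} (hx : x ∈ Icc (0 : ℝ) 1) :
    HasDerivWithinAt (volt (fun z => pξ z - px z) v) (-((pξ (x, 1) - px (x, 1)) * v 1) +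
      (Complex.I * (P.h x + c) * volt p v x + volt (fun z => pξ z - px z) v' x)) (Icc 0 1) x := by
  set m : ℝ × ℝ → ℂ := fun z => pξ z - px z with hm
  have hmc : ContinuousOn m triangle := hk.cont_ξ.sub hk.cont_x
  have hvc : ContinuousOn v (Icc 0 1) := fun x hx => (hv x hx).continuousWithinAt
  have hshift : MapsTo (fun z : ℝ × ℝ => (z.1, z.1 + 1 - z.2)) triangle triangle := fun z hz =>
    ⟨hz.1, by linarith [hz.2.2], by linarith [hz.2.1]⟩
  have hsc : Continuous fun z : ℝ × ℝ => (z.1, z.1 + 1 - z.2) := by fun_prop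
  have hv2 : ∀ {w : ℝ → ℂ}, ContinuousOn w (Icc 0 1) →
      ContinuousOn (fun z : ℝ × ℝ => w z.2) triangle := fun hw =>
    hw.comp continuousOn_snd fun z hz => (mem_I_of_mem_triangle hz).2
  have hh1 : ContinuousOn (fun z : ℝ × ℝ => P.h z.1) triangle :=
    hh.comp continuousOn_fst fun z hz => (mem_I_of_mem_triangle hz).1
  have hrefl : ∀ (φ : ℝ → ℂ) (x : ℝ), ∫ ξ in x..(1 : ℝ), φ (x + 1 - ξ) = ∫ ξ in x..(1 : ℝ), φ ξ := by
    intro φ x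
    rw [intervalIntegral.integral_comp_sub_left]
    congr 1 <;> ring
  set A : ℝ × ℝ → ℂ := fun z => m z * v z.2 with hA
  set B : ℝ × ℝ → ℂ := fun z => Complex.I * (P.h z.1 + c) * p z * v z.2 + m z * v' z.2 with hB
  have hAc : ContinuousOn A triangle := hmc.mul (hv2 hvc)
  have hBc : ContinuousOn B triangle :=
    (((continuousOn_const.mul (hh1.add continuousOn_const)).mul hk.cont).mul (hv2 hvc)).add
      (hmc.mul (hv2 hv'))
  have key := hasDerivWithinAt_integral_triangle (φ := fun z => A (z.1, z.1 + 1 - z.2))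
    (φ' := fun z => B (z.1, z.1 + 1 - z.2))
    (hAc.comp hsc.continuousOn hshift) (hBc.comp hsc.continuousOn hshift)
    (fun x ξ h1 h2 h3 => ?_) hx
  · have e1 : (fun x => ∫ ξ in x..(1 : ℝ), A (x, x + 1 - ξ)) = volt m v := by
      funext x
      rw [hrefl (fun ξ => A (x, ξ))]
      rfl
    simp only at key
    rw [e1, hrefl (fun ξ => B (x, ξ))] at key
    convert key using 1
    simp only [hA, hB, add_sub_cancel_left]
    rw [intervalIntegral.integral_add (ContinuousOn.intervalIntegrable ?_)
      (intervalIntegrable_volt hmc (memLp_mu01_of_continuousOn hv') hx)]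
    · simp only [mul_assoc, intervalIntegral.integral_const_mul, volt, hm]
    · refine (continuousOn_const.mul (hk.cont.comp (by fun_prop)
        fun ξ hξ => mem_triangle_of_uIcc hx hξ)).mul (hvc.mono ?_)
      rw [uIcc_of_le hx.2]
      exact Icc_subset_Icc_left hx.1
  · have hw := hk.wave x (x + 1 - ξ) h1 (by linarith) (by linarith)
    have hw' : HasDerivAt (fun s => m (s, s + 1 - ξ))
        (Complex.I * (P.h x + c) * p (x, x + 1 - ξ)) x := by
      have h0 : HasDerivAt (fun s : ℝ => s - x) 1 x := (hasDerivAt_id x).sub_const x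
      have := HasDerivAt.scomp (h := fun s : ℝ => s - x) x (by rw [sub_self]; exact hw) h0
      rw [one_smul] at this
      refine this.congr_of_eventuallyEq (Eventually.of_forall fun s => ?_)
      simp only [Function.comp, hm]
      ring_nf
    have hmem : Icc (0 : ℝ) 1 ∈ 𝓝 (x + 1 - ξ) := Icc_mem_nhds (by linarith) (by linarith)
    have hv1 := (hv (x + 1 - ξ) (mem_of_mem_nhds hmem)).hasDerivAt hmem
    have h0 : HasDerivAt (fun s : ℝ => s + 1 - ξ) 1 x := ((hasDerivAt_id x).add_const 1).sub_const ξ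
    have hv3 := HasDerivAt.scomp (h := fun s : ℝ => s + 1 - ξ) x hv1 h0
    rw [one_smul] at hv3
    exact hw'.mul hv3

/-- The derivative of `∫ₓ¹ p_x(x,ξ) v(ξ) dξ`. -/
theorem hasDerivWithinAt_volt_px (hk : IsKernel P c p px pξ) (hh : ContinuousOn P.h (Icc 0 1))
    {v v' : ℝ → ℂ} (hv' : ContinuousOn v' (Icc 0 1))
    (hv : ∀ x ∈ Icc (0 : ℝ) 1, HasDerivWithinAt v (v' x) (Icc 0 1) x)
    (hvi : ∀ x ∈ Icc (0 : ℝ) 1, v x = v 0 + ∫ t in (0 : ℝ)..x, v' t)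
    {x : ℝ} (hx : x ∈ Icc (0 : ℝ) 1) :
    HasDerivWithinAt (volt px v) (pξ (x, 1) * v 1 + Complex.I / 2 * (P.h x + c) * v x
      - volt pξ v' x - Complex.I * (P.h x + c) * volt p v x) (Icc 0 1) x := by
  have hvc : ContinuousOn v (Icc 0 1) := fun x hx => (hv x hx).continuousWithinAt
  have hvm := memLp_mu01_of_continuousOn hvc
  have hvm' := memLp_mu01_of_continuousOn hv'
  have hsub : ∀ {w : ℝ → ℂ}, MemLp w 2 mu01 → ∀ y ∈ Icc (0 : ℝ) 1,
      volt (fun z => pξ z - px z) w y = volt pξ w y - volt px w y := fun hw y hy => by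
    simp only [volt, sub_mul]
    exact intervalIntegral.integral_sub (intervalIntegrable_volt hk.cont_ξ hw hy)
      (intervalIntegrable_volt hk.cont_x hw hy)
  -- Write `p_x = p_ξ - (p_ξ - p_x)`, integrate the first part by parts in `ξ` and differentiate;
  -- the terms with `p_x` then cancel.
  have h1 := ((((hk.hasDerivWithinAt_right hx).mul_const (v 1)).sub
    ((hk.hasDerivWithinAt_diag hh hx).mul (hv x hx))).sub (hk.hasDerivWithinAt_volt hv' hx)).sub
    (hk.hasDerivWithinAt_volt_sub hh hv' hv hx)
  rw [hsub hvm' x hx] at h1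
  refine (h1.congr_of_mem (fun y hy => ?_) hx).congr_deriv (by ring)
  simp only [Pi.sub_apply, Pi.mul_apply]
  rw [hsub hvm y hy, hk.volt_partial_ξ hvm' hvi hy]
  ring

theorem continuousOn_diag (hk : IsKernel P c p px pξ) :
    ContinuousOn (fun x => p (x, x)) (Icc 0 1) :=
  hk.cont.comp (f := fun t : ℝ => (t, t)) (by fun_prop) fun _ ht => ⟨ht.1, le_rfl, ht.2⟩

/-- The `C¹` part `p(x,x) v(x) - ∫ₓ¹ p_x(x,ξ) v(ξ) dξ` of the derivative of `F_o[v]`. -/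
theorem exists_hasDerivWithinAt_remainder (hk : IsKernel P c p px pξ)
    (hh : ContinuousOn P.h (Icc 0 1)) {v v' : ℝ → ℂ} (hv' : ContinuousOn v' (Icc 0 1))
    (hv : ∀ x ∈ Icc (0 : ℝ) 1, HasDerivWithinAt v (v' x) (Icc 0 1) x) :
    ∃ w' : ℝ → ℂ, ContinuousOn w' (Icc 0 1) ∧
      (∀ x ∈ Icc (0 : ℝ) 1, w' x = p (x, x) * v' x - Complex.I * (P.h x + c) * backstep p v x
        - pξ (x, 1) * v 1 + volt pξ v' x) ∧
      ∀ x ∈ Icc (0 : ℝ) 1, p (x, x) * v x - volt px v x =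
        (p (0, 0) * v 0 - volt px v 0) + ∫ t in (0 : ℝ)..x, w' t := by
  have hvc : ContinuousOn v (Icc 0 1) := fun x hx => (hv x hx).continuousWithinAt
  have hpr : ContinuousOn (fun x => pξ (x, 1)) (Icc 0 1) :=
    hk.cont_ξ.comp (f := fun t : ℝ => (t, (1 : ℝ))) (by fun_prop) fun _ ht => ⟨ht.1, ht.2, le_rfl⟩
  have hvm' := memLp_mu01_of_continuousOn hv'
  have hc : ContinuousOn (fun x => p (x, x) * v' x - Complex.I * (P.h x + c) * backstep p v x
        - pξ (x, 1) * v 1 + volt pξ v' x) (Icc 0 1) :=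
    (((hk.continuousOn_diag.mul hv').sub ((continuousOn_const.mul (hh.add continuousOn_const)).mul
      (continuousOn_backstep hk.cont hvc))).sub (hpr.mul continuousOn_const)).add
      (continuousOn_volt hk.cont_ξ hvm')
  refine ⟨_, hc, fun x _ => rfl, primitive_of_hasDerivWithinAt hc fun x hx => ?_⟩
  refine (((hk.hasDerivWithinAt_diag hh hx).mul (hv x hx)).sub (hk.hasDerivWithinAt_volt_px hh hv' hv
    (primitive_of_hasDerivWithinAt hv' hv) hx)).congr_deriv ?_
  rw [backstep_eq]
  ring

/-- `F_o` maps `H²(0,1)` to itself. -/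
theorem isH2Jet_backstep (hk : IsKernel P c p px pξ) (hh : ContinuousOn P.h (Icc 0 1)) {F Z : L2I}
    {v v1 v2 : ℝ → ℂ} (hF : IsH2Jet F v v1 v2) (hZ : (Z : ℝ → ℂ) =ᵐ[mu01] backstep p v) :
    IsH2Jet Z (backstep p v) (fun x => v1 x + (p (x, x) * v x - volt px v x))
      (fun x => backstep p v2 x - Complex.I * (P.h x + c) * backstep p v x - pξ (x, 1) * v 1
        + p (x, 1) * v1 1) := by
  obtain ⟨w', hw', hwe, hwi⟩ := hk.exists_hasDerivWithinAt_remainder hh hF.cont_one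
    fun x hx => hF.hasDerivWithinAt hx
  have hvm := memLp_mu01_of_continuousOn hF.cont
  -- Integration by parts trades `p_ξ v'` for `p v''`. In sum, `-i F_o[v]'' + h F_o[v] = F_o[-i v''
  -- - c v] + i p_ξ(x,1) v(1) - i p(x,1) v'(1)`, the intertwining relation behind the design.
  have e : EqOn (fun x => v2 x + w' x) (fun x => backstep p v2 x
      - Complex.I * (P.h x + c) * backstep p v x - pξ (x, 1) * v 1 + p (x, 1) * v1 1)
      (Icc 0 1) := fun x hx => by
    simp only
    rw [hwe x hx, hk.volt_partial_ξ hF.memLp hF.deriv_two hx, backstep_eq p v2]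
    ring
  refine ⟨hZ, ?_, primitive_of_hasDerivWithinAt ?_ fun x hx => ?_, fun x hx => ?_⟩
  · exact (hF.memLp.add (memLp_mu01_of_continuousOn hw')).ae_eq (ae_mu01_of_eqOn e)
  · exact hF.cont_one.add ((hk.continuousOn_diag.mul hF.cont).sub (continuousOn_volt hk.cont_x hvm))
  · exact ((hF.hasDerivWithinAt hx).sub (hk.hasDerivWithinAt_volt hF.cont hx)).congr_deriv (by ring)
  · rw [hF.deriv_two x hx, hwi x hx, ← intervalIntegral_congr_mu01 (ae_mu01_of_eqOn e) zero_mem_I hx,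
      intervalIntegral.integral_add (intervalIntegrable_of_memLp hF.memLp zero_mem_I hx)
      (intervalIntegrable_of_continuousOn hw' zero_mem_I hx)]
    ring

/-- `F_o⁻¹` maps `H²(0,1)` to itself. -/
theorem exists_isH2Jet_of_backstep (hk : IsKernel P c p px pξ) (hh : ContinuousOn P.h (Icc 0 1))
    {F Z : L2I} {z z1 z2 : ℝ → ℂ} (hz : IsH2Jet Z z z1 z2)
    (hZ : (Z : ℝ → ℂ) =ᵐ[mu01] backstep p F) : ∃ v v1 v2, IsH2Jet F v v1 v2 := by
  -- Bootstrap in `v = z + ∫ p v`: an L² solution is continuous, then C¹, and then has its second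
  -- derivative in L².
  set v : ℝ → ℂ := fun x => z x + volt p F x with hv
  have hvc : ContinuousOn v (Icc 0 1) := hz.cont.add (continuousOn_volt hk.cont (Lp.memLp F))
  have hFv : (F : ℝ → ℂ) =ᵐ[mu01] v := by
    filter_upwards [hZ, hz.rep] with x h2 h3
    rw [h3, backstep_eq] at h2
    simp only [hv]
    rw [h2]; ring
  have hve : ∀ x ∈ Icc (0 : ℝ) 1, v x = z x + volt p v x := fun x hx => by
    rw [← volt_congr (fun _ _ => rfl) hFv hx]
  have hvm := memLp_mu01_of_continuousOn hvc
  set v1 : ℝ → ℂ := fun x => z1 x - (p (x, x) * v x - volt px v x) with hv1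
  have hv1c : ContinuousOn v1 (Icc 0 1) :=
    hz.cont_one.sub ((hk.continuousOn_diag.mul hvc).sub (continuousOn_volt hk.cont_x hvm))
  have hvd : ∀ x ∈ Icc (0 : ℝ) 1, HasDerivWithinAt v (v1 x) (Icc 0 1) x := fun x hx =>
    (((hz.hasDerivWithinAt hx).add (hk.hasDerivWithinAt_volt hvc hx)).congr_of_mem hve
      hx).congr_deriv (by simp only [hv1]; ring)
  obtain ⟨w', hw', -, hwi⟩ := hk.exists_hasDerivWithinAt_remainder hh hv1c hvd
  refine ⟨v, v1, fun x => z2 x - w' x, hFv, hz.memLp.sub (memLp_mu01_of_continuousOn hw'),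
    primitive_of_hasDerivWithinAt hv1c hvd, fun x hx => ?_⟩
  rw [intervalIntegral.integral_sub (intervalIntegrable_of_memLp hz.memLp zero_mem_I hx)
      (intervalIntegrable_of_continuousOn hw' zero_mem_I hx)]
  simp only [hv1]
  rw [hwi x hx, hz.deriv_two x hx]
  ring

end IsKernel

/-! ### The profile -/

/-- A homogeneous Neumann problem without resonance has only the zero solution. -/
theorem eq_zero_of_neumann {nd : ℕ} {S : Matrix (Fin nd) (Fin nd) ℂ} {c : ℝ}
    (hspec : ∀ j : ℕ, (Complex.I * ((j : ℂ) * (Real.pi : ℂ)) ^ 2 - (c : ℂ)) ∉ spectrum ℂ S)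
    {n n1 n2 : ℝ → Fin nd → ℂ} (hn2 : ContinuousOn n2 (Icc 0 1))
    (hn : ∀ x ∈ Icc (0 : ℝ) 1, HasDerivWithinAt n (n1 x) (Icc 0 1) x)
    (hn1 : ∀ x ∈ Icc (0 : ℝ) 1, HasDerivWithinAt n1 (n2 x) (Icc 0 1) x)
    (heq : ∀ x ∈ Icc (0 : ℝ) 1, Complex.I • n2 x + n x ᵥ* S + (c : ℂ) • n x = 0)
    (h0 : n1 0 = 0) (h1 : n1 1 = 0) : ∀ x ∈ Icc (0 : ℝ) 1, n x = 0 := by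
  have hnc : ∀ i, ContinuousOn (fun x => n x i) (Icc 0 1) := fun i x hx =>
    (hasDerivWithinAt_pi.1 (hn x hx) i).continuousWithinAt
  have hn1c : ∀ i, ContinuousOn (fun x => n1 x i) (Icc 0 1) := fun i x hx =>
    (hasDerivWithinAt_pi.1 (hn1 x hx) i).continuousWithinAt
  have hn2c : ∀ i, ContinuousOn (fun x => n2 x i) (Icc 0 1) := fun i =>
    (continuous_apply i).comp_continuousOn hn2
  have hjet : ∀ i, IsH2Jet (contClass _ (hnc i)) (fun x => n x i) (fun x => n1 x i)
      (fun x => n2 x i) := fun i =>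
    ⟨contClass_ae _ _, memLp_mu01_of_continuousOn (hn2c i),
      primitive_of_hasDerivWithinAt (hn1c i) fun x hx => hasDerivWithinAt_pi.1 (hn x hx) i,
      primitive_of_hasDerivWithinAt (hn2c i) fun x hx => hasDerivWithinAt_pi.1 (hn1 x hx) i⟩
  have hcoeff : ∀ i j, cosCoeff (contClass _ (hnc i)) j = 0 := by
    intro i j
    set a : Fin nd → ℂ := fun i => cosCoeff (contClass _ (hnc i)) j with ha
    have hint : ∀ i, IntervalIntegrable (fun x => cosf j x * n x i) volume 0 1 := fun i =>
      intervalIntegrable_of_continuousOn ((continuous_cosf j).continuousOn.mul (hnc i))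
        zero_mem_I one_mem_I
    have hint2 : ∀ i, IntervalIntegrable (fun x => cosf j x * n2 x i) volume 0 1 := fun i =>
      intervalIntegrable_of_continuousOn ((continuous_cosf j).continuousOn.mul (hn2c i))
        zero_mem_I one_mem_I
    have hav : ∀ i, a i = ∫ x in (0 : ℝ)..1, cosf j x * n x i := fun i =>
      cosCoeff_eq (contClass_ae _ _) j
    have hgreen := fun i => (hjet i).integral_cosf_mul_two j
    simp only [h0, h1, Pi.zero_apply, mul_zero, sub_zero, zero_sub] at hgreen
    -- Testing the equation against cos(jπx) gives a left eigenvector relation for the `j`-th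
    -- coefficients; the number in question is not in the spectrum, so they vanish.
    have key : a ᵥ* (algebraMap ℂ _ (Complex.I * ((j : ℂ) * (Real.pi : ℂ)) ^ 2 - (c : ℂ)) - S) = 0 := by
      rw [Matrix.vecMul_sub, sub_eq_zero]
      funext i
      have e1 : ∫ x in (0 : ℝ)..1, cosf j x * (∑ k, n x k * S k i) = ∑ k, a k * S k i := by
        simp_rw [hav, ← intervalIntegral.integral_mul_const, Finset.mul_sum]
        rw [intervalIntegral.integral_finsetSum fun k _ => by
          simpa only [mul_assoc] using (hint k).mul_const (S k i)]
        simp only [mul_assoc]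
      have e2 : ∫ x in (0 : ℝ)..1, (Complex.I * (cosf j x * n2 x i) + (c : ℂ) * (cosf j x * n x i))
          = ∫ x in (0 : ℝ)..1, - (cosf j x * (∑ k, n x k * S k i)) := by
        refine intervalIntegral.integral_congr fun x hx => ?_
        rw [uIcc_of_le (zero_le_one' ℝ)] at hx
        have := congrFun (heq x hx) i
        simp only [Pi.add_apply, Pi.smul_apply, smul_eq_mul, Matrix.vecMul, dotProduct,
          Pi.zero_apply] at this
        linear_combination cosf j x * this
      rw [intervalIntegral.integral_add ((hint2 i).const_mul _) ((hint i).const_mul _),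
        intervalIntegral.integral_neg, e1, intervalIntegral.integral_const_mul,
        intervalIntegral.integral_const_mul, hgreen i, ← hav i] at e2
      have e3 : cosCoeff (contClass _ (hnc i)) j = a i := rfl
      rw [e3] at e2
      rw [Matrix.algebraMap_eq_diagonal, Matrix.vecMul_diagonal]
      simp only [Matrix.vecMul, dotProduct, Pi.algebraMap_apply, Algebra.algebraMap_self,
        RingHom.id_apply]
      linear_combination -e2
    have hu := spectrum.notMem_iff.1 (hspec j)
    have ha0 : a = 0 := Matrix.vecMul_injective_of_isUnit hu (key.trans (Matrix.zero_vecMul _).symm)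
    exact congrFun ha0 i
  intro x hx
  funext i
  have hz : contClass _ (hnc i) = 0 := ext_cosCoeff fun j => by
    rw [hcoeff i j, cosCoeff_eq (Lp.coeFn_zero ℂ 2 mu01)]
    simp
  exact eqOn_of_ae_mu01 (hnc i) continuousOn_const ((contClass_ae _ (hnc i)).symm.trans
    (hz ▸ Lp.coeFn_zero ℂ 2 mu01)) hx

/-! ### Construction of the profile by shooting -/

theorem exp_zero_smul_apply {W : Type*} [NormedAddCommGroup W] [NormedSpace ℂ W] (A : W →L[ℂ] W)
    (w : W) : NormedSpace.exp ((0 : ℝ) • A) w = w := by simp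

/-- Variation of constants. -/
theorem hasDerivAt_variation_of_constants {W : Type*} [NormedAddCommGroup W] [NormedSpace ℂ W]
    [CompleteSpace W] (A : W →L[ℂ] W) {b : ℝ → W} (hb : Continuous b) (y : W) (t : ℝ) :
    HasDerivAt (fun t : ℝ => NormedSpace.exp (t • A)
        (y + ∫ s in (0 : ℝ)..t, NormedSpace.exp ((-s) • A) (b s)))
      (A (NormedSpace.exp (t • A) (y + ∫ s in (0 : ℝ)..t, NormedSpace.exp ((-s) • A) (b s))) + b t)
      t := by
  have hc : Continuous fun s : ℝ => NormedSpace.exp ((-s) • A) (b s) :=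
    ((continuous_exp_smul A).comp continuous_neg).clm_apply hb
  have h1 : HasDerivAt (fun t => y + ∫ s in (0 : ℝ)..t, NormedSpace.exp ((-s) • A) (b s))
      (NormedSpace.exp ((-t) • A) (b t)) t :=
    (intervalIntegral.integral_hasDerivAt_right (hc.intervalIntegrable _ _)
      hc.aestronglyMeasurable.stronglyMeasurableAtFilter hc.continuousAt).const_add _
  have h2 := ((hasDerivAt_exp_smul A t).hasDerivWithinAt (s := univ)).complex_clm_apply
    (h1.hasDerivWithinAt (s := univ))
  refine (hasDerivWithinAt_univ.1 h2).congr_deriv ?_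
  have : NormedSpace.exp (t • A) (NormedSpace.exp ((-t) • A) (b t)) = b t := by
    rw [exp_add_smul_apply]; simp
  rw [this]
  rfl

theorem exists_isProfile (P : PlantData nr nd) {c : ℝ} {p : ℝ × ℝ → ℂ} (hp : ContinuousOn p triangle)
    (hg : ContinuousOn P.g (Icc 0 1))
    (hspec : ∀ j : ℕ, (Complex.I * ((j : ℂ) * (Real.pi : ℂ)) ^ 2 - (c : ℂ)) ∉ spectrum ℂ P.Sd) :
    ∃ n, IsProfile P c p n := by
  obtain ⟨γ, hγ, hγe⟩ := exists_continuous_backstep_eq hp hg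
  obtain ⟨γ', hγ', hγγ⟩ := exists_continuous_extension hγ
  let V := Fin nd → ℂ
  let L : V →L[ℂ] V := LinearMap.toContinuousLinearMap
    (Complex.I • (P.Sd.vecMulLinear + (c : ℂ) • LinearMap.id))
  have hL : ∀ v : V, L v = Complex.I • (v ᵥ* P.Sd + (c : ℂ) • v) := fun v => rfl
  let A : V × V →L[ℂ] V × V :=
    (ContinuousLinearMap.snd ℂ V V).prod (L.comp (ContinuousLinearMap.fst ℂ V V))
  have hA : ∀ v : V × V, A v = (v.2, L v.1) := fun v => rfl
  let b : ℝ → V × V := fun t => (0, (-Complex.I * γ' t) • P.qd1)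
  have hb : Continuous b := by fun_prop
  have hfst : ∀ {Y : ℝ → V × V} {Y' : V × V} {x : ℝ}, HasDerivAt Y Y' x →
      HasDerivWithinAt (fun x => (Y x).1) Y'.1 (Icc 0 1) x := fun h =>
    ((ContinuousLinearMap.fst ℝ V V).hasFDerivAt.comp_hasDerivAt _ h).hasDerivWithinAt
  have hsnd : ∀ {Y : ℝ → V × V} {Y' : V × V} {x : ℝ}, HasDerivAt Y Y' x →
      HasDerivWithinAt (fun x => (Y x).2) Y'.2 (Icc 0 1) x := fun h =>
    ((ContinuousLinearMap.snd ℝ V V).hasFDerivAt.comp_hasDerivAt _ h).hasDerivWithinAt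
  -- The map n(0) ↦ n'(1) for the homogeneous equation with n'(0) = 0. Nonresonance makes it
  -- injective, hence bijective in finite dimension.
  let shoot : V →ₗ[ℂ] V := LinearMap.comp (LinearMap.snd ℂ V V)
    ((NormedSpace.exp ((1 : ℝ) • A) : V × V →L[ℂ] V × V).toLinearMap.comp (LinearMap.inl ℂ V V))
  have hshoot : ∀ a, shoot a = (NormedSpace.exp ((1 : ℝ) • A) (a, 0)).2 := fun a => rfl
  have hinj : Function.Injective shoot := by
    refine (injective_iff_map_eq_zero _).2 fun a ha => ?_
    have hd : ∀ x, HasDerivAt (fun x : ℝ => NormedSpace.exp (x • A) (a, (0 : V)))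
        (A (NormedSpace.exp (x • A) (a, (0 : V)))) x := fun x => by
      simpa using hasDerivAt_variation_of_constants A (b := fun _ => 0) continuous_const (a, 0) x
    have h0 : NormedSpace.exp ((0 : ℝ) • A) (a, (0 : V)) = (a, 0) := exp_zero_smul_apply _ _
    have := eq_zero_of_neumann hspec (n := fun x => (NormedSpace.exp (x • A) (a, (0 : V))).1)
      (n1 := fun x => (NormedSpace.exp (x • A) (a, (0 : V))).2)
      (n2 := fun x => L (NormedSpace.exp (x • A) (a, (0 : V))).1)
      (L.continuous.comp (continuous_fst.comp ((continuous_exp_smul A).clm_apply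
        continuous_const))).continuousOn
      (fun x _ => hfst (hd x)) (fun x _ => hsnd (hd x)) (fun x _ => ?_) (by rw [h0]) ha 0 zero_mem_I
    · rwa [h0] at this
    · rw [hL, smul_smul, Complex.I_mul_I, add_assoc, neg_one_smul, neg_add_cancel]
  have hsurj := LinearMap.injective_iff_surjective.1 hinj
  let w : V × V := ∫ s in (0 : ℝ)..1, NormedSpace.exp ((-s) • A) (b s)
  -- The value n(0) is chosen so that its contribution to n'(1) cancels that of the forcing and of
  -- n'(0) = q_{d2}.
  obtain ⟨a, ha⟩ := hsurj (-(NormedSpace.exp ((1 : ℝ) • A) ((0, P.qd2) + w)).2)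
  let Y : ℝ → V × V := fun t => NormedSpace.exp (t • A)
    ((a, P.qd2) + ∫ s in (0 : ℝ)..t, NormedSpace.exp ((-s) • A) (b s))
  have hY : ∀ x, HasDerivAt Y (A (Y x) + b x) x :=
    hasDerivAt_variation_of_constants A hb (a, P.qd2)
  have hYc : Continuous Y := continuous_iff_continuousAt.2 fun x => (hY x).continuousAt
  refine ⟨fun x => (Y x).1, γ, fun x => (Y x).2, fun x => (A (Y x) + b x).2, hγ, hγe, ?_, ?_, ?_, ?_,
    ?_, ?_⟩
  · exact (continuous_snd.comp ((A.continuous.comp hYc).add hb)).continuousOn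
  · intro x _
    have := hfst (hY x)
    rwa [Prod.fst_add, hA, add_zero] at this
  · exact fun x _ => hsnd (hY x)
  · intro x hx
    simp only [Prod.snd_add, hA, b, hL, hγγ hx]
    match_scalars <;> simp [← mul_assoc]
  · change (NormedSpace.exp ((0 : ℝ) • A) _).2 = _
    rw [exp_zero_smul_apply, intervalIntegral.integral_same, add_zero]
  · have e : (a, P.qd2) + w = (a, 0) + ((0, P.qd2) + w) := by
      rw [← add_assoc]
      simp
    change (NormedSpace.exp ((1 : ℝ) • A) ((a, P.qd2) + w)).2 = 0
    rw [e, map_add, Prod.snd_add, ← hshoot, ha, neg_add_cancel]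

theorem IsProfile.unique {P : PlantData nr nd} {c : ℝ} {p : ℝ × ℝ → ℂ}
    (hp : ContinuousOn p triangle)
    (hspec : ∀ j : ℕ, (Complex.I * ((j : ℂ) * (Real.pi : ℂ)) ^ 2 - (c : ℂ)) ∉ spectrum ℂ P.Sd)
    {n n' : ℝ → Fin nd → ℂ} (hn : IsProfile P c p n) (hn' : IsProfile P c p n') :
    EqOn n' n (Icc 0 1) := by
  obtain ⟨γ, n1, n2, hγ, hγe, h2, hd, hd1, he, h0, h1⟩ := hn
  obtain ⟨γ', n1', n2', hγ', hγe', h2', hd', hd1', he', h0', h1'⟩ := hn'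
  have hγγ := backstep_injOn hp hγ' hγ fun x hx => (hγe' x hx).trans (hγe x hx).symm
  intro x hx
  refine sub_eq_zero.1 (eq_zero_of_neumann hspec (n := fun x => n' x - n x)
    (n1 := fun x => n1' x - n1 x) (n2 := fun x => n2' x - n2 x) (h2'.sub h2)
    (fun x hx => (hd' x hx).sub (hd x hx)) (fun x hx => (hd1' x hx).sub (hd1 x hx))
    (fun x hx => ?_) (by rw [h0, h0', sub_self]) (by rw [h1, h1', sub_self]) x hx)
  have e1 := he x hx
  have e2 := he' x hx
  rw [hγγ hx, ← e1] at e2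
  rw [Matrix.sub_vecMul, smul_sub, smul_sub, ← sub_eq_zero.2 e2]
  abel

/-! ### The transformation to the target system -/

theorem dotProduct_act {n : ℕ} (A : Matrix (Fin n) (Fin n) ℂ) (a : Fin n → ℂ)
    (w : EuclideanSpace ℂ (Fin n)) : a ⬝ᵥ (act A w).ofLp = (a ᵥ* A) ⬝ᵥ w.ofLp :=
  Matrix.dotProduct_mulVec _ _ _

theorem act_add_vecMulVec {n : ℕ} (A : Matrix (Fin n) (Fin n) ℂ) (a b : Fin n → ℂ)
    (w : EuclideanSpace ℂ (Fin n)) :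
    act (A + Matrix.vecMulVec a b) w = act A w + (b ⬝ᵥ w.ofLp) • WithLp.toLp 2 a := by
  ext i
  simp [act, Matrix.add_mulVec, Matrix.vecMulVec_mulVec, mul_comm]

/-- Needed because the relation quantifies over representatives: continuous representatives and
second derivatives of an H² class are unique. -/
theorem ErrorOp.mem_unique {P : PlantData nr nd} {K : Gains nr nd} {X Y Y' : StateSpace nr nd}
    (h : ErrorOp P K X Y) (h' : ErrorOp P K X Y') : Y = Y' := by
  obtain ⟨f, f1, f2, hf, -, -, ha, hb, hc⟩ := h
  obtain ⟨g, g1, g2, hg, -, -, ha', hb', hc'⟩ := h'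
  have e := hf.eqOn hg
  have e2 := hf.ae_eq_two hg
  have h3 : Y.snd.snd = Y'.snd.snd := by
    apply Lp.ext
    filter_upwards [hc, hc', e2, ae_restrict_mem measurableSet_Icc] with x h1 h2 h3 hx
    rw [h1, h2, h3, e hx, e one_mem_I]
  have h1 : Y.fst = Y'.fst := ha.trans ha'.symm
  have h2 : Y.snd.fst = Y'.snd.fst := by rw [hb, hb', e one_mem_I]
  exact WithLp.ofLp_injective 2 (Prod.ext h1 (WithLp.ofLp_injective 2 (Prod.ext h2 h3)))

theorem exists_profile_map {n : ℝ → Fin nd → ℂ} (hn : ∀ i, ContinuousOn (fun x => n x i) (Icc 0 1)) :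
    ∃ N : EuclideanSpace ℂ (Fin nd) →L[ℂ] L2I, ∀ w : EuclideanSpace ℂ (Fin nd),
      (N w : ℝ → ℂ) =ᵐ[mu01] fun x => n x ⬝ᵥ w.ofLp := by
  have hc : ∀ w : EuclideanSpace ℂ (Fin nd), ContinuousOn (fun x => n x ⬝ᵥ w.ofLp) (Icc 0 1) :=
    fun w => continuousOn_finsetSum _ fun i _ => (hn i).mul continuousOn_const
  refine ⟨LinearMap.toContinuousLinearMap
    { toFun := fun w => contClass _ (hc w)
      map_add' := fun w w' => Lp.ext ?_
      map_smul' := fun a w => Lp.ext ?_ }, fun w => contClass_ae _ (hc w)⟩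
  · filter_upwards [contClass_ae _ (hc (w + w')), contClass_ae _ (hc w), contClass_ae _ (hc w'),
      Lp.coeFn_add (contClass _ (hc w)) (contClass _ (hc w'))] with x h1 h2 h3 h4
    rw [h1, h4, Pi.add_apply, h2, h3, WithLp.ofLp_add, dotProduct_add]
  · filter_upwards [contClass_ae _ (hc (a • w)), contClass_ae _ (hc w),
      Lp.coeFn_smul a (contClass _ (hc w))] with x h1 h2 h4
    rw [h1, RingHom.id_apply, h4, Pi.smul_apply, h2, WithLp.ofLp_smul, dotProduct_smul]

theorem isH2Jet_profile {n n1 n2 : ℝ → Fin nd → ℂ} (hn2 : ContinuousOn n2 (Icc 0 1))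
    (hd : ∀ x ∈ Icc (0 : ℝ) 1, HasDerivWithinAt n (n1 x) (Icc 0 1) x)
    (hd1 : ∀ x ∈ Icc (0 : ℝ) 1, HasDerivWithinAt n1 (n2 x) (Icc 0 1) x) {F : L2I} (a : Fin nd → ℂ)
    (hF : (F : ℝ → ℂ) =ᵐ[mu01] fun x => n x ⬝ᵥ a) :
    IsH2Jet F (fun x => n x ⬝ᵥ a) (fun x => n1 x ⬝ᵥ a) (fun x => n2 x ⬝ᵥ a) := by
  have hdot : ∀ {u u' : ℝ → Fin nd → ℂ} {x : ℝ}, HasDerivWithinAt u (u' x) (Icc 0 1) x →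
      HasDerivWithinAt (fun x => u x ⬝ᵥ a) (u' x ⬝ᵥ a) (Icc 0 1) x := fun h =>
    HasDerivWithinAt.fun_sum fun i _ => (hasDerivWithinAt_pi.1 h i).mul_const _
  have hcont : ∀ {u : ℝ → Fin nd → ℂ}, ContinuousOn u (Icc 0 1) →
      ContinuousOn (fun x => u x ⬝ᵥ a) (Icc 0 1) := fun h =>
    continuousOn_finsetSum _ fun i _ => ((continuous_apply i).comp_continuousOn h).mul
      continuousOn_const
  exact ⟨hF, memLp_mu01_of_continuousOn (hcont hn2),
    primitive_of_hasDerivWithinAt (hcont fun x hx => (hd1 x hx).continuousWithinAt)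
      fun x hx => hdot (hd x hx),
    primitive_of_hasDerivWithinAt (hcont hn2) fun x hx => hdot (hd1 x hx)⟩

/-- The state `(w_r, w_d, z)` of the error system in terms of the target variables. -/
def observerEquiv (Φ : L2I ≃L[ℂ] L2I) (N : EuclideanSpace ℂ (Fin nd) →L[ℂ] L2I)
    (L : L2I →L[ℂ] EuclideanSpace ℂ (Fin nd)) :
    (EuclideanSpace ℂ (Fin nr) × (EuclideanSpace ℂ (Fin nd) × L2I)) ≃L[ℂ] StateSpace nr nd :=
  (((ContinuousLinearEquiv.refl ℂ (EuclideanSpace ℂ (Fin nr))).prodCongr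
    ((((ContinuousLinearEquiv.prodComm ℂ _ _).trans
      ((ContinuousLinearEquiv.refl ℂ L2I).skewProd (ContinuousLinearEquiv.refl ℂ _) (-L))).trans
      (ContinuousLinearEquiv.prodComm ℂ _ _)).trans
      (((ContinuousLinearEquiv.refl ℂ _).skewProd Φ ((Φ : L2I →L[ℂ] L2I).comp N)).trans
        (WithLp.prodContinuousLinearEquiv 2 ℂ _ _).symm)))).trans
    (WithLp.prodContinuousLinearEquiv 2 ℂ _ _).symm

theorem observerEquiv_apply (Φ : L2I ≃L[ℂ] L2I) (N : EuclideanSpace ℂ (Fin nd) →L[ℂ] L2I)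
    (L : L2I →L[ℂ] EuclideanSpace ℂ (Fin nd))
    (x : EuclideanSpace ℂ (Fin nr) × (EuclideanSpace ℂ (Fin nd) × L2I)) :
    observerEquiv Φ N L x =
      mkState x.1 (x.2.1 - L x.2.2) (Φ (x.2.2 + N (x.2.1 - L x.2.2))) := by
  have : observerEquiv Φ N L x =
      mkState x.1 (x.2.1 + -L x.2.2) (Φ x.2.2 + Φ (N (x.2.1 + -L x.2.2))) := rfl
  rw [this, ← map_add, ← sub_eq_add_neg]


/-- The functional `e ↦ (i/2) ∫ x² e(x) dx`, times the vector `l_d`. -/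
def momentMap (ld : Fin nd → ℂ) : L2I →L[ℂ] EuclideanSpace ℂ (Fin nd) :=
  ((Complex.I / 2) • pairing (fun x => (x : ℂ) ^ 2) (by fun_prop)).smulRight (WithLp.toLp 2 ld)

/-- The mean of `e`, times the vector `l_d`. -/
def meanMap (ld : Fin nd → ℂ) : L2I →L[ℂ] EuclideanSpace ℂ (Fin nd) :=
  (pairing (fun _ => 1) continuousOn_const).smulRight (WithLp.toLp 2 ld)

/-- Along the Neumann operator the moment map differentiates to the boundary value `e(1)`. -/
theorem momentMap_neumann (ld : Fin nd → ℂ) {c : ℝ} {F G : L2I} {e e1 e2 : ℝ → ℂ}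
    (he : IsH2Jet F e e1 e2) (h1 : e1 1 = 0)
    (hG : (G : ℝ → ℂ) =ᵐ[mu01] fun x => -Complex.I * e2 x - (c : ℂ) * e x) :
    momentMap ld G = meanMap ld F - (e 1) • WithLp.toLp 2 ld - (c : ℂ) • momentMap ld F := by
  -- The weight x² and its derivative vanish at 0, which removes all data there. With `e'(1) = 0`,
  -- Green's formula leaves `-2 e(1) + 2 ∫ e`; the factor i/2 normalizes the trace term to `-e(1)`.
  have hφ : ∀ x : ℝ, HasDerivAt (fun x : ℝ => (x : ℂ) ^ 2) (2 * (x : ℂ)) x := fun x => by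
    simpa using (hasDerivAt_id x).ofReal_comp.fun_pow 2
  have hφ1 : ∀ x : ℝ, HasDerivAt (fun x : ℝ => 2 * (x : ℂ)) 2 x := fun x => by
    simpa using (hasDerivAt_id x).ofReal_comp.const_mul (2 : ℂ)
  have hgreen := he.integral_mul_two hφ hφ1 continuous_const
  have hsq : ContinuousOn (fun x : ℝ => (x : ℂ) ^ 2) (uIcc 0 1) := by fun_prop
  have i1 : IntervalIntegrable (fun x : ℝ => (x : ℂ) ^ 2 * e2 x) volume 0 1 :=
    (intervalIntegrable_of_memLp he.memLp zero_mem_I one_mem_I).continuousOn_mul hsq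
  have i2 : IntervalIntegrable (fun x : ℝ => (x : ℂ) ^ 2 * e x) volume 0 1 :=
    (intervalIntegrable_of_continuousOn he.cont zero_mem_I one_mem_I).continuousOn_mul hsq
  have h2 : ∫ x in (0 : ℝ)..1, (x : ℂ) ^ 2 * (-Complex.I * e2 x - (c : ℂ) * e x) =
      -Complex.I * (∫ x in (0 : ℝ)..1, (x : ℂ) ^ 2 * e2 x) -
        c * ∫ x in (0 : ℝ)..1, (x : ℂ) ^ 2 * e x := by
    rw [← intervalIntegral.integral_const_mul, ← intervalIntegral.integral_const_mul,
      ← intervalIntegral.integral_sub (i1.const_mul _) (i2.const_mul _)]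
    congr 1
    funext x
    ring
  have key : Complex.I / 2 * pairing (fun x => (x : ℂ) ^ 2) (by fun_prop) G =
      pairing (fun _ => 1) continuousOn_const F - e 1 -
        c * (Complex.I / 2 * pairing (fun x => (x : ℂ) ^ 2) (by fun_prop) F) := by
    rw [pairing_eq _ hG, pairing_eq _ he.rep, pairing_eq _ he.rep, h2, hgreen, h1,
      intervalIntegral.integral_const_mul]
    simp only [one_mul, Complex.ofReal_one, Complex.ofReal_zero, mul_zero, zero_mul, sub_zero,
      mul_one]
    linear_combination (-1 / 2 * (-(2 * e 1) + 2 * ∫ x in (0 : ℝ)..1, e x)) * Complex.I_mul_I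
  simp only [momentMap, meanMap, ContinuousLinearMap.smulRight_apply,
    _root_.smul_apply, smul_eq_mul, key, smul_smul]
  module

/-- The operator of the target system. -/
def TargetOp (A : Matrix (Fin nr) (Fin nr) ℂ) (B : Matrix (Fin nd) (Fin nd) ℂ) (ld : Fin nd → ℂ)
    (c : ℝ) (x y : EuclideanSpace ℂ (Fin nr) × (EuclideanSpace ℂ (Fin nd) × L2I)) : Prop :=
  y.1 = act A x.1 ∧
  y.2.1 = act B x.2.1 +
    (meanMap ld x.2.2 - act B (momentMap ld x.2.2) - (c : ℂ) • momentMap ld x.2.2) ∧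
  NeumannOp c x.2.2 y.2.2

/-- In the shifted variable the e-component drives the disturbance equation through a bounded
operator, so the triangular construction applies; a second application with zero coupling adjoins
the reference part. -/
theorem exists_target_semigroup {A : Matrix (Fin nr) (Fin nr) ℂ} {B : Matrix (Fin nd) (Fin nd) ℂ}
    (ld : Fin nd → ℂ) {c : ℝ} (hc : 0 < c) (hA : IsHurwitz A) (hAs : HasSimpleEigenvalues A)
    (hB : IsHurwitz B) (hBs : HasSimpleEigenvalues B) :
    ∃ T : ℝ → (EuclideanSpace ℂ (Fin nr) × (EuclideanSpace ℂ (Fin nd) × L2I)) →L[ℂ]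
        (EuclideanSpace ℂ (Fin nr) × (EuclideanSpace ℂ (Fin nd) × L2I)),
      IsC0Semigroup T ∧ IsGeneratorOf (TargetOp A B ld c) T ∧ IsExpStable T := by
  obtain ⟨S, hS, hSG, hSb⟩ := exists_neumann_semigroup hc
  obtain ⟨T, hT, hTG, hTb⟩ := exists_triangular_semigroup (Matrix.toEuclideanCLM (𝕜 := ℂ) B)
    (meanMap ld - (Matrix.toEuclideanCLM (𝕜 := ℂ) B).comp (momentMap ld)
      - (c : ℂ) • momentMap ld) (isExpStable_exp_matrix hB hBs) hS hSG hSb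
  obtain ⟨U, hU, hUG, hUb⟩ := exists_triangular_semigroup (Matrix.toEuclideanCLM (𝕜 := ℂ) A)
    0 (isExpStable_exp_matrix hA hAs) hT hTG hTb
  refine ⟨U, hU, fun x y => ?_, hUb⟩
  rw [← hUG x y]
  simp only [TargetOp, _root_.zero_apply, add_zero]
  rfl

/-! ### Equivalence of the error system and the target system -/

theorem backstep_linear_comb {p : ℝ × ℝ → ℂ} (hp : ContinuousOn p triangle) {f1 f2 f3 f4 : ℝ → ℂ}
    (h1 : MemLp f1 2 mu01) (h2 : MemLp f2 2 mu01) (h3 : MemLp f3 2 mu01) (h4 : MemLp f4 2 mu01)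
    (a1 a2 a3 a4 : ℂ) {x : ℝ} (hx : x ∈ Icc (0 : ℝ) 1) :
    backstep p (fun x => a1 * f1 x + a2 * f2 x + a3 * f3 x + a4 * f4 x) x =
      a1 * backstep p f1 x + a2 * backstep p f2 x + a3 * backstep p f3 x + a4 * backstep p f4 x := by
  simp only [backstep_eq]
  have m1 := h1.const_mul a1
  have m2 := h2.const_mul a2
  have m3 := h3.const_mul a3
  rw [volt_add (f := fun x => a1 * f1 x + a2 * f2 x + a3 * f3 x) hp ((m1.add m2).add m3)
    (h4.const_mul a4) hx, volt_add (f := fun x => a1 * f1 x + a2 * f2 x) hp (m1.add m2) m3 hx,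
    volt_add hp m1 m2 hx, volt_const_mul, volt_const_mul, volt_const_mul, volt_const_mul]
  ring

variable {P : PlantData nr nd} {c : ℝ} {p px pξ : ℝ × ℝ → ℂ}

/-- The kernel's condition at x = 0 passes under the integral, so F_o turns the homogeneous Neumann
condition at 0 into the Robin condition of the plant. -/
theorem IsKernel.volt_left (hk : IsKernel P c p px pξ) (v : ℝ → ℂ) :
    volt px v 0 = -Complex.I * P.q * volt p v 0 := by
  have h : EqOn (fun ξ => px (0, ξ) * v ξ) (fun ξ => -Complex.I * P.q * (p (0, ξ) * v ξ))
      (uIcc 0 1) := fun ξ hξ => by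
    rw [uIcc_of_le (zero_le_one' ℝ)] at hξ
    simp only
    linear_combination v ξ * hk.left ξ hξ
  rw [volt, intervalIntegral.integral_congr h, intervalIntegral.integral_const_mul, volt]

theorem IsKernel.diag_zero (hk : IsKernel P c p px pξ) : p (0, 0) = -Complex.I * P.q := by
  rw [hk.diag 0 zero_mem_I]
  simp

/-- The boundary values of `F_o[v]`. -/
theorem IsKernel.backstep_bc_zero (hk : IsKernel P c p px pξ) (v : ℝ → ℂ) :
    p (0, 0) * v 0 - volt px v 0 = -Complex.I * P.q * backstep p v 0 := by
  rw [hk.diag_zero, hk.volt_left, backstep_eq]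
  ring

theorem volt_one (k : ℝ × ℝ → ℂ) (v : ℝ → ℂ) : volt k v 1 = 0 := by simp [volt]

theorem backstep_one (k : ℝ × ℝ → ℂ) (v : ℝ → ℂ) : backstep k v 1 = v 1 := by
  rw [backstep_eq, volt_one, sub_zero]

/-- Let v = e + nᵀw. Since e'(1) = n'(1) = 0, the intertwining relation leaves only the edge term i
p_ξ(x,1) v(1), which is compensated in `l`. As F_o[v](1) = v(1) and F_o[v]'(1) = p(1,1) v(1), the
condition at 1 holds with `l0 = p (1, 1)`. -/
theorem errorOp_of_target (hk : IsKernel P c p px pξ) (hh : ContinuousOn P.h (Icc 0 1))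
    {n n1 n2 : ℝ → Fin nd → ℂ} {γ : ℝ → ℂ} (hγ : ContinuousOn γ (Icc 0 1))
    (hγe : ∀ x ∈ Icc (0 : ℝ) 1, backstep p γ x = P.g x) (hn2 : ContinuousOn n2 (Icc 0 1))
    (hd : ∀ x ∈ Icc (0 : ℝ) 1, HasDerivWithinAt n (n1 x) (Icc 0 1) x)
    (hd1 : ∀ x ∈ Icc (0 : ℝ) 1, HasDerivWithinAt n1 (n2 x) (Icc 0 1) x)
    (hne : ∀ x ∈ Icc (0 : ℝ) 1, Complex.I • n2 x + n x ᵥ* P.Sd + (c : ℂ) • n x = γ x • P.qd1)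
    (hn0 : n1 0 = P.qd2) (hn1 : n1 1 = 0) {Φ : L2I ≃L[ℂ] L2I}
    (hΦ : ∀ (F : L2I) (f : ℝ → ℂ), (F : ℝ → ℂ) =ᵐ[mu01] f → (Φ F : ℝ → ℂ) =ᵐ[mu01] backstep p f)
    {N : EuclideanSpace ℂ (Fin nd) →L[ℂ] L2I}
    (hN : ∀ w : EuclideanSpace ℂ (Fin nd), (N w : ℝ → ℂ) =ᵐ[mu01] fun x => n x ⬝ᵥ w.ofLp)
    (lr : Fin nr → ℂ) (ld : Fin nd → ℂ)
    {x y : EuclideanSpace ℂ (Fin nr) × (EuclideanSpace ℂ (Fin nd) × L2I)}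
    (hxy : TargetOp (P.Sr + Matrix.vecMulVec lr P.qr) (P.Sd + Matrix.vecMulVec ld (n 1)) ld c x y) :
    ErrorOp P (designedGains p pξ n lr ld) (observerEquiv Φ N (momentMap ld) x)
      (observerEquiv Φ N (momentMap ld) y) := by
  obtain ⟨r, wt, F⟩ := x
  obtain ⟨r', wt', G⟩ := y
  obtain ⟨h1, h2, e, e1, e2, he, he0, he1, hG⟩ := hxy
  simp only at h1 h2 he hG
  rw [observerEquiv_apply, observerEquiv_apply]
  simp only
  set w := wt - momentMap ld F with hw
  have hnj := isH2Jet_profile hn2 hd hd1 w.ofLp (hN w)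
  have hnw := isH2Jet_profile hn2 hd hd1 ld (hN (WithLp.toLp 2 ld))
  have hvj := he.add hnj
  set v0 : ℝ → ℂ := fun x => e x + n x ⬝ᵥ w.ofLp with hv0
  -- Removing the moment brings back the trace `e 1`, which with the term `n(1)ᵀ w` from the
  -- closed-loop matrix adds up to `v0 1`, the measured error.
  have hw' : wt' - momentMap ld G = act P.Sd w + v0 1 • WithLp.toLp 2 ld := by
    have hact : act (P.Sd + Matrix.vecMulVec ld (n 1)) w =
        act (P.Sd + Matrix.vecMulVec ld (n 1)) wt -
          act (P.Sd + Matrix.vecMulVec ld (n 1)) (momentMap ld F) := by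
      simp only [← toEuclideanCLM_apply_eq_act, hw, map_sub]
    rw [act_add_vecMulVec] at hact
    have := momentMap_neumann ld he he1 hG
    rw [h2, this, hv0]
    simp only [add_smul]
    rw [← sub_eq_zero] at hact ⊢
    rw [← neg_eq_zero, ← hact]
    abel
  rw [hw']
  have hzj := hk.isH2Jet_backstep hh hvj (hΦ _ _ hvj.rep)
  refine ⟨_, _, _, hzj, ?_, ?_, h1, ?_, ?_⟩
  · rw [← hk.backstep_bc_zero]
    simp only [he0, hn0]
    change _ = _ + P.qd2 ⬝ᵥ w.ofLp
    ring
  · simp only [volt_one, backstep_one, he1, hn1, designedGains, zero_dotProduct]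
    ring
  · rw [backstep_one]
    rfl
  -- The profile equation, paired with `w`, replaces `n ⬝ᵥ (S_d w)` by the missing parts of `-i v''
  -- - c v` and the disturbance term `γ q_{d1}ᵀ w`.
  · have hsum : ((G + N (act P.Sd w + v0 1 • WithLp.toLp 2 ld) : L2I) : ℝ → ℂ) =ᵐ[mu01] fun x =>
        -Complex.I * (e2 x + n2 x ⬝ᵥ w.ofLp) + -(c : ℂ) * v0 x + (P.qd1 ⬝ᵥ w.ofLp) * γ x
          + v0 1 * (n x ⬝ᵥ ld) := by
      filter_upwards [Lp.coeFn_add G (N (act P.Sd w + v0 1 • WithLp.toLp 2 ld)), hG, hN _,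
        ae_restrict_mem measurableSet_Icc] with x k1 k2 k3 hx
      have k4 := congrArg (fun a => a ⬝ᵥ w.ofLp) (hne x hx)
      simp only [add_dotProduct, smul_dotProduct, smul_eq_mul] at k4
      rw [k1, Pi.add_apply, k2, k3, WithLp.ofLp_add, dotProduct_add, dotProduct_act,
        WithLp.ofLp_smul, dotProduct_smul, smul_eq_mul, hv0]
      simp only
      linear_combination k4
    refine (hΦ _ _ hsum).trans ?_
    refine ae_mu01_of_eqOn fun x hx => ?_
    rw [backstep_linear_comb hk.cont hvj.memLp (memLp_mu01_of_continuousOn hvj.cont)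
      (memLp_mu01_of_continuousOn hγ) (memLp_mu01_of_continuousOn hnw.cont) _ _ _ _ hx, hγe x hx,
      backstep_one, he1, hn1, zero_dotProduct]
    simp only [designedGains]
    change _ = _ + P.g x * (P.qd1 ⬝ᵥ w.ofLp) + _
    linear_combination (-(P.h x + c) * backstep p v0 x) * Complex.I_mul_I

/-- The domains correspond exactly: F_o⁻¹ preserves H², and the two boundary conditions of the error
system become e'(0) = 0 and e'(1) = 0. -/
theorem exists_neumannOp_of_errorOp (hk : IsKernel P c p px pξ) (hh : ContinuousOn P.h (Icc 0 1))
    {n n1 n2 : ℝ → Fin nd → ℂ} (hn2 : ContinuousOn n2 (Icc 0 1))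
    (hd : ∀ x ∈ Icc (0 : ℝ) 1, HasDerivWithinAt n (n1 x) (Icc 0 1) x)
    (hd1 : ∀ x ∈ Icc (0 : ℝ) 1, HasDerivWithinAt n1 (n2 x) (Icc 0 1) x)
    (hn0 : n1 0 = P.qd2) (hn1 : n1 1 = 0) {Φ : L2I ≃L[ℂ] L2I}
    (hΦ : ∀ (F : L2I) (f : ℝ → ℂ), (F : ℝ → ℂ) =ᵐ[mu01] f → (Φ F : ℝ → ℂ) =ᵐ[mu01] backstep p f)
    {N : EuclideanSpace ℂ (Fin nd) →L[ℂ] L2I}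
    (hN : ∀ w : EuclideanSpace ℂ (Fin nd), (N w : ℝ → ℂ) =ᵐ[mu01] fun x => n x ⬝ᵥ w.ofLp)
    {lr : Fin nr → ℂ} {ld : Fin nd → ℂ} {r : EuclideanSpace ℂ (Fin nr)}
    {w : EuclideanSpace ℂ (Fin nd)} {F : L2I} {Y : StateSpace nr nd}
    (h : ErrorOp P (designedGains p pξ n lr ld) (mkState r w (Φ (F + N w))) Y) :
    ∃ G, NeumannOp c F G := by
  obtain ⟨f, f1, f2, hf, hf0, hf1, -⟩ := h
  change IsH2Jet (Φ (F + N w)) f f1 f2 at hf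
  change f1 0 = -Complex.I * P.q * f 0 + P.qd2 ⬝ᵥ w.ofLp at hf0
  change f1 1 = p (1, 1) * f 1 at hf1
  obtain ⟨v, v1, v2, hv⟩ := hk.exists_isH2Jet_of_backstep hh hf (hΦ _ _ (ae_eq_refl _))
  have hz := hk.isH2Jet_backstep hh hv (hΦ _ _ hv.rep)
  have he := hv.sub (isH2Jet_profile hn2 hd hd1 w.ofLp (hN w))
  rw [add_sub_cancel_right] at he
  rw [hf.eqOn_one hz zero_mem_I, hf.eqOn hz zero_mem_I] at hf0
  simp only [hk.backstep_bc_zero] at hf0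
  rw [hf.eqOn_one hz one_mem_I, hf.eqOn hz one_mem_I] at hf1
  simp only [volt_one, backstep_one] at hf1
  have hm : MemLp (fun x => -Complex.I * (v2 x - n2 x ⬝ᵥ w.ofLp) - (c : ℂ) * (v x - n x ⬝ᵥ w.ofLp))
      2 mu01 := (he.memLp.const_mul _).sub ((memLp_mu01_of_continuousOn he.cont).const_mul _)
  refine ⟨hm.toLp _, _, _, _, he, ?_, ?_, MemLp.coeFn_toLp hm⟩
  · simp only [hn0]
    linear_combination hf0
  · simp only [hn1, zero_dotProduct]
    linear_combination hf1

/-- The state transformation maps the target operator to the error operator. -/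
theorem errorOp_iff_targetOp (hk : IsKernel P c p px pξ) (hh : ContinuousOn P.h (Icc 0 1))
    {n : ℝ → Fin nd → ℂ} (hn : IsProfile P c p n) {Φ : L2I ≃L[ℂ] L2I}
    (hΦ : ∀ (F : L2I) (f : ℝ → ℂ), (F : ℝ → ℂ) =ᵐ[mu01] f → (Φ F : ℝ → ℂ) =ᵐ[mu01] backstep p f)
    {N : EuclideanSpace ℂ (Fin nd) →L[ℂ] L2I}
    (hN : ∀ w : EuclideanSpace ℂ (Fin nd), (N w : ℝ → ℂ) =ᵐ[mu01] fun x => n x ⬝ᵥ w.ofLp)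
    (lr : Fin nr → ℂ) (ld : Fin nd → ℂ) (X Y : StateSpace nr nd) :
    ErrorOp P (designedGains p pξ n lr ld) X Y ↔
      TargetOp (P.Sr + Matrix.vecMulVec lr P.qr) (P.Sd + Matrix.vecMulVec ld (n 1)) ld c
        ((observerEquiv Φ N (momentMap ld)).symm X) ((observerEquiv Φ N (momentMap ld)).symm Y) := by
  obtain ⟨γ, n1, n2, hγ, hγe, hn2, hd, hd1, hne, hn0, hn1⟩ := hn
  set Θ := observerEquiv (nr := nr) Φ N (momentMap ld) with hΘ
  have hback : ∀ x y, TargetOp (P.Sr + Matrix.vecMulVec lr P.qr) (P.Sd + Matrix.vecMulVec ld (n 1))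
      ld c x y → ErrorOp P (designedGains p pξ n lr ld) (Θ x) (Θ y) := fun x y h =>
    errorOp_of_target hk hh hγ hγe hn2 hd hd1 hne hn0 hn1 hΦ hN lr ld h
  constructor
  · intro h
    obtain ⟨x, rfl⟩ := Θ.surjective X
    have h' := h
    rw [hΘ, observerEquiv_apply] at h'
    -- Only the domain has to be pulled back. The implication already proved then yields an image of
    -- `X`, and single-valuedness identifies it with `Y`.
    obtain ⟨G, hG⟩ := exists_neumannOp_of_errorOp hk hh hn2 hd hd1 hn0 hn1 hΦ hN h'
    have h1 := hback x ⟨_, _, G⟩ ⟨rfl, rfl, hG⟩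
    rw [h.mem_unique h1, Θ.symm_apply_apply, Θ.symm_apply_apply]
    exact ⟨rfl, rfl, hG⟩
  · intro h
    simpa using hback _ _ h

theorem exists_error_semigroup (hk : IsKernel P c p px pξ) (hc : 0 < c)
    (hh : ContinuousOn P.h (Icc 0 1)) {n : ℝ → Fin nd → ℂ} (hn : IsProfile P c p n)
    {lr : Fin nr → ℂ} {ld : Fin nd → ℂ} (hA : IsHurwitz (P.Sr + Matrix.vecMulVec lr P.qr))
    (hB : IsHurwitz (P.Sd + Matrix.vecMulVec ld (n 1)))
    (hAs : HasSimpleEigenvalues (P.Sr + Matrix.vecMulVec lr P.qr))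
    (hBs : HasSimpleEigenvalues (P.Sd + Matrix.vecMulVec ld (n 1))) :
    ∃ T : ℝ → StateSpace nr nd →L[ℂ] StateSpace nr nd, IsC0Semigroup T ∧
      IsGeneratorOf (ErrorOp P (designedGains p pξ n lr ld)) T ∧ IsExpStable T := by
  obtain ⟨Φ, hΦ⟩ := exists_volterra_equiv hk.cont
  have hnc : ∀ i, ContinuousOn (fun x => n x i) (Icc 0 1) := by
    obtain ⟨γ, n1, n2, -, -, -, hd, -⟩ := hn
    exact fun i x hx => (hasDerivWithinAt_pi.1 (hd x hx) i).continuousWithinAt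
  obtain ⟨N, hN⟩ := exists_profile_map hnc
  obtain ⟨T, hT, hG, hTb⟩ := exists_target_semigroup ld hc hA hAs hB hBs
  refine ⟨conjFamily (observerEquiv Φ N (momentMap ld)) T, hT.conj _, fun X Y => ?_, hTb.conj _⟩
  rw [errorOp_iff_targetOp hk hh hn hΦ hN lr ld X Y]
  exact hG.conj _ X Y

/-! ### The observer error -/

/-- `mkState` as a bounded operator. -/
def mkStateCLM : EuclideanSpace ℂ (Fin nr) × (EuclideanSpace ℂ (Fin nd) × L2I) →L[ℂ]
    StateSpace nr nd :=
  (((ContinuousLinearEquiv.refl ℂ (EuclideanSpace ℂ (Fin nr))).prodCongr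
    (WithLp.prodContinuousLinearEquiv 2 ℂ _ _).symm).trans
    (WithLp.prodContinuousLinearEquiv 2 ℂ _ _).symm : _ ≃L[ℂ] StateSpace nr nd)

/-- The first component of a state. -/
def fstCLM : StateSpace nr nd →L[ℂ] EuclideanSpace ℂ (Fin nr) := WithLp.fstL 2 ℂ _ _

/-- The second component of a state. -/
def sndCLM : StateSpace nr nd →L[ℂ] EuclideanSpace ℂ (Fin nd) :=
  (WithLp.fstL 2 ℂ _ _).comp (WithLp.sndL 2 ℂ _ _)

/-- The third component of a state. -/
def trdCLM : StateSpace nr nd →L[ℂ] L2I := (WithLp.sndL 2 ℂ _ _).comp (WithLp.sndL 2 ℂ _ _)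

theorem act_sub {n : ℕ} (A : Matrix (Fin n) (Fin n) ℂ) (v w : EuclideanSpace ℂ (Fin n)) :
    act A (v - w) = act A v - act A w := by
  simp only [← toEuclideanCLM_apply_eq_act, map_sub]

theorem act_add {n : ℕ} (A : Matrix (Fin n) (Fin n) ℂ) (v w : EuclideanSpace ℂ (Fin n)) :
    act A (v + w) = act A v + act A w := by
  simp only [← toEuclideanCLM_apply_eq_act, map_add]

theorem hasDerivWithinAt_mkState {wr : ℝ → EuclideanSpace ℂ (Fin nr)}
    {wd : ℝ → EuclideanSpace ℂ (Fin nd)} {z : ℝ → L2I} {a : EuclideanSpace ℂ (Fin nr)}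
    {b : EuclideanSpace ℂ (Fin nd)} {F : L2I} {s : Set ℝ} {t : ℝ} (h1 : HasDerivWithinAt wr a s t)
    (h2 : HasDerivWithinAt wd b s t) (h3 : HasDerivWithinAt z F s t) :
    HasDerivWithinAt (fun t => mkState (wr t) (wd t) (z t)) (mkState a b F) s t :=
  (mkStateCLM.restrictScalars ℝ).hasFDerivAt.comp_hasDerivWithinAt t (h1.prodMk (h2.prodMk h3))

variable {P : PlantData nr nd} {K : Gains nr nd}

/-- The input cancels in the difference, and `y t` is the plant trace `f 1`, so each injection term
becomes the trace of the error. -/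
theorem exists_errorOp_obsError {wr wd z u y wrh wdh zh} (hp : IsPlantSolution P wr wd z u y)
    (ho : IsObserverSolution P K (fun t => P.qr ⬝ᵥ (wr t).ofLp) u y wrh wdh zh) {t : ℝ}
    (ht : 0 ≤ t) :
    ∃ Y, ErrorOp P K (obsError wr wd z wrh wdh zh t) Y ∧
      HasDerivWithinAt (obsError wr wd z wrh wdh zh) Y (Ici 0) t := by
  obtain ⟨z', -, hz'⟩ := hp.pde
  obtain ⟨hzd, f, f1, f2, hf, hfz, hf0, hf1, hy⟩ := hz' t ht
  obtain ⟨zh', -, hzh'⟩ := ho.pde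
  obtain ⟨hzhd, g, g1, g2, hg, hwd, hgz, hg0, hg1⟩ := hzh' t ht
  have hr : act P.Sr (wrh t) + (P.qr ⬝ᵥ (wrh t).ofLp - P.qr ⬝ᵥ (wr t).ofLp) • WithLp.toLp 2 K.lr
      - act P.Sr (wr t) = act (P.Sr + Matrix.vecMulVec K.lr P.qr) (wrh t - wr t) := by
    rw [act_add_vecMulVec, act_sub, WithLp.ofLp_sub, dotProduct_sub]
    abel
  have hd : act P.Sd (wdh t) + (g 1 - y t) • WithLp.toLp 2 K.ld - act P.Sd (wd t) =
      act P.Sd (wdh t - wd t) + (g 1 - f 1) • WithLp.toLp 2 K.ld := by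
    rw [act_sub, hy]
    abel
  refine ⟨_, ⟨_, _, _, hg.sub hf, ?_, ?_, ?_, ?_, ?_⟩, hasDerivWithinAt_mkState
    (((ho.ode_r t ht).sub (hp.ode_r t ht)).congr_deriv hr)
    ((hwd.sub (hp.ode_d t ht)).congr_deriv hd) (hzhd.sub hzd)⟩
  · change _ = _ + P.qd2 ⬝ᵥ (wdh t - wd t).ofLp
    rw [WithLp.ofLp_sub, dotProduct_sub, hg0, hf0]
    ring
  · rw [hg1, hf1, hy]
    ring
  · rfl
  · rfl
  · change ((zh' t - z' t : L2I) : ℝ → ℂ) =ᵐ[mu01] fun x => -Complex.I * (g2 x - f2 x) +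
      P.h x * (g x - f x) + P.g x * (P.qd1 ⬝ᵥ (wdh t - wd t).ofLp) + K.l x * (g 1 - f 1)
    filter_upwards [Lp.coeFn_sub (zh' t) (z' t), hgz, hfz] with x h1 h2 h3
    rw [h1, Pi.sub_apply, h2, h3, WithLp.ofLp_sub, dotProduct_sub, hy]
    ring

/-- The plant state plus a classical orbit of the error system solves the observer equations. -/
theorem isObserverSolution_add {wr wd z u y} (hp : IsPlantSolution P wr wd z u y)
    {T : ℝ → StateSpace nr nd →L[ℂ] StateSpace nr nd} (hT : IsC0Semigroup T)
    (hG : IsGeneratorOf (ErrorOp P K) T) {X Y : StateSpace nr nd} (hX : ErrorOp P K X Y) :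
    IsObserverSolution P K (fun t => P.qr ⬝ᵥ (wr t).ofLp) u y (fun t => wr t + (T t X).fst)
      (fun t => wd t + (T t X).snd.fst) (fun t => z t + (T t X).snd.snd) := by
  have hder : ∀ t, 0 ≤ t → HasDerivWithinAt (fun s => T s X) (T t Y) (Ici 0) t := fun t ht =>
    hG.hasDerivWithinAt hT hX ht
  have hder1 : ∀ t, 0 ≤ t → HasDerivWithinAt (fun s => (T s X).fst) (T t Y).fst (Ici 0) t :=
    fun t ht => (fstCLM.restrictScalars ℝ).hasFDerivAt.comp_hasDerivWithinAt t (hder t ht)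
  have hder2 : ∀ t, 0 ≤ t → HasDerivWithinAt (fun s => (T s X).snd.fst) (T t Y).snd.fst (Ici 0) t :=
    fun t ht => (sndCLM.restrictScalars ℝ).hasFDerivAt.comp_hasDerivWithinAt t (hder t ht)
  have hder3 : ∀ t, 0 ≤ t → HasDerivWithinAt (fun s => (T s X).snd.snd) (T t Y).snd.snd (Ici 0) t :=
    fun t ht => (trdCLM.restrictScalars ℝ).hasFDerivAt.comp_hasDerivWithinAt t (hder t ht)
  obtain ⟨z', hz'c, hz'⟩ := hp.pde
  refine ⟨fun t ht => ?_, fun t => z' t + (T t Y).snd.snd,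
    hz'c.add (trdCLM.continuous.comp_continuousOn (hT.cont Y)), fun t ht => ?_⟩
  · obtain ⟨g, g1, g2, hg, hg0, hg1, ha, hb, hc⟩ := hG.orbit_mem hT hX ht
    refine ((hp.ode_r t ht).add (hder1 t ht)).congr_deriv ?_
    rw [ha, act_add_vecMulVec, act_add, WithLp.ofLp_add, dotProduct_add, add_sub_cancel_left,
      add_assoc]
  · obtain ⟨g, g1, g2, hg, hg0, hg1, ha, hb, hc⟩ := hG.orbit_mem hT hX ht
    obtain ⟨hzd, f, f1, f2, hf, hfz, hf0, hf1, hy⟩ := hz' t ht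
    refine ⟨hzd.add (hder3 t ht), _, _, _, hf.add hg, ?_, ?_, ?_, ?_⟩
    · refine ((hp.ode_d t ht).add (hder2 t ht)).congr_deriv ?_
      rw [hb, act_add, hy, add_sub_cancel_left, add_assoc]
    · filter_upwards [Lp.coeFn_add (z' t) (T t Y).snd.snd, hfz, hc] with x h1 h2 h3
      rw [h1, Pi.add_apply, h2, h3, WithLp.ofLp_add, dotProduct_add, hy]
      ring
    · rw [WithLp.ofLp_add, dotProduct_add, hg0, hf0]
      ring
    · rw [hg1, hf1, hy]
      ring

/-- Compatible initial states have their error in the domain of the error operator. -/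
theorem exists_errorOp_of_compatible (hh : ContinuousOn P.h (Icc 0 1))
    (hg : ContinuousOn P.g (Icc 0 1)) (hl : ContinuousOn K.l (Icc 0 1)) {wr wd z u y}
    (hp : IsPlantSolution P wr wd z u y) (a : EuclideanSpace ℂ (Fin nr))
    {b : EuclideanSpace ℂ (Fin nd)} {F : L2I} (hc : ObserverCompatible P K (u 0) (y 0) b F) :
    ∃ Y, ErrorOp P K (mkState (a - wr 0) (b - wd 0) (F - z 0)) Y := by
  obtain ⟨z', -, hz'⟩ := hp.pde
  obtain ⟨-, f, f1, f2, hf, -, hf0, hf1, hy⟩ := hz' 0 le_rfl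
  obtain ⟨k, k1, k2, hk, hk0, hk1⟩ := hc
  have hj := hk.sub hf
  have hm : MemLp (fun x => -Complex.I * (k2 x - f2 x) + P.h x * (k x - f x) +
      P.g x * (P.qd1 ⬝ᵥ (b - wd 0).ofLp) + K.l x * (k 1 - f 1)) 2 mu01 :=
    (((hj.memLp.const_mul _).add (memLp_mu01_of_continuousOn (hh.mul hj.cont))).add
      (memLp_mu01_of_continuousOn (hg.mul continuousOn_const))).add
      (memLp_mu01_of_continuousOn (hl.mul continuousOn_const))
  refine ⟨mkState (act (P.Sr + Matrix.vecMulVec K.lr P.qr) (a - wr 0))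
    (act P.Sd (b - wd 0) + (k 1 - f 1) • WithLp.toLp 2 K.ld) (hm.toLp _),
    _, _, _, hj, ?_, ?_, rfl, rfl, MemLp.coeFn_toLp hm⟩
  · change _ = _ + P.qd2 ⬝ᵥ (b - wd 0).ofLp
    rw [WithLp.ofLp_sub, dotProduct_sub, hk0, hf0]
    ring
  · rw [hk1, hf1, hy]
    ring

/-! ### Uniform limits -/

theorem ConvUniform.tendsto {E : Type*} [NormedAddCommGroup E] {a : ℕ → ℝ → E} {b : ℝ → E}
    (h : ConvUniform a b) {t : ℝ} (ht : 0 ≤ t) : Tendsto (fun k => a k t) atTop (𝓝 (b t)) :=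
  (h t).tendsto_at ⟨ht, le_rfl⟩

theorem ConvUniform.add {E : Type*} [NormedAddCommGroup E] {a a' : ℕ → ℝ → E} {b b' : ℝ → E}
    (h : ConvUniform a b) (h' : ConvUniform a' b') :
    ConvUniform (fun k t => a k t + a' k t) (fun t => b t + b' t) := fun τ => (h τ).add (h' τ)

theorem ConvUniform.clm {E F : Type*} [NormedAddCommGroup E] [NormedSpace ℂ E]
    [NormedAddCommGroup F] [NormedSpace ℂ F] {a : ℕ → ℝ → E} {b : ℝ → E} (h : ConvUniform a b)
    (L : E →L[ℂ] F) : ConvUniform (fun k t => L (a k t)) (fun t => L (b t)) := fun τ =>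
  L.uniformContinuous.comp_tendstoUniformlyOn (h τ)

theorem convUniform_semigroup {E : Type*} [NormedAddCommGroup E] [NormedSpace ℂ E]
    {T : ℝ → E →L[ℂ] E} {M : ℝ} (hM : ∀ t : ℝ, 0 ≤ t → ∀ x, ‖T t x‖ ≤ M * ‖x‖) {X : ℕ → E} {x : E}
    (hX : Tendsto X atTop (𝓝 x)) : ConvUniform (fun k t => T t (X k)) (fun t => T t x) := by
  intro τ
  rw [Metric.tendstoUniformlyOn_iff]
  intro ε hε
  have h0 : Tendsto (fun k => M * ‖x - X k‖) atTop (𝓝 0) := by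
    have := ((tendsto_const_nhds (x := x)).sub hX).norm.const_mul M
    simpa using this
  filter_upwards [h0.eventually (gt_mem_nhds hε)] with k hk t ht
  rw [dist_eq_norm, ← map_sub]
  exact (hM t ht.1 _).trans_lt hk

theorem eq_apply_of_tendsto {E : Type*} [NormedAddCommGroup E] [NormedSpace ℂ E] {T : E →L[ℂ] E}
    {a b : ℕ → E} {x y : E} (ha : Tendsto a atTop (𝓝 x)) (hb : Tendsto b atTop (𝓝 y))
    (h : ∀ k, a k = T (b k)) : x = T y :=
  tendsto_nhds_unique ha (((T.continuous.tendsto y).comp hb).congr fun k => (h k).symm)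

/-! ### Solutions of the coupled system -/

section Semigroup

variable {T : ℝ → StateSpace nr nd →L[ℂ] StateSpace nr nd} {M : ℝ}

theorem obsError_eq (hT : IsC0Semigroup T) (hG : IsGeneratorOf (ErrorOp P K) T)
    (hM : ∀ t : ℝ, 0 ≤ t → ∀ x, ‖T t x‖ ≤ M * ‖x‖) {wr wd z u y wrh wdh zh}
    (hp : IsPlantSolution P wr wd z u y)
    (ho : IsObserverSolution P K (fun t => P.qr ⬝ᵥ (wr t).ofLp) u y wrh wdh zh) {t : ℝ}
    (ht : 0 ≤ t) :
    obsError wr wd z wrh wdh zh t = T t (obsError wr wd z wrh wdh zh 0) := by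
  choose! Y hY hY' using fun t ht => exists_errorOp_obsError hp ho (t := t) ht
  exact hG.eq_orbit hT hM hY' hY ht

/-- The orbit identity is closed under pointwise limits at the times `t` and 0, because each `T t`
is continuous. -/
theorem obsError_eq_of_generalized (hT : IsC0Semigroup T) (hG : IsGeneratorOf (ErrorOp P K) T)
    (hM : ∀ t : ℝ, 0 ≤ t → ∀ x, ‖T t x‖ ≤ M * ‖x‖) {wr wd z u y wrh wdh zh}
    (h : IsGenCoupledSolution P K wr wd z u y wrh wdh zh) {t : ℝ} (ht : 0 ≤ t) :
    obsError wr wd z wrh wdh zh t = T t (obsError wr wd z wrh wdh zh 0) := by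
  obtain ⟨wrk, wdk, zk, uk, yk, wrhk, wdhk, zhk, hk, h1, h2, h3, -, -, h4, h5, h6⟩ := h
  have hlim : ∀ s, 0 ≤ s → Tendsto (fun k => obsError (wrk k) (wdk k) (zk k) (wrhk k) (wdhk k)
      (zhk k) s) atTop (𝓝 (obsError wr wd z wrh wdh zh s)) := fun s hs =>
    (mkStateCLM.continuous.tendsto _).comp (((h4.tendsto hs).sub (h1.tendsto hs)).prodMk_nhds
      (((h5.tendsto hs).sub (h2.tendsto hs)).prodMk_nhds ((h6.tendsto hs).sub (h3.tendsto hs))))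
  exact eq_apply_of_tendsto (hlim t ht) (hlim 0 le_rfl)
    fun k => obsError_eq hT hG hM (hk k).1 (hk k).2 ht

theorem eq_of_obsError_eq {wr wd z wrh wdh zh} {t : ℝ} {X : StateSpace nr nd}
    (h : obsError wr wd z wrh wdh zh t = X) :
    wrh t = wr t + X.fst ∧ wdh t = wd t + X.snd.fst ∧ zh t = z t + X.snd.snd := by
  subst h
  exact ⟨(add_sub_cancel _ _).symm, (add_sub_cancel _ _).symm, (add_sub_cancel _ _).symm⟩

/-- The initial error is approximated from the domain of the generator, and the resulting orbits are
added to the approximating plant solutions; inputs and outputs stay the same, and the uniform bound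
on `T` makes the orbits converge uniformly. -/
theorem exists_generalized_observer (hT : IsC0Semigroup T) (hG : IsGeneratorOf (ErrorOp P K) T)
    (hM : ∀ t : ℝ, 0 ≤ t → ∀ x, ‖T t x‖ ≤ M * ‖x‖) {wr wd z u y}
    (h : IsGenPlantSolution P wr wd z u y) (X : StateSpace nr nd) :
    IsGenCoupledSolution P K wr wd z u y (fun t => wr t + (T t X).fst)
      (fun t => wd t + (T t X).snd.fst) (fun t => z t + (T t X).snd.snd) := by
  obtain ⟨wrk, wdk, zk, uk, yk, hk, h1, h2, h3, h4, h5⟩ := h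
  obtain ⟨Xk, Yk, hXY, hX⟩ := hG.exists_seq_tendsto hT X
  have hc := convUniform_semigroup hM hX
  exact ⟨wrk, wdk, zk, uk, yk, _, _, _,
    fun k => ⟨hk k, isObserverSolution_add (hk k) hT hG (hXY k)⟩, h1, h2, h3, h4, h5,
    h1.add (hc.clm fstCLM), h2.add (hc.clm sndCLM), h3.add (hc.clm trdCLM)⟩

end Semigroup

theorem IsKernel.continuousOn_gain {P : PlantData nr nd} {c : ℝ} {p px pξ : ℝ × ℝ → ℂ}
    (hk : IsKernel P c p px pξ) {n : ℝ → Fin nd → ℂ} (hn : IsProfile P c p n) (lr : Fin nr → ℂ)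
    (ld : Fin nd → ℂ) : ContinuousOn (designedGains p pξ n lr ld).l (Icc 0 1) := by
  obtain ⟨γ, n1, n2, -, -, -, hd, -⟩ := hn
  have hnc : ContinuousOn (fun x => n x ⬝ᵥ ld) (Icc 0 1) :=
    continuousOn_finsetSum _ fun i _ => ContinuousOn.mul
      (fun x hx => (hasDerivWithinAt_pi.1 (hd x hx) i).continuousWithinAt) continuousOn_const
  exact (continuousOn_backstep hk.cont hnc).sub (continuousOn_const.mul
    (hk.cont_ξ.comp (f := fun t : ℝ => (t, (1 : ℝ))) (by fun_prop) fun _ ht => ⟨ht.1, ht.2, le_rfl⟩))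

end SchObs

end

/-! ### Assembly of the main theorem -/

theorem theorem5p1 {nr nd : ℕ} (P : PlantData nr nd) (co : ℝ)
    (hq : 0 < P.q) (hco : 0 < co)
    (hh : ContinuousOn P.h (Icc 0 1)) (hg : ContinuousOn P.g (Icc 0 1))
    (hspec : ∀ j : ℕ,
      (Complex.I * ((j : ℂ) * (Real.pi : ℂ)) ^ 2 - (co : ℂ)) ∉ spectrum ℂ P.Sd) :
    -- the kernel exists and is unique
    ∃ p px pξ : ℝ × ℝ → ℂ, IsKernel P co p px pξ ∧
      (∀ p' px' pξ' : ℝ × ℝ → ℂ, IsKernel P co p' px' pξ' →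
        EqOn p' p triangle ∧ EqOn px' px triangle ∧ EqOn pξ' pξ triangle) ∧
    -- the function used in the gains exists and is unique
    ∃ n : ℝ → Fin nd → ℂ, IsProfile P co p n ∧
      (∀ n' : ℝ → Fin nd → ℂ, IsProfile P co p n' → EqOn n' n (Icc 0 1)) ∧
    ∀ (lr : Fin nr → ℂ) (ld : Fin nd → ℂ),
      IsHurwitz (P.Sr + Matrix.vecMulVec lr P.qr) →
      IsHurwitz (P.Sd + Matrix.vecMulVec ld (n 1)) →
      HasSimpleEigenvalues (P.Sr + Matrix.vecMulVec lr P.qr) →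
      HasSimpleEigenvalues (P.Sd + Matrix.vecMulVec ld (n 1)) →
      Disjoint (spectrum ℂ (P.Sr + Matrix.vecMulVec lr P.qr))
        (spectrum ℂ (P.Sd + Matrix.vecMulVec ld (n 1))) →
      ∃ (T : ℝ → StateSpace nr nd →L[ℂ] StateSpace nr nd) (M μ : ℝ), 1 ≤ M ∧ 0 < μ ∧
        -- the error dynamics is governed by an exponentially stable semigroup
        IsC0Semigroup T ∧
        IsGeneratorOf (ErrorOp P (designedGains p pξ n lr ld)) T ∧
        (∀ t : ℝ, 0 ≤ t → ∀ X : StateSpace nr nd, ‖T t X‖ ≤ M * Real.exp (-μ * t) * ‖X‖) ∧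
        -- along every solution the observer error follows that semigroup and decays exponentially
        (∀ wr wd z u y wrh wdh zh,
          IsGenCoupledSolution P (designedGains p pξ n lr ld) wr wd z u y wrh wdh zh →
          ∀ t : ℝ, 0 ≤ t →
            obsError wr wd z wrh wdh zh t = T t (obsError wr wd z wrh wdh zh 0) ∧
            ‖obsError wr wd z wrh wdh zh t‖ ≤
              M * Real.exp (-μ * t) * ‖obsError wr wd z wrh wdh zh 0‖) ∧
        -- the observer can be started in any state, and its evolution is unique
        (∀ wr wd z u y, IsGenPlantSolution P wr wd z u y →
          ∀ (a : EuclideanSpace ℂ (Fin nr)) (b : EuclideanSpace ℂ (Fin nd)) (F : L2I),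
            ∃ wrh wdh zh,
              IsGenCoupledSolution P (designedGains p pξ n lr ld) wr wd z u y wrh wdh zh ∧
              wrh 0 = a ∧ wdh 0 = b ∧ zh 0 = F ∧
              ∀ wrh' wdh' zh',
                IsGenCoupledSolution P (designedGains p pξ n lr ld) wr wd z u y wrh' wdh' zh' →
                wrh' 0 = a → wdh' 0 = b → zh' 0 = F →
                EqOn wrh' wrh (Ici 0) ∧ EqOn wdh' wdh (Ici 0) ∧ EqOn zh' zh (Ici 0)) ∧
        -- the same for classical solutions and compatible initial states
        (∀ wr wd z u y, IsPlantSolution P wr wd z u y →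
          ∀ (a : EuclideanSpace ℂ (Fin nr)) (b : EuclideanSpace ℂ (Fin nd)) (F : L2I),
            ObserverCompatible P (designedGains p pξ n lr ld) (u 0) (y 0) b F →
            ∃ wrh wdh zh,
              IsObserverSolution P (designedGains p pξ n lr ld)
                (fun t => P.qr ⬝ᵥ (wr t).ofLp) u y wrh wdh zh ∧
              wrh 0 = a ∧ wdh 0 = b ∧ zh 0 = F ∧
              ∀ wrh' wdh' zh',
                IsObserverSolution P (designedGains p pξ n lr ld)
                  (fun t => P.qr ⬝ᵥ (wr t).ofLp) u y wrh' wdh' zh' →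
                wrh' 0 = a → wdh' 0 = b → zh' 0 = F →
                EqOn wrh' wrh (Ici 0) ∧ EqOn wdh' wdh (Ici 0) ∧ EqOn zh' zh (Ici 0)) := by
  obtain ⟨p, px, pξ, hk⟩ := exists_isKernel P co hh
  refine ⟨p, px, pξ, hk, fun p' px' pξ' hk' => hk.unique hh hk', ?_⟩
  obtain ⟨n, hn⟩ := exists_isProfile P hk.cont hg hspec
  refine ⟨n, hn, fun n' hn' => hn.unique hk.cont hspec hn', ?_⟩
  intro lr ld hA hB hAs hBs _
  obtain ⟨T, hT, hG, M, μ, hM, hμ, hTb⟩ := exists_error_semigroup hk hco hh hn hA hB hAs hBs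
  have hTM : ∀ t : ℝ, 0 ≤ t → ∀ X, ‖T t X‖ ≤ M * ‖X‖ := fun t ht X => by
    refine (hTb t ht X).trans (mul_le_mul_of_nonneg_right ?_ (norm_nonneg X))
    refine mul_le_of_le_one_right (zero_le_one.trans hM) (Real.exp_le_one_iff.2 ?_)
    rw [neg_mul, neg_nonpos]
    exact mul_nonneg hμ.le ht
  have hl := hk.continuousOn_gain hn lr ld
  have hzero : ∀ X, T 0 X = X := fun X => by rw [hT.zero]; rfl
  refine ⟨T, M, μ, hM, hμ, hT, hG, hTb, ?_, ?_, ?_⟩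
  · intro wr wd z u y wrh wdh zh hs t ht
    have h := obsError_eq_of_generalized hT hG hTM hs ht
    exact ⟨h, h ▸ hTb t ht _⟩
  · intro wr wd z u y hp a b F
    -- The orbit starts at the prescribed observer state minus the initial plant state, so that
    -- plant plus orbit starts where required.
    refine ⟨_, _, _, exists_generalized_observer hT hG hTM hp
      (mkState (a - wr 0) (b - wd 0) (F - z 0)), ?_, ?_, ?_, ?_⟩
    · rw [hzero]; exact add_sub_cancel _ _
    · rw [hzero]; exact add_sub_cancel _ _
    · rw [hzero]; exact add_sub_cancel _ _
    · rintro wrh' wdh' zh' hs rfl rfl rfl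
      -- Any competitor has the same initial error, hence the same error orbit, and the plant
      -- trajectory is given.
      have h := fun t (ht : 0 ≤ t) => eq_of_obsError_eq (obsError_eq_of_generalized hT hG hTM hs ht)
      exact ⟨fun t ht => (h t ht).1, fun t ht => (h t ht).2.1, fun t ht => (h t ht).2.2⟩
  · intro wr wd z u y hp a b F hc
    obtain ⟨Y, hY⟩ := exists_errorOp_of_compatible hh hg hl hp a hc
    refine ⟨_, _, _, isObserverSolution_add hp hT hG hY, ?_, ?_, ?_, ?_⟩
    · rw [hzero]; exact add_sub_cancel _ _
    · rw [hzero]; exact add_sub_cancel _ _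
    · rw [hzero]; exact add_sub_cancel _ _
    · rintro wrh' wdh' zh' hs rfl rfl rfl
      have h := fun t (ht : 0 ≤ t) => eq_of_obsError_eq (obsError_eq hT hG hTM hp hs ht)
      exact ⟨fun t ht => (h t ht).1, fun t ht => (h t ht).2.1, fun t ht => (h t ht).2.2⟩
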